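/- Let $m\ge 0$ be an integer, $n=m+1$, $\delta\in\{0,1\}\cong\mathbb Z/2\mathbb Z$, and let $\omega((x,\xi),(y,\eta))=\langle \xi,y\rangle-\langle x,\eta\rangle$ be the standard symplectic form on $\mathbb R^{2n}=\mathbb R^n\times\mathbb R^n$. For $\mu\in\mathbb C$ let $V^\infty_{\mu,\delta}$ be the space of smooth functions $f$ on $\mathbb R^{2n}\setminus\{0\}$ with $f(rX)=(\operatorname{sgn} r)^\delta|r|^{-n-\mu}f(X)$ for all $r\in\mathbb R^\times$, and let $V_{\mu,\delta}$ be its completion in the norm of $L^2(S^{2n-1})$, i.e. the space of (classes of) functions with the same homogeneity whose restriction to $S^{2n-1}$ is square integrable. The normalized Knapp–Stein operator $\widetilde{\mathcal T}_{\mu,\delta}\colon V^\infty_{-\mu,\delta}\to V^\infty_{\mu,\delta}$ of $Sp(n,\mathbb R)$ is the meromorphic continuation in $\mu$ (with the restriction of $f$ to $S^{2n-1}$ kept fixed), from the half plane $\operatorname{Re}\mu<1-n$, of $$(\widetilde{\mathcal T}_{\mu,\delta}f)(Y)=\frac1{C(\mu,\delta)}\int_{S^{2n-1}}f(\xi)\,|\omega(\xi,Y)|^{-\mu-n}(\operatorname{sgn}\omega(\xi,Y))^\delta\,d\sigma(\xi),$$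 where $d\sigma$ is the Euclidean surface measure and $$C(\mu,0)=2\pi^{\mu+n-\frac12}\,\frac{\Gamma(\frac{1-\mu-n}2)}{\Gamma(\frac{\mu+n}2)},\qquad C(\mu,1)=2\pi^{\mu+n-\frac12}\, i\,\frac{\Gamma(\frac{2-\mu-n}2)}{\Gamma(\frac{\mu+n+1}2)}.$$ It is regular for $\mu\notin\{-n-\delta-2k: k=0,1,2,\dots\}$. As an operator $V_{-\mu,\delta}\to V_{\mu,\delta}$, $\widetilde{\mathcal T}_{\mu,\delta}$ is the closure, for the $L^2(S^{2n-1})$ norms, of this operator on smooth vectors. Put $f_N(t,x,\xi)=f(1,x,2t,\xi)$ for $(t,x,\xi)\in\mathbb R\times\mathbb R^m\times\mathbb R^m$ (the $N$-picture), and let $$(\mathcal F_\xi\mathcal F_tF)(\rho,x,\eta)=\int_{\mathbb R}\int_{\mathbb R^m}F(t,x,\xi)\,e^{-2\pi i(t\rho+\langle\xi,\eta\rangle)}\,d\xi\,dt,$$ in the sense of tempered distributions. Let $$(T_{\mu,\delta}H)(\rho,x,\eta)=\Bigl|\frac\rho2\Bigr|^{\mu}(\operatorname{sgn}\rho)^\delta\,H\Bigl(\rho,\frac2\rho\,\eta,\frac\rho2\,x\Bigr),$$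 an operator on functions and on distributions on $\{(\rho,x,\eta):\rho\ne0\}$. **Theorem.** Let $\mu\in\mathbb C$ with $\mu\notin\{-n-\delta-2k:k=0,1,2,\dots\}$. 1. For every $f\in V^\infty_{-\mu,\delta}$ the meromorphic continuation exists pointwise on $\mathbb R^{2n}\setminus\{0\}$ and is regular outside $\{-n-\delta-2k\}$, and $\widetilde{\mathcal T}_{\mu,\delta}f\in V^\infty_{\mu,\delta}$. 2. For every $f\in V_{-\mu,\delta}$ in the domain of $\widetilde{\mathcal T}_{\mu,\delta}$ (in particular for every $f\in V_{-\mu,\delta}^\infty$), $$\mathcal F_\xi\mathcal F_t\bigl((\widetilde{\mathcal T}_{\mu,\delta}f)_N\bigr)=T_{\mu,\delta}\bigl(\mathcal F_\xi\mathcal F_t(f_N)\bigr)$$ as distributions on $\{\rho\neq0\}$. 3. If $\operatorname{Re}\mu=0$, then $\widetilde{\mathcal T}_{\mu,\delta}$ is defined on all of $V_{-\mu,\delta}$, and for every $f\in V_{-\mu,\delta}$ the functions $f_N$, $(\widetilde{\mathcal T}_{\mu,\delta}f)_N$ and their transforms lie in $L^2(\mathbb R^{2m+1})$, and the identity in 2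 holds in $L^2(\mathbb R^{2m+1})$. -/

import Mathlib

open MeasureTheory Filter Topology
open scoped ContDiff FourierTransform SchwartzMap

noncomputable section

namespace KnappStein

/-- `ℝ²ⁿ` with `n = m + 1`; the index `Sum.inl` marks the first `n` coordinates, the index
`Sum.inr` the last `n` coordinates. -/
abbrev Ambient (m : ℕ) : Type := EuclideanSpace ℝ (Fin (m + 1) ⊕ Fin (m + 1))

/-- `ℝ × ℝᵐ × ℝᵐ`, the underlying space of the Heisenberg group. -/
abbrev Heis (m : ℕ) : Type := ℝ × EuclideanSpace ℝ (Fin m) × EuclideanSpace ℝ (Fin m)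

/-- The standard symplectic form `ω((x, ξ), (y, η)) = ⟨ξ, y⟩ - ⟨x, η⟩`. -/
def omega {m : ℕ} (X Y : Ambient m) : ℝ :=
  ∑ i, X (Sum.inr i) * Y (Sum.inl i) - ∑ i, X (Sum.inl i) * Y (Sum.inr i)

/-- The Euclidean surface measure on the unit sphere of `ℝ²ⁿ`. -/
abbrev sphereMeasure (m : ℕ) : Measure (Metric.sphere (0 : Ambient m) 1) :=
  (volume : Measure (Ambient m)).toSphere

/-- `(sgn r) ^ δ` for `δ ∈ ℤ/2ℤ`. -/
def sgnPow (δ : ZMod 2) (r : ℝ) : ℂ := ((Real.sign r : ℝ) : ℂ) ^ δ.val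

/-- `f (r X) = (sgn r) ^ δ |r| ^ (-n - μ) f X` for all `r ≠ 0`, `X ≠ 0`. -/
def IsHomog (m : ℕ) (μ : ℂ) (δ : ZMod 2) (f : Ambient m → ℂ) : Prop :=
  ∀ r : ℝ, r ≠ 0 → ∀ X : Ambient m, X ≠ 0 →
    f (r • X) = sgnPow δ r * ((|r| : ℝ) : ℂ) ^ (-((m + 1 : ℕ) : ℂ) - μ) * f X

/-- The space of smooth homogeneous functions on `ℝ²ⁿ ∖ {0}`. (The value at the origin
is immaterial.) -/
def VSmooth (m : ℕ) (μ : ℂ) (δ : ZMod 2) : Set (Ambient m → ℂ) :=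
  {f | ContDiffOn ℝ ∞ f {0}ᶜ ∧ IsHomog m μ δ f}

/-- The completion of `VSmooth` in the `L²` norm over the unit sphere: homogeneous functions
which are square integrable on the sphere. -/
def V (m : ℕ) (μ : ℂ) (δ : ZMod 2) : Set (Ambient m → ℂ) :=
  {f | IsHomog m μ δ f ∧
    MemLp (fun ξ : Metric.sphere (0 : Ambient m) 1 => f ξ) 2 (sphereMeasure m)}

/-- The Knapp–Stein integral
`∫ f(ξ) |ω(ξ, Y)| ^ (-μ - n) (sgn ω(ξ, Y)) ^ δ dσ(ξ)` over the unit sphere; it converges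
for smooth `f` if `Re μ < 1 - n`. -/
def knappSteinIntegral (m : ℕ) (μ : ℂ) (δ : ZMod 2) (f : Ambient m → ℂ) (Y : Ambient m) : ℂ :=
  ∫ ξ : Metric.sphere (0 : Ambient m) 1,
    f ξ * ((|omega (ξ : Ambient m) Y| : ℝ) : ℂ) ^ (-μ - ((m + 1 : ℕ) : ℂ))
      * sgnPow δ (omega (ξ : Ambient m) Y) ∂(sphereMeasure m)

/-- The normalizing constant. -/
def normConst (m : ℕ) (μ : ℂ) (δ : ZMod 2) : ℂ :=
  2 * (Real.pi : ℂ) ^ (μ + ((m + 1 : ℕ) : ℂ) - 1 / 2) *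
    (if δ = 0 then
      Complex.Gamma ((1 - μ - ((m + 1 : ℕ) : ℂ)) / 2) /
        Complex.Gamma ((μ + ((m + 1 : ℕ) : ℂ)) / 2)
    else
      Complex.I * (Complex.Gamma ((2 - μ - ((m + 1 : ℕ) : ℂ)) / 2) /
        Complex.Gamma ((μ + ((m + 1 : ℕ) : ℂ) + 1) / 2)))

/-- The points `-n - δ - 2k`, `k ∈ ℕ`: the poles of the normalized Knapp–Stein operator. -/
def poles (m : ℕ) (δ : ZMod 2) : Set ℂ :=
  {μ | ∃ k : ℕ, μ = -((m + 1 : ℕ) : ℂ) - (δ.val : ℂ) - 2 * (k : ℂ)}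

/-- `G` is the meromorphic continuation in `ν` of the normalized Knapp–Stein integral of `f` at
the point `Y`, and is regular outside `poles`. By the identity theorem, `G` is unique
outside `poles`. -/
def IsContinuation (m : ℕ) (δ : ZMod 2) (f : Ambient m → ℂ) (Y : Ambient m) (G : ℂ → ℂ) : Prop :=
  MeromorphicOn G Set.univ ∧ AnalyticOnNhd ℂ G (poles m δ)ᶜ ∧
    ∀ ν : ℂ, ν.re < 1 - ((m + 1 : ℕ) : ℝ) → ν ∉ poles m δ →
      G ν = (normConst m ν δ)⁻¹ * knappSteinIntegral m ν δ f Y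

/-- The meromorphic continuation itself (only meaningful if it exists). -/
def continuation (m : ℕ) (δ : ZMod 2) (f : Ambient m → ℂ) (Y : Ambient m) : ℂ → ℂ :=
  Classical.epsilon (IsContinuation m δ f Y)

/-- The normalized Knapp–Stein operator on smooth functions. -/
def knappStein (m : ℕ) (μ : ℂ) (δ : ZMod 2) (f : Ambient m → ℂ) : Ambient m → ℂ :=
  fun Y => continuation m δ f Y μ

/-- The graph of the normalized Knapp–Stein operator as an operator from `V m (-μ) δ`
to `V m μ δ`: the closure, for the `L²` norms over the sphere, of its graph on smooth functions.
For a smooth `f` it contains `(f, knappStein m μ δ f)`. -/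
def KnappSteinGraph (m : ℕ) (μ : ℂ) (δ : ZMod 2) (f g : Ambient m → ℂ) : Prop :=
  f ∈ V m (-μ) δ ∧ g ∈ V m μ δ ∧
    ∃ F : ℕ → Ambient m → ℂ, (∀ k, F k ∈ VSmooth m (-μ) δ) ∧
      Tendsto (fun k => eLpNorm (fun ξ : Metric.sphere (0 : Ambient m) 1 => F k ξ - f ξ) 2
        (sphereMeasure m)) atTop (𝓝 0) ∧
      Tendsto (fun k => eLpNorm (fun ξ : Metric.sphere (0 : Ambient m) 1 =>
        knappStein m μ δ (F k) ξ - g ξ) 2 (sphereMeasure m)) atTop (𝓝 0)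

/-- The point `(1, x, 2t, ξ)` of `ℝ²ⁿ`. -/
def embed {m : ℕ} (p : Heis m) : Ambient m :=
  WithLp.toLp 2 (Sum.elim (Fin.cons 1 (fun i => p.2.1 i)) (Fin.cons (2 * p.1) (fun i => p.2.2 i)))

/-- Passage to the `N`-picture: `(t, x, ξ) ↦ f (1, x, 2t, ξ)`. -/
def toN {m : ℕ} (f : Ambient m → ℂ) : Heis m → ℂ := fun p => f (embed p)

/-- The partial Fourier transform in the first variable. -/
def fourierT {m : ℕ} (F : Heis m → ℂ) : Heis m → ℂ :=
  fun p => 𝓕 (fun t : ℝ => F (t, p.2.1, p.2.2)) p.1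

/-- The partial Fourier transform in the last variable. -/
def fourierXi {m : ℕ} (F : Heis m → ℂ) : Heis m → ℂ :=
  fun p => 𝓕 (fun ξ : EuclideanSpace ℝ (Fin m) => F (p.1, p.2.1, ξ)) p.2.2

/-- The transform `F_ξ F_t F` of a function `F`, in the sense of tempered distributions: its value
on the test function `φ`. -/
def fourierDist {m : ℕ} (F φ : Heis m → ℂ) : ℂ :=
  ∫ p : Heis m, F p * fourierXi (fourierT φ) p

/-- The function `H` is the transform `F_ξ F_t F`. -/
def IsFourier {m : ℕ} (F H : Heis m → ℂ) : Prop :=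
  ∀ φ : 𝓢(Heis m, ℂ), ∫ p : Heis m, H p * φ p = fourierDist F (φ : Heis m → ℂ)

/-- The algebraic operator
`H ↦ |ρ/2| ^ μ (sgn ρ) ^ δ H(ρ, (2/ρ) η, (ρ/2) x)` on functions of `(ρ, x, η)`. -/
def algOp {m : ℕ} (μ : ℂ) (δ : ZMod 2) (H : Heis m → ℂ) : Heis m → ℂ :=
  fun p => ((|p.1 / 2| : ℝ) : ℂ) ^ μ * sgnPow δ p.1 *
    H (p.1, (2 / p.1) • p.2.2, (p.1 / 2) • p.2.1)

/-- The algebraic operator on distributions on `{ρ ≠ 0}`. Since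
`(ρ, x, η) ↦ (ρ, (2/ρ) η, (ρ/2) x)` is an involution which preserves Lebesgue measure, `algOp` is
its own transpose. -/
def algOpDist {m : ℕ} (μ : ℂ) (δ : ZMod 2) (u : (Heis m → ℂ) → ℂ) : (Heis m → ℂ) → ℂ :=
  fun φ => u (algOp μ δ φ)

/-- The test functions on the open set `{ρ ≠ 0}`. -/
def TestFunctions (m : ℕ) : Set (Heis m → ℂ) :=
  {φ | ContDiff ℝ ∞ φ ∧ HasCompactSupport φ ∧ tsupport φ ⊆ {p | p.1 ≠ 0}}

end KnappStein

end

/-!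
Put `n = m + 1`. The idea is to write homogeneous functions as Mellin averages of test functions
along rays, on which the Knapp–Stein operator becomes a Fourier transform.

Let `χ` be a cut-off function on the half line with `∫ χ(t) dt / t = 1`. A function `f` which is
homogeneous of degree `μ - n` is the average `∫ r ^ (n - 1 - μ) Φ(r X) dr` of the test function
`Φ(X) = χ(|X|) f(X)` (`rayMellin_truncate`). Its image under the normalized Knapp–Stein operator is
the average `∫ r ^ (n - 1 + μ) Ψ(r Y) dr` of the symplectic Fourier transform `Ψ` of `Φ`. Indeed,
for `b = ν + n` with `0 < Re b < 1`, the Mellin transform of `Ψ` along the ray through `Y` is the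
integral of `Φ(X)` against `Γ(b) (2πi ω(X, Y)) ^ (-b)` (`mellin_fourier_ray`), and the part of
parity `δ` of this kernel is a signed power of `ω(X, Y)` times the inverse of the normalizing
constant (`gamma_mul_boundary_values`, `rayMellin_generatorFourier`). The Mellin average is
holomorphic for `Re ν > -n`, the Knapp–Stein integral for `Re ν < 1 - n`, so that together they
give the continuation, its regularity and its smoothness (`isContinuation_continued`,
`knappStein_mem`).

In the `N`-picture, the pairing of a Mellin average of `Φ` with `F_ξ F_t φ` is, by Parseval's
formula in `(t, ξ)`, a Mellin integral over `r` of pairings of `φ` with the partial Fourier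
transform of `Φ` in the last `n` variables, at the point `(r (1, x), r⁻¹ (ρ / 2, η))`
(`exists_integral_rayMellin_mul_fourierHeis`). By Fourier inversion in the first `n` variables, the
symplectic Fourier transform exchanges the two arguments of this partial Fourier transform
(`halfFourier_symplecticFourier`). The substitution `r = |ρ| / (2 s)` brings the exchanged
arguments back to the form `± (s (1, (2/ρ) η), s⁻¹ (ρ / 2, (ρ/2) x))`, and this is the algebraic
operator (`integral_halfFourier_symplecticFourier`). As `φ` is supported away from `ρ = 0`,
everything converges absolutely for `Re μ > -n`; the remaining `μ` are reached by analytic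
continuation (`fourierDist_knappStein`). The pairings are continuous for the norm of `L²(S)`,
whence the identity on the closure of the operator (`KnappSteinGraph.fourierDist_eq`).

If `Re μ = 0`, the squared norm of `f` in `L²(S)` is a Mellin integral over `t` of the pairings of
`Φ` with its dilations by `t`. Parseval's formula and the substitution `t ↦ t⁻¹` show that the
squared norm of the image is the same integral, so that the operator is isometric on smooth vectors
(`eLpNorm_knappStein`). These are dense, hence the closure is defined everywhere
(`exists_knappSteinGraph`). Restriction to the `N`-picture maps `L²(S)` to `L²` (`memLp_toN`), the
transform exists in `L²` by Plancherel's theorem on slices (`exists_isFourier`), and the identity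
of distributions on `ρ ≠ 0` is one of functions, since `ρ = 0` is a null set
(`KnappSteinGraph.exists_isFourier`).
-/

noncomputable section

namespace KnappStein

open scoped ComplexConjugate

/-! ### Integrals depending holomorphically on an exponent -/

lemma rpow_le_rpow_add_rpow {w a b c : ℝ} (hw : 0 < w) (hab : a ≤ b) (hbc : b ≤ c) :
    w ^ b ≤ w ^ a + w ^ c := by
  have ha := Real.rpow_nonneg hw.le a
  have hc := Real.rpow_nonneg hw.le c
  rcases le_total w 1 with h | h
  · linarith [Real.rpow_le_rpow_of_exponent_ge hw h hab]
  · linarith [Real.rpow_le_rpow_of_exponent_le h hbc]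

lemma abs_log_le_rpow {w η : ℝ} (hw : 0 < w) (hη : 0 < η) :
    |Real.log w| ≤ (w ^ (-η) + w ^ η) / η := by
  have h1 := Real.log_le_rpow_div hw.le hη
  have h2 := Real.log_le_rpow_div (inv_pos.2 hw).le hη
  rw [Real.log_inv, Real.inv_rpow hw.le, ← Real.rpow_neg hw.le] at h2
  have ha := div_nonneg (Real.rpow_nonneg hw.le (-η)) hη.le
  have hc := div_nonneg (Real.rpow_nonneg hw.le η) hη.le
  rw [add_div]
  exact abs_le.2 ⟨by linarith, by linarith⟩

/-- If `h wˢ` is integrable for all `s` in an open set, then `∫ h wˢ` is holomorphic there. -/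
lemma differentiableOn_integral_mul_cpow {α : Type*} [MeasurableSpace α] {ν : Measure α}
    {h : α → ℂ} {w : α → ℝ} (hh : AEStronglyMeasurable h ν) (hw : AEMeasurable w ν)
    (hpos : ∀ᵐ x ∂ν, 0 < w x) {U : Set ℂ} (hU : IsOpen U)
    (hint : ∀ s ∈ U, Integrable (fun x => ‖h x‖ * w x ^ s.re) ν) :
    DifferentiableOn ℂ (fun s => ∫ x, h x * (w x : ℂ) ^ s ∂ν) U := by
  -- near `s₀` the derivative `h wˢ log w` is dominated by `|h| (w ^ (a - 2η) + w ^ (a + 2η))` with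
  -- `a = Re s₀`, up to a constant: the logarithm costs an `η`, and so does the variation of `s`
  intro s₀ hs₀
  obtain ⟨ε, hε, hball⟩ := Metric.isOpen_iff.1 hU s₀ hs₀
  set η := ε / 4 with hη
  have hη0 : 0 < η := by positivity
  have hmem : ∀ t : ℝ, |t| < ε → s₀ + (t : ℂ) ∈ U := fun t ht => hball (by
    simpa [Metric.mem_ball, dist_eq_norm] using ht)
  have hI1 := hint _ (hmem (-(2 * η)) (by rw [abs_neg, abs_of_pos (by positivity)]; linarith))
  have hI2 := hint _ (hmem (2 * η) (by rw [abs_of_pos (by positivity)]; linarith))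
  have hmeas : ∀ s : ℂ, AEStronglyMeasurable (fun x => h x * (w x : ℂ) ^ s) ν := fun s =>
    hh.mul ((Complex.measurable_ofReal.comp_aemeasurable hw).pow_const s).aestronglyMeasurable
  have hnorm : ∀ s : ℂ, ∀ x, 0 < w x → ‖h x * (w x : ℂ) ^ s‖ = ‖h x‖ * w x ^ s.re := by
    intro s x hx
    rw [norm_mul, Complex.norm_cpow_eq_rpow_re_of_pos hx]
  refine (hasDerivAt_integral_of_dominated_loc_of_deriv_le
    (F' := fun s x => h x * ((w x : ℂ) ^ s * Complex.log (w x)))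
    (bound := fun x => (‖h x‖ * w x ^ (s₀ + ((-(2 * η) : ℝ) : ℂ)).re +
      ‖h x‖ * w x ^ (s₀ + ((2 * η : ℝ) : ℂ)).re) * (2 / η))
    (Metric.ball_mem_nhds s₀ hη0) (Eventually.of_forall hmeas) ?_ ?_ ?_
    ((hI1.add hI2).mul_const _) ?_).2.differentiableAt.differentiableWithinAt
  · refine (hint s₀ hs₀).mono' (hmeas s₀) ?_
    filter_upwards [hpos] with x hx
    rw [hnorm _ _ hx]
  · refine hh.mul (AEMeasurable.aestronglyMeasurable ?_)
    exact ((Complex.measurable_ofReal.comp_aemeasurable hw).pow_const s₀).mul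
      (Complex.measurable_log.comp_aemeasurable (Complex.measurable_ofReal.comp_aemeasurable hw))
  · filter_upwards [hpos] with x hx s hs
    have hre : |s.re - s₀.re| < η := by
      have := (Complex.abs_re_le_norm (s - s₀)).trans_lt (by simpa [dist_eq_norm] using hs)
      simpa using this
    rw [abs_lt] at hre
    rw [← Complex.ofReal_log hx.le, ← mul_assoc, norm_mul, hnorm _ _ hx, Complex.norm_real,
      Real.norm_eq_abs, mul_assoc, ← mul_add, mul_assoc]
    refine mul_le_mul_of_nonneg_left ?_ (norm_nonneg _)
    refine (mul_le_mul_of_nonneg_left (abs_log_le_rpow hx hη0) (Real.rpow_nonneg hx.le _)).trans ?_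
    rw [mul_div_assoc', mul_add, ← Real.rpow_add hx, ← Real.rpow_add hx, div_eq_mul_inv,
      div_eq_mul_inv, ← mul_assoc]
    refine mul_le_mul_of_nonneg_right ?_ (by positivity)
    simp only [Complex.add_re, Complex.ofReal_re]
    have h1 := rpow_le_rpow_add_rpow (a := s₀.re + -(2 * η)) (b := s.re + -η)
      (c := s₀.re + 2 * η) hx (by linarith) (by linarith)
    have h2 := rpow_le_rpow_add_rpow (a := s₀.re + -(2 * η)) (b := s.re + η)
      (c := s₀.re + 2 * η) hx (by linarith) (by linarith)
    linarith
  · filter_upwards [hpos] with x hx s _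
    have hx' : (w x : ℂ) ≠ 0 := by exact_mod_cast hx.ne'
    simpa using ((Complex.hasStrictDerivAt_const_cpow (y := s)
        (Or.inl hx')).hasDerivAt).const_mul (h x)

/-- Euler's integral with a complex rate. -/
lemma integral_cpow_mul_exp_neg_mul {b z : ℂ} (hb : 0 < b.re) (hz : 0 < z.re) :
    ∫ t in Set.Ioi (0 : ℝ), (t : ℂ) ^ (b - 1) * Complex.exp (-(z * t)) =
      Complex.Gamma b * z ^ (-b) := by
  -- both sides are holomorphic in `z` on the right half plane and agree for real `z`; the left side
  -- is of the form `∫ h wᶻ` with `w = exp (-t)`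
  have hpre : IsPreconnected {z : ℂ | 0 < z.re} := (convex_halfSpace_re_gt 0).isPreconnected
  have hopen : IsOpen {z : ℂ | 0 < z.re} := isOpen_lt continuous_const Complex.continuous_re
  have e : ∀ z : ℂ, ∫ t in Set.Ioi (0 : ℝ), (t : ℂ) ^ (b - 1) * Complex.exp (-(z * t)) =
      ∫ t in Set.Ioi (0 : ℝ), (t : ℂ) ^ (b - 1) * ((Real.exp (-t) : ℝ) : ℂ) ^ z := by
    intro z
    refine integral_congr_ae (Eventually.of_forall fun t => ?_)
    simp only
    rw [Complex.cpow_def_of_ne_zero (x := ((Real.exp (-t) : ℝ) : ℂ))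
      (by exact_mod_cast (Real.exp_pos _).ne'), ← Complex.ofReal_log (Real.exp_pos _).le,
          Real.log_exp]
    push_cast
    ring_nf
  have hA : AnalyticOnNhd ℂ (fun z : ℂ => ∫ t in Set.Ioi (0 : ℝ), (t : ℂ) ^ (b - 1) *
      Complex.exp (-(z * t))) {z : ℂ | 0 < z.re} := by
    simp_rw [e]
    refine DifferentiableOn.analyticOnNhd (differentiableOn_integral_mul_cpow ?_ ?_ ?_ hopen ?_) hopen
    · exact (Complex.measurable_ofReal.pow_const _).aestronglyMeasurable
    · fun_prop
    · exact Eventually.of_forall fun t => Real.exp_pos _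
    · intro s hs
      have h := integrableOn_rpow_mul_exp_neg_mul_rpow (p := 1) (s := b.re - 1) (b := s.re)
        (by linarith) one_pos hs
      refine h.congr ?_
      filter_upwards [ae_restrict_mem measurableSet_Ioi] with t ht
      rw [Complex.norm_cpow_eq_rpow_re_of_pos ht, ← Real.exp_mul]
      simp [mul_comm]
  have hB : AnalyticOnNhd ℂ (fun z : ℂ => Complex.Gamma b * z ^ (-b)) {z : ℂ | 0 < z.re} := by
    refine DifferentiableOn.analyticOnNhd (fun z hz => ?_) hopen
    exact ((differentiableAt_id.cpow_const (Or.inl hz)).const_mul _).differentiableWithinAt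
  refine hA.eqOn_of_preconnected_of_frequently_eq hB hpre (z₀ := 1) (by simp) ?_ hz
  have : Tendsto (fun x : ℝ => (x : ℂ)) (𝓝[≠] 1) (𝓝[≠] 1) := by
    refine tendsto_nhdsWithin_iff.2 ⟨?_, ?_⟩
    · exact (Complex.continuous_ofReal.tendsto' 1 1 (by simp)).mono_left nhdsWithin_le_nhds
    · filter_upwards [self_mem_nhdsWithin] with x hx
      simpa using hx
  refine this.frequently (Eventually.frequently ?_)
  have hev : ∀ᶠ x : ℝ in 𝓝[≠] 1, 0 < x := nhdsWithin_le_nhds (lt_mem_nhds one_pos)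
  filter_upwards [hev] with x hx
  rw [Complex.integral_cpow_mul_exp_neg_mul_Ioi hb hx, mul_comm, one_div, Complex.inv_cpow,
    Complex.cpow_neg]
  rw [Complex.arg_ofReal_of_nonneg hx.le]
  exact Real.pi_pos.ne

/-- Away from the imaginary axis the power `z ^ (-b)` is dominated by its modulus on the axis. -/
lemma norm_add_cpow_le {ε y : ℝ} (hy : y ≠ 0) {b : ℂ} (hb : 0 ≤ b.re) :
    ‖((ε : ℂ) + y * Complex.I) ^ (-b)‖ ≤ Real.exp (Real.pi * |b.im|) * |y| ^ (-b.re) := by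
  refine (Complex.norm_cpow_le _ _).trans ?_
  rw [div_eq_mul_inv, mul_comm, ← Real.exp_neg]
  refine mul_le_mul ?_ ?_ (Real.rpow_nonneg (norm_nonneg _) _) (Real.exp_pos _).le
  · refine Real.exp_le_exp.2 ?_
    rw [Complex.neg_im, mul_neg, neg_neg]
    refine (le_abs_self _).trans ?_
    rw [abs_mul]
    exact mul_le_mul_of_nonneg_right (Complex.abs_arg_le_pi _) (abs_nonneg _)
  · rw [Complex.neg_re]
    refine Real.rpow_le_rpow_of_nonpos (abs_pos.2 hy) ?_ (by linarith)
    simpa using Complex.abs_im_le_norm ((ε : ℂ) + y * Complex.I)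

variable {E : Type*} [NormedAddCommGroup E] [InnerProductSpace ℝ E] [FiniteDimensional ℝ E]
  [MeasurableSpace E] [BorelSpace E]

/-- The Mellin transform of the Fourier transform along a ray. The interchange of the integrals
over `r` and `X` is justified by Abel summation: a factor `exp (-ε r)` is inserted, and `ε → 0`. -/
lemma mellin_fourier_ray {H : E → ℂ} (hH : Integrable H) {Z : E} {b : ℂ} (hb : 0 < b.re)
    (hZ : ∀ᵐ X : E, inner ℝ X Z ≠ 0)
    (hint : Integrable fun X => ‖H X‖ * |inner ℝ X Z| ^ (-b.re))
    (hint' : IntegrableOn (fun r : ℝ => (r : ℂ) ^ (b - 1) * 𝓕 H (r • Z)) (Set.Ioi 0)) :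
    ∫ r in Set.Ioi (0 : ℝ), (r : ℂ) ^ (b - 1) * 𝓕 H (r • Z) =
      Complex.Gamma b * ∫ X, H X * ((2 * Real.pi * inner ℝ X Z : ℝ) * Complex.I) ^ (-b) := by
  set ε : ℕ → ℝ := fun k => 1 / ((k : ℝ) + 1) with hεdef
  have hε0 : ∀ k, 0 < ε k := fun k => by positivity
  have hεlim : Tendsto ε atTop (𝓝 0) := tendsto_one_div_add_atTop_nhds_zero_nat
  have hF : ∀ r : ℝ, 𝓕 H (r • Z) = ∫ X, H X * Complex.exp
      (-((2 * Real.pi * inner ℝ X Z : ℝ) * Complex.I * r)) := by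
    intro r
    rw [Real.fourier_eq']
    refine integral_congr_ae (Eventually.of_forall fun X => ?_)
    simp only [smul_eq_mul, inner_smul_right]
    rw [mul_comm]
    congr 2
    push_cast
    ring
  have hy' : ∀ X : E, inner ℝ X Z ≠ 0 → 2 * Real.pi * inner ℝ X Z ≠ 0 := fun X hX =>
    mul_ne_zero (by positivity) hX
  -- the regularized integrals, by Fubini and Euler's integral
  have key : ∀ k, ∫ r in Set.Ioi (0 : ℝ), Complex.exp (-(ε k * r)) *
      ((r : ℂ) ^ (b - 1) * 𝓕 H (r • Z))
      = Complex.Gamma b * ∫ X, H X *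
        ((ε k : ℂ) + (2 * Real.pi * inner ℝ X Z : ℝ) * Complex.I) ^ (-b) := by
    intro k
    have hrint : IntegrableOn (fun r : ℝ => (r : ℂ) ^ (b - 1) * Complex.exp (-(ε k * r)))
        (Set.Ioi 0) := by
      have h := integrableOn_rpow_mul_exp_neg_mul_rpow (p := 1) (s := b.re - 1) (b := ε k)
        (by linarith) one_pos (hε0 k)
      refine h.mono' (by fun_prop) ?_
      filter_upwards [ae_restrict_mem measurableSet_Ioi] with t ht
      rw [norm_mul, Complex.norm_cpow_eq_rpow_re_of_pos ht, Complex.norm_exp]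
      simp
    have hprod := hrint.mul_prod hH
    calc _ = ∫ r in Set.Ioi (0 : ℝ), ∫ X, ((r : ℂ) ^ (b - 1) * Complex.exp (-(ε k * r)) * H X) *
          Complex.exp (-((2 * Real.pi * inner ℝ X Z : ℝ) * Complex.I * r)) := by
          refine integral_congr_ae (Eventually.of_forall fun r => ?_)
          simp only
          rw [hF, ← integral_const_mul, ← integral_const_mul]
          refine integral_congr_ae (Eventually.of_forall fun X => ?_)
          simp only
          ring
      _ = ∫ X, ∫ r in Set.Ioi (0 : ℝ), ((r : ℂ) ^ (b - 1) * Complex.exp (-(ε k * r)) * H X) *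
          Complex.exp (-((2 * Real.pi * inner ℝ X Z : ℝ) * Complex.I * r)) := by
          refine integral_integral_swap ?_
          refine hprod.mul_bdd (c := 1) (by fun_prop) (Eventually.of_forall fun x => ?_)
          rw [Complex.norm_exp]
          simp
      _ = _ := by
          rw [← integral_const_mul]
          refine integral_congr_ae (Eventually.of_forall fun X => ?_)
          simp only
          rw [mul_left_comm, ← integral_cpow_mul_exp_neg_mul hb (by simpa using hε0 k),
            ← integral_const_mul]
          refine integral_congr_ae (Eventually.of_forall fun r => ?_)
          simp only
          rw [add_mul, neg_add, Complex.exp_add]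
          ring
  have hL : Tendsto (fun k => ∫ r in Set.Ioi (0 : ℝ), Complex.exp (-(ε k * r)) *
      ((r : ℂ) ^ (b - 1) * 𝓕 H (r • Z))) atTop
      (𝓝 (∫ r in Set.Ioi (0 : ℝ), (r : ℂ) ^ (b - 1) * 𝓕 H (r • Z))) := by
    refine tendsto_integral_of_dominated_convergence _
      (fun k => (by fun_prop : AEStronglyMeasurable (fun r : ℝ => Complex.exp (-(ε k * r)))
        (volume.restrict (Set.Ioi 0))).mul hint'.aestronglyMeasurable) hint'.norm ?_ ?_
    · intro k
      filter_upwards [ae_restrict_mem measurableSet_Ioi] with r hr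
      rw [norm_mul]
      refine mul_le_of_le_one_left (norm_nonneg _) ?_
      rw [Complex.norm_exp]
      simpa using mul_nonneg (hε0 k).le (le_of_lt hr)
    · refine Eventually.of_forall fun r => ?_
      have : Tendsto (fun k => Complex.exp (-((ε k : ℝ) * r))) atTop (𝓝 1) := by
        have h0 : Continuous fun x : ℝ => Complex.exp (-((x : ℂ) * r)) := by fun_prop
        simpa [Function.comp_def] using (h0.tendsto 0).comp hεlim
      simpa using this.mul_const _
  have hR : Tendsto (fun k => Complex.Gamma b * ∫ X, H X *
      ((ε k : ℂ) + (2 * Real.pi * inner ℝ X Z : ℝ) * Complex.I) ^ (-b)) atTop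
      (𝓝 (Complex.Gamma b * ∫ X, H X * ((2 * Real.pi * inner ℝ X Z : ℝ) * Complex.I) ^ (-b))) := by
    refine Tendsto.const_mul _ (tendsto_integral_of_dominated_convergence
      (fun X => Real.exp (Real.pi * |b.im|) * (2 * Real.pi) ^ (-b.re) *
        (‖H X‖ * |inner ℝ X Z| ^ (-b.re)))
      (fun k => hH.aestronglyMeasurable.mul ?_) (hint.const_mul _) (fun k => ?_) ?_)
    · exact (by fun_prop : Measurable fun X : E => (ε k : ℂ) +
        (2 * Real.pi * inner ℝ X Z : ℝ) * Complex.I).pow_const _ |>.aestronglyMeasurable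
    · filter_upwards [hZ] with X hX
      rw [norm_mul]
      have h1 := norm_add_cpow_le (ε := ε k) (hy' X hX) hb.le
      refine (mul_le_mul_of_nonneg_left h1 (norm_nonneg _)).trans (le_of_eq ?_)
      rw [abs_mul, Real.mul_rpow (abs_nonneg _) (abs_nonneg _), abs_of_pos
          (by positivity : 0 < 2 * Real.pi)]
      ring
    · filter_upwards [hZ] with X hX
      refine Tendsto.const_mul _ ?_
      have hs : ((2 * Real.pi * inner ℝ X Z : ℝ) * Complex.I) ∈ Complex.slitPlane := by
        right
        simpa using hy' X hX
      refine (continuousAt_cpow_const hs).tendsto.comp ?_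
      have h0 : Continuous fun x : ℝ => (x : ℂ) + (2 * Real.pi * inner ℝ X Z : ℝ) * Complex.I := by
        fun_prop
      simpa [Function.comp_def] using (h0.tendsto 0).comp hεlim
  refine tendsto_nhds_unique hL ?_
  simpa only [key] using hR

/-! ### Polar coordinates and powers of linear forms -/

section Polar

variable {E : Type*} [NormedAddCommGroup E] [InnerProductSpace ℝ E] [FiniteDimensional ℝ E]
  [MeasurableSpace E] [BorelSpace E] [Nontrivial E]

/-- The measure `r ^ (d - 1) dr` on the half line. -/
def rayMeasure (d : ℕ) : Measure ℝ :=
  (volume.restrict (Set.Ioi 0)).withDensity fun r => ENNReal.ofReal (r ^ (d - 1))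

instance (d : ℕ) : SFinite (rayMeasure d) := by unfold rayMeasure; infer_instance

lemma lintegral_rayMeasure (d : ℕ) {g : ℝ → ENNReal} (hg : Measurable g) :
    ∫⁻ r, g r ∂rayMeasure d = ∫⁻ r in Set.Ioi (0 : ℝ), ENNReal.ofReal (r ^ (d - 1)) * g r := by
  rw [rayMeasure, lintegral_withDensity_eq_lintegral_mul _ (by fun_prop) hg]
  rfl

lemma lintegral_polar {G : E → ENNReal} (hG : Measurable G) :
    ∫⁻ X, G X = ∫⁻ θ, (∫⁻ r, G (r • (θ : E)) ∂rayMeasure (Module.finrank ℝ E))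
        ∂(volume : Measure E).toSphere := by
  have h := ((volume : Measure E).measurePreserving_homeomorphUnitSphereProd).symm
    (homeomorphUnitSphereProd E).toMeasurableEquiv
  have h1 : ∫⁻ X, G X = ∫⁻ X : ({0}ᶜ : Set E), G X ∂(volume.comap Subtype.val) := by
    rw [lintegral_subtype_comap (measurableSet_singleton _).compl, restrict_compl_singleton]
  rw [h1, ← h.lintegral_comp (f := fun X : ({0}ᶜ : Set E) => G X)
    (hG.comp measurable_subtype_coe),
    lintegral_prod _ (by
      refine Measurable.aemeasurable ?_
      exact (hG.comp measurable_subtype_coe).comp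
        (homeomorphUnitSphereProd E).symm.continuous.measurable)]
  refine lintegral_congr fun θ => ?_
  rw [Measure.volumeIoiPow, lintegral_withDensity_eq_lintegral_mul _ (by fun_prop),
    lintegral_rayMeasure _ (by fun_prop), ← lintegral_subtype_comap measurableSet_Ioi]
  · rfl
  · exact (hG.comp measurable_subtype_coe).comp
      ((homeomorphUnitSphereProd E).symm.continuous.measurable.comp (by fun_prop))

/-- Polar coordinates transport the product of the surface measure and `r ^ (d - 1) dr` to
Lebesgue measure. -/
lemma measurePreserving_polar :
    MeasurePreserving (fun p : Metric.sphere (0 : E) 1 × ℝ => p.2 • (p.1 : E))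
      ((volume : Measure E).toSphere.prod (rayMeasure (Module.finrank ℝ E))) volume := by
  refine ⟨by fun_prop, Measure.ext_of_lintegral _ fun G hG => ?_⟩
  rw [lintegral_map hG (by fun_prop), lintegral_prod _ (by fun_prop), lintegral_polar hG]

lemma integral_rayMeasure (d : ℕ) (g : ℝ → ℂ) :
    ∫ r, g r ∂rayMeasure d = ∫ r in Set.Ioi (0 : ℝ), (r : ℂ) ^ (d - 1) * g r := by
  rw [rayMeasure, integral_withDensity_eq_integral_toReal_smul (by fun_prop)
    (Eventually.of_forall fun _ => ENNReal.ofReal_lt_top)]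
  refine setIntegral_congr_fun measurableSet_Ioi fun r hr => ?_
  rw [ENNReal.toReal_ofReal (pow_nonneg (le_of_lt hr) _), Complex.real_smul]
  push_cast
  rfl

lemma integral_polar {G : E → ℂ} (hG : Integrable G) :
    ∫ X, G X = ∫ θ, (∫ r in Set.Ioi (0 : ℝ), (r : ℂ) ^ (Module.finrank ℝ E - 1) *
      G (r • (θ : E))) ∂(volume : Measure E).toSphere := by
  have h := measurePreserving_polar (E := E)
  conv_lhs => rw [← h.map_eq, integral_map h.aemeasurable
    (by rw [h.map_eq]; exact hG.aestronglyMeasurable)]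
  rw [integral_prod]
  · simp_rw [integral_rayMeasure]
  · exact h.integrable_comp_of_integrable hG

end Polar

lemma lintegral_abs_rpow_lt_top {s : ℝ} (hs : -1 < s) (A : ℝ) :
    ∫⁻ u in Set.Ioo (-A) A, ENNReal.ofReal |u| ^ s < ⊤ := by
  have h1 : ∫⁻ u in Set.Ioo 0 A, ENNReal.ofReal |u| ^ s < ⊤ := by
    rcases le_total A 0 with hA | hA
    · simp [Set.Ioo_eq_empty_of_le hA]
    have h := (intervalIntegral.intervalIntegrable_rpow' (a := 0) (b := A) hs).1
    have h' := (h.mono_set Set.Ioo_subset_Ioc_self).lintegral_lt_top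
    refine lt_of_le_of_lt (le_of_eq (setLIntegral_congr_fun measurableSet_Ioo fun u hu => ?_)) h'
    rw [abs_of_pos hu.1, ENNReal.ofReal_rpow_of_pos hu.1]
  have h2 : ∫⁻ u in Set.Ioo (-A) 0, ENNReal.ofReal |u| ^ s < ⊤ := by
    have := (Measure.measurePreserving_neg (volume : Measure ℝ)).setLIntegral_comp_preimage
      (s := Set.Ioo 0 A) measurableSet_Ioo (f := fun u => ENNReal.ofReal |u| ^ s) (by fun_prop)
    rw [← this] at h1
    simpa using h1
  have h3 : Set.Ioo (-A) A ⊆ (Set.Ioo (-A) 0 ∪ Set.Ioo 0 A) ∪ {0} := by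
    rintro x ⟨hx1, hx2⟩
    rcases lt_trichotomy x 0 with h | h | h
    · exact Or.inl (Or.inl ⟨hx1, h⟩)
    · exact Or.inr h
    · exact Or.inl (Or.inr ⟨h, hx2⟩)
  refine (lintegral_mono_set h3).trans_lt ((lintegral_union_le _ _ _).trans_lt ?_)
  refine ENNReal.add_lt_top.2 ⟨(lintegral_union_le _ _ _).trans_lt
      (ENNReal.add_lt_top.2 ⟨h2, h1⟩), ?_⟩
  rw [setLIntegral_measure_zero _ _ (by simp)]
  exact ENNReal.zero_lt_top

section LinearForms

variable {E : Type*} [NormedAddCommGroup E] [InnerProductSpace ℝ E] [FiniteDimensional ℝ E]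
  [MeasurableSpace E] [BorelSpace E]

/-- Powers of linear forms are locally integrable: translate in the direction of the linear form
and average over the translations. -/
lemma exists_lintegral_ball_inner_rpow_le {s : ℝ} (hs : -1 < s) (R : ℝ) :
    ∃ C < (⊤ : ENNReal), ∀ Z : E, ‖Z‖ = 1 →
      ∫⁻ X in Metric.ball (0 : E) R, ENNReal.ofReal |inner ℝ X Z| ^ s ≤ C := by
  refine ⟨(∫⁻ u in Set.Ioo (-(R + 2)) (R + 2), ENNReal.ofReal |u| ^ s) *
    volume (Metric.ball (0 : E) (R + 1)),
    ENNReal.mul_lt_top (lintegral_abs_rpow_lt_top hs _) measure_ball_lt_top, fun Z hZ => ?_⟩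
  have hm : Measurable fun q : E × ℝ => ENNReal.ofReal |inner ℝ q.1 Z + q.2| ^ s := by fun_prop
  have hZZ : inner ℝ Z Z = 1 := by rw [real_inner_self_eq_norm_sq, hZ]; norm_num
  calc ∫⁻ X in Metric.ball (0 : E) R, ENNReal.ofReal |inner ℝ X Z| ^ s
      = ∫⁻ t in Set.Ioo (0 : ℝ) 1, ∫⁻ X in Metric.ball (0 : E) R,
          ENNReal.ofReal |inner ℝ X Z| ^ s := by simp
    _ ≤ ∫⁻ t in Set.Ioo (0 : ℝ) 1, ∫⁻ X in Metric.ball (0 : E) (R + 1),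
          ENNReal.ofReal |inner ℝ X Z + t| ^ s := by
        refine setLIntegral_mono' measurableSet_Ioo fun t ht => ?_
        have hp := measurePreserving_add_right (volume : Measure E) (t • Z)
        rw [← hp.setLIntegral_comp_preimage Metric.isOpen_ball.measurableSet (by fun_prop)]
        refine (lintegral_mono_set (t := Metric.ball (0 : E) (R + 1)) fun X hX => ?_).trans ?_
        · simp only [Set.mem_preimage, Metric.mem_ball, dist_zero_right] at hX ⊢
          have h1 : ‖t • Z‖ < 1 := by
            rw [norm_smul, hZ, Real.norm_eq_abs, abs_of_pos ht.1]
            simpa using ht.2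
          have h2 := norm_sub_le (X + t • Z) (t • Z)
          rw [add_sub_cancel_right] at h2
          linarith
        · refine lintegral_mono fun X => ?_
          rw [inner_add_left, real_inner_smul_left, hZZ, mul_one]
    _ = ∫⁻ X in Metric.ball (0 : E) (R + 1), ∫⁻ t in Set.Ioo (0 : ℝ) 1,
          ENNReal.ofReal |inner ℝ X Z + t| ^ s := by
        exact lintegral_lintegral_swap (hm.comp measurable_swap).aemeasurable
    _ ≤ ∫⁻ _ in Metric.ball (0 : E) (R + 1),
          ∫⁻ u in Set.Ioo (-(R + 2)) (R + 2), ENNReal.ofReal |u| ^ s := by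
        refine setLIntegral_mono' Metric.isOpen_ball.measurableSet fun X hX => ?_
        have hp := measurePreserving_add_left (volume : Measure ℝ) (inner ℝ X Z)
        refine (lintegral_mono_set fun t ht => ?_).trans
          (hp.setLIntegral_comp_preimage measurableSet_Ioo (by fun_prop)).le
        have h1 := abs_real_inner_le_norm X Z
        rw [hZ, mul_one] at h1
        rw [Metric.mem_ball, dist_zero_right] at hX
        have h2 := abs_le.1 (h1.trans hX.le)
        exact ⟨by linarith [ht.1], by linarith [ht.2]⟩
    _ = _ := by rw [lintegral_const, Measure.restrict_apply_univ]

lemma exists_lintegral_sphere_inner_rpow_le [Nontrivial E] {s : ℝ} (hs : -1 < s) :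
    ∃ C < (⊤ : ENNReal), ∀ Z : E, ‖Z‖ = 1 →
      ∫⁻ ξ, ENNReal.ofReal |inner ℝ (ξ : E) Z| ^ s ∂(volume : Measure E).toSphere ≤ C := by
  obtain ⟨C, hC, h⟩ := exists_lintegral_ball_inner_rpow_le (E := E) hs 1
  -- in polar coordinates the integral over the unit ball is `c` times the integral over the sphere
  set c : ENNReal := ∫⁻ r, (Set.Ioo (0 : ℝ) 1).indicator (fun r => ENNReal.ofReal r ^ s) r
    ∂rayMeasure (Module.finrank ℝ E) with hc
  have hmc : Measurable fun r : ℝ => (Set.Ioo (0 : ℝ) 1).indicator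
      (fun r => ENNReal.ofReal r ^ s) r :=
    Measurable.indicator (by fun_prop) measurableSet_Ioo
  have hc0 : c ≠ 0 := by
    rw [hc, lintegral_rayMeasure _ hmc]
    intro h0
    rw [lintegral_eq_zero_iff (by fun_prop)] at h0
    have h1 : ∀ᵐ r : ℝ, ¬ r ∈ Set.Ioo (0 : ℝ) 1 := by
      rw [Filter.EventuallyEq, ae_restrict_iff' measurableSet_Ioi] at h0
      filter_upwards [h0] with r hr hr'
      have := hr hr'.1
      simp only [Set.indicator_of_mem hr', Pi.zero_apply, mul_eq_zero,
          ENNReal.ofReal_eq_zero] at this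
      rcases this with h | h
      · exact absurd h (not_le.2 (pow_pos hr'.1 _))
      · rw [ENNReal.rpow_eq_zero_iff] at h
        rcases h with h | h
        · exact absurd (ENNReal.ofReal_eq_zero.1 h.1) (not_le.2 hr'.1)
        · exact absurd h.1 ENNReal.ofReal_ne_top
    rw [ae_iff] at h1
    simp only [not_not] at h1
    have h2 : volume (Set.Ioo (0 : ℝ) 1) = 0 := h1
    simp at h2
  refine ⟨C / c, ENNReal.div_lt_top hC.ne hc0, fun Z hZ => ?_⟩
  rw [ENNReal.le_div_iff_mul_le (Or.inl hc0) (Or.inr hC.ne)]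
  refine le_trans ?_ (h Z hZ)
  rw [← lintegral_indicator Metric.isOpen_ball.measurableSet,
    lintegral_polar ((by fun_prop : Measurable fun X : E =>
      ENNReal.ofReal |inner ℝ X Z| ^ s).indicator Metric.isOpen_ball.measurableSet),
    ← lintegral_mul_const _ (by fun_prop)]
  refine lintegral_mono fun θ => ?_
  rw [hc, ← lintegral_const_mul _ hmc]
  refine lintegral_mono fun r => ?_
  by_cases hr : r ∈ Set.Ioo (0 : ℝ) 1
  · have hmem : r • (θ : E) ∈ Metric.ball (0 : E) 1 := by
      have : ‖(θ : E)‖ = 1 := by simp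
      simpa [norm_smul, this, abs_of_pos hr.1] using hr.2
    rw [Set.indicator_of_mem hr, Set.indicator_of_mem hmem, real_inner_smul_left, abs_mul,
      abs_of_pos hr.1, ENNReal.ofReal_mul hr.1.le, mul_comm,
      ENNReal.mul_rpow_of_ne_top ENNReal.ofReal_ne_top ENNReal.ofReal_ne_top]
  · simp [Set.indicator_of_notMem hr]

lemma ae_inner_ne_zero {Z : E} (hZ : Z ≠ 0) : ∀ᵐ X : E, inner ℝ X Z ≠ 0 := by
  have h := Measure.addHaar_submodule (volume : Measure E) (ℝ ∙ Z)ᗮ (by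
    intro h
    rw [Submodule.orthogonal_eq_top_iff, Submodule.span_singleton_eq_bot] at h
    exact hZ h)
  rw [ae_iff]
  refine measure_mono_null (fun X hX => ?_) h
  simpa [Submodule.mem_orthogonal_singleton_iff_inner_left] using hX

end LinearForms

/-! ### Mellin transforms of Schwartz functions along rays -/

lemma integrableOn_rpow_div_one_add_pow {b : ℝ} (hb : -1 < b) {M : ℕ} (hM : b + 1 < M) :
    IntegrableOn (fun r : ℝ => r ^ b * (1 + r ^ M)⁻¹) (Set.Ioi 0) := by
  rw [← Set.Ioc_union_Ioi_eq_Ioi zero_le_one]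
  refine IntegrableOn.union ?_ ?_
  · refine ((intervalIntegral.intervalIntegrable_rpow' (a := 0) (b := 1) hb).1).mono'
        (by fun_prop) ?_
    filter_upwards [ae_restrict_mem measurableSet_Ioc] with r hr
    have h1 := Real.rpow_nonneg hr.1.le b
    have h2 : 0 ≤ r ^ M := pow_nonneg hr.1.le M
    rw [norm_mul, Real.norm_of_nonneg h1, Real.norm_of_nonneg (by positivity)]
    exact mul_le_of_le_one_right h1 (inv_le_one_of_one_le₀ (by linarith))
  · refine (integrableOn_Ioi_rpow_of_lt (a := b - M) (c := 1) (by linarith) one_pos).mono'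
      (by fun_prop) ?_
    filter_upwards [ae_restrict_mem measurableSet_Ioi] with r hr
    have hr0 : (0 : ℝ) < r := one_pos.trans hr
    have h1 := Real.rpow_nonneg hr0.le b
    have h2 : 0 < r ^ M := pow_pos hr0 M
    rw [norm_mul, Real.norm_of_nonneg h1, Real.norm_of_nonneg (by positivity),
      Real.rpow_sub hr0, Real.rpow_natCast, div_eq_mul_inv]
    exact mul_le_mul_of_nonneg_left (inv_anti₀ h2 (by linarith)) h1

section Ray

variable {E : Type} [NormedAddCommGroup E] [NormedSpace ℝ E]

/-- Along rays starting at a positive distance from the origin a Schwartz function has a common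
integrable majorant. -/
lemma exists_ray_majorant {G : Type} [NormedAddCommGroup G] [NormedSpace ℝ G] (Φ : 𝓢(E, G))
    {b : ℝ} (hb : -1 < b) {ε : ℝ} (hε : 0 < ε) :
    ∃ g : ℝ → ℝ, IntegrableOn g (Set.Ioi 0) ∧
      ∀ Y : E, ε ≤ ‖Y‖ → ∀ r : ℝ, 0 < r → r ^ b * ‖Φ (r • Y)‖ ≤ g r := by
  obtain ⟨M, hM⟩ := exists_nat_gt (b + 1)
  obtain ⟨C0, hC0⟩ := Φ.decay 0 0
  obtain ⟨C1, hC1⟩ := Φ.decay M 0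
  simp only [norm_iteratedFDeriv_zero, pow_zero, one_mul] at hC0 hC1
  refine ⟨fun r => (C0 + C1 / ε ^ M) * (r ^ b * (1 + r ^ M)⁻¹),
    (integrableOn_rpow_div_one_add_pow hb hM).const_mul _, fun Y hY r hr => ?_⟩
  have hrM : 0 < r ^ M := pow_pos hr M
  simp only
  rw [mul_left_comm]
  refine mul_le_mul_of_nonneg_left ?_ (Real.rpow_nonneg hr.le _)
  rw [← div_eq_mul_inv, le_div_iff₀ (by positivity), mul_add, mul_one]
  refine add_le_add (hC0.2 _) ?_
  rw [le_div_iff₀ (by positivity), mul_assoc, mul_comm]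
  refine le_trans ?_ (hC1.2 (r • Y))
  refine mul_le_mul_of_nonneg_right ?_ (norm_nonneg _)
  rw [norm_smul, mul_pow, Real.norm_of_nonneg hr.le]
  gcongr

/-- The Mellin transform `∫₀^∞ r ^ a Φ(r Y) dr` of a function along the ray through `Y`. -/
def rayMellin {G : Type} [NormedAddCommGroup G] [NormedSpace ℝ G] [NormedSpace ℂ G] (a : ℂ)
    (Φ : E → G) (Y : E) : G :=
  ∫ r in Set.Ioi (0 : ℝ), (r : ℂ) ^ a • Φ (r • Y)

lemma integrableOn_ray {G : Type} [NormedAddCommGroup G] [NormedSpace ℝ G] [NormedSpace ℂ G]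
    (Φ : 𝓢(E, G)) {a : ℂ} (ha : -1 < a.re) {Y : E} (hY : Y ≠ 0) :
    IntegrableOn (fun r : ℝ => (r : ℂ) ^ a • Φ (r • Y)) (Set.Ioi 0) := by
  obtain ⟨g, hg, hb⟩ := exists_ray_majorant Φ ha (norm_pos_iff.2 hY)
  refine hg.mono' ?_ ?_
  · refine (Complex.measurable_ofReal.pow_const a).aestronglyMeasurable.smul ?_
    exact (Φ.continuous.comp (by fun_prop : Continuous fun r : ℝ => r • Y)).aestronglyMeasurable
  · filter_upwards [ae_restrict_mem measurableSet_Ioi] with r hr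
    rw [norm_smul, Complex.norm_cpow_eq_rpow_re_of_pos hr]
    exact hb Y le_rfl r hr

lemma hasFDerivAt_rayMellin {G : Type} [NormedAddCommGroup G] [NormedSpace ℝ G] [NormedSpace ℂ G]
    [SMulCommClass ℝ ℂ G] [IsScalarTower ℝ ℂ G] (Φ : 𝓢(E, G)) {a : ℂ} (ha : -1 < a.re) {Y : E}
    (hY : Y ≠ 0) :
    HasFDerivAt (rayMellin a Φ) (rayMellin (a + 1) (SchwartzMap.fderivCLM ℝ E G Φ) Y) Y := by
  have hε : 0 < ‖Y‖ / 2 := by have := norm_pos_iff.2 hY; positivity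
  obtain ⟨g, hg, hb⟩ := exists_ray_majorant (SchwartzMap.fderivCLM ℝ E G Φ) (b := (a + 1).re)
    (by simp; linarith) hε
  refine hasFDerivAt_integral_of_dominated_of_fderiv_le (bound := g) (Metric.ball_mem_nhds Y hε)
    (F := fun (Z : E) (r : ℝ) => (r : ℂ) ^ a • Φ (r • Z))
    (F' := fun (Z : E) (r : ℝ) => (r : ℂ) ^ (a + 1) • SchwartzMap.fderivCLM ℝ E G Φ (r • Z))
    ?_ (integrableOn_ray Φ ha hY) ?_ ?_ hg ?_
  · refine Eventually.of_forall fun Z => (Complex.measurable_ofReal.pow_const a).aestronglyMeasurable.smul ?_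
    exact (Φ.continuous.comp (by fun_prop : Continuous fun r : ℝ => r • Z)).aestronglyMeasurable
  · exact (integrableOn_ray (SchwartzMap.fderivCLM ℝ E G Φ) (by simp; linarith)
      hY).aestronglyMeasurable
  · filter_upwards [ae_restrict_mem measurableSet_Ioi] with r hr Z hZ
    rw [norm_smul, Complex.norm_cpow_eq_rpow_re_of_pos hr]
    refine hb Z ?_ r hr
    have h1 := norm_sub_norm_le Y Z
    rw [Metric.mem_ball', dist_eq_norm] at hZ
    linarith
  · filter_upwards [ae_restrict_mem measurableSet_Ioi] with r hr Z hZ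
    have hr' : (r : ℂ) ≠ 0 := by exact_mod_cast (ne_of_gt hr)
    have h1 : HasFDerivAt (fun Z : E => Φ (r • Z)) (r • fderiv ℝ Φ (r • Z)) Z := by
      have := (Φ.differentiableAt (x := r • Z)).hasFDerivAt.comp Z ((hasFDerivAt_id Z).const_smul r)
      exact this.congr_fderiv (by ext v; simp)
    refine (h1.const_smul ((r : ℂ) ^ a)).congr_fderiv ?_
    rw [Complex.cpow_add _ _ hr', Complex.cpow_one, SchwartzMap.fderivCLM_apply, mul_smul]
    congr 1
    exact (algebraMap_smul ℂ r _).symm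

lemma contDiffOn_rayMellin_nat (k : ℕ) : ∀ {G : Type} [NormedAddCommGroup G] [NormedSpace ℝ G]
    [NormedSpace ℂ G] [SMulCommClass ℝ ℂ G] [IsScalarTower ℝ ℂ G] (Φ : 𝓢(E, G)) {a : ℂ},
    -1 < a.re → ContDiffOn ℝ k (rayMellin a Φ) {0}ᶜ := by
  induction k with
  | zero =>
    intro G _ _ _ _ _ Φ a ha
    exact contDiffOn_zero.2 fun Y hY =>
      (hasFDerivAt_rayMellin Φ ha hY).continuousAt.continuousWithinAt
  | succ k ih =>
    intro G _ _ _ _ _ Φ a ha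
    push_cast
    rw [contDiffOn_succ_iff_fderiv_of_isOpen isOpen_compl_singleton]
    refine ⟨fun Y hY => (hasFDerivAt_rayMellin Φ ha hY).differentiableAt.differentiableWithinAt,
      by simp, ?_⟩
    refine (ih (SchwartzMap.fderivCLM ℝ E G Φ) (a := a + 1)
        (by simp; linarith)).congr fun Y hY => ?_
    exact (hasFDerivAt_rayMellin Φ ha hY).fderiv

lemma contDiffOn_rayMellin {G : Type} [NormedAddCommGroup G] [NormedSpace ℝ G] [NormedSpace ℂ G]
    [SMulCommClass ℝ ℂ G] [IsScalarTower ℝ ℂ G] (Φ : 𝓢(E, G)) {a : ℂ} (ha : -1 < a.re) :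
    ContDiffOn ℝ ∞ (rayMellin a Φ) {0}ᶜ :=
  contDiffOn_infty.2 fun k => contDiffOn_rayMellin_nat k Φ ha

lemma differentiableOn_rayMellin (Φ : 𝓢(E, ℂ)) {Y : E} (hY : Y ≠ 0) :
    DifferentiableOn ℂ (fun a => rayMellin a Φ Y) {a | -1 < a.re} := by
  have h : ∀ a, rayMellin a Φ Y = ∫ r in Set.Ioi (0 : ℝ), Φ (r • Y) * (r : ℂ) ^ a := fun a =>
    integral_congr_ae (Eventually.of_forall fun r => by simp [mul_comm])
  simp_rw [h]
  refine differentiableOn_integral_mul_cpow ?_ (by fun_prop) (ae_restrict_mem measurableSet_Ioi)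
    (isOpen_lt continuous_const Complex.continuous_re) ?_
  · exact (Φ.continuous.comp (by fun_prop : Continuous fun r : ℝ => r • Y)).aestronglyMeasurable
  · intro s hs
    refine (integrableOn_ray Φ hs hY).norm.congr ?_
    filter_upwards [ae_restrict_mem measurableSet_Ioi] with r hr
    rw [norm_smul, Complex.norm_cpow_eq_rpow_re_of_pos hr, mul_comm]

lemma contDiffOn_ofReal_cpow {g : E → ℝ} {S : Set E} (hg : ContDiffOn ℝ ∞ g S)
    (hpos : ∀ X ∈ S, 0 < g X) (s : ℂ) : ContDiffOn ℝ ∞ (fun X => (g X : ℂ) ^ s) S := by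
  have h : ContDiffOn ℝ ∞ (fun X => Complex.exp ((Real.log (g X) : ℂ) * s)) S :=
    ((Complex.ofRealCLM.contDiff.comp_contDiffOn (hg.log fun X hX => (hpos X hX).ne')).mul
      contDiffOn_const).cexp
  refine h.congr fun X hX => ?_
  rw [Complex.cpow_def_of_ne_zero (by exact_mod_cast (hpos X hX).ne'),
    ← Complex.ofReal_log (hpos X hX).le]

end Ray

/-! ### Smooth dependence of integrals of powers of linear forms -/


lemma sgnPow_zero (r : ℝ) : sgnPow 0 r = 1 := by simp [sgnPow]

lemma sgnPow_one (r : ℝ) : sgnPow 1 r = (Real.sign r : ℝ) := by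
  simp [sgnPow, ZMod.val_one]

lemma zmod_two_cases (δ : ZMod 2) : δ = 0 ∨ δ = 1 := by
  fin_cases δ
  · exact Or.inl rfl
  · exact Or.inr rfl

lemma sgnPow_of_pos (δ : ZMod 2) {r : ℝ} (hr : 0 < r) : sgnPow δ r = 1 := by
  simp [sgnPow, Real.sign_of_pos hr]

lemma sgnPow_mul (δ : ZMod 2) (r t : ℝ) : sgnPow δ (r * t) = sgnPow δ r * sgnPow δ t := by
  have h : Real.sign (r * t) = Real.sign r * Real.sign t := by
    rcases lt_trichotomy r 0 with hr | hr | hr <;> rcases lt_trichotomy t 0 with ht | ht | ht <;>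
    simp [hr, ht, Real.sign_of_pos, Real.sign_of_neg, mul_pos_of_neg_of_neg, mul_neg_of_neg_of_pos,
      mul_neg_of_pos_of_neg]
  simp [sgnPow, h, mul_pow]

lemma measurable_sgnPow (δ : ZMod 2) : Measurable (sgnPow δ) := by
  have h : Measurable Real.sign := by
    unfold Real.sign
    exact Measurable.ite measurableSet_Iio measurable_const
      (Measurable.ite measurableSet_Ioi measurable_const measurable_const)
  exact (Complex.measurable_ofReal.comp h).pow_const _

lemma norm_sgnPow_le (δ : ZMod 2) (r : ℝ) : ‖sgnPow δ r‖ ≤ 1 := by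
  rw [sgnPow, norm_pow, Complex.norm_real]
  refine pow_le_one₀ (norm_nonneg _) ?_
  rcases Real.sign_apply_eq r with h | h | h <;> simp [h]

lemma norm_sgnPow (δ : ZMod 2) {r : ℝ} (hr : r ≠ 0) : ‖sgnPow δ r‖ = 1 := by
  rw [sgnPow, norm_pow, Complex.norm_real]
  rcases Real.sign_apply_eq_of_ne_zero r hr with h | h <;> simp [h]

lemma sgnPow_mul_self (δ : ZMod 2) {r : ℝ} (hr : r ≠ 0) : sgnPow δ r * sgnPow δ r = 1 := by
  rw [← sgnPow_mul, sgnPow_of_pos δ (mul_self_pos.2 hr)]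

/-- The signed power `|u| ^ s (sgn u) ^ δ`. -/
def signedPow (s : ℂ) (δ : ZMod 2) (u : ℝ) : ℂ := ((|u| : ℝ) : ℂ) ^ s * sgnPow δ u

lemma measurable_signedPow (s : ℂ) (δ : ZMod 2) : Measurable (signedPow s δ) :=
  ((Complex.measurable_ofReal.comp measurable_norm).pow_const _).mul (measurable_sgnPow δ)

lemma signedPow_mul (s : ℂ) (δ : ZMod 2) (u v : ℝ) :
    signedPow s δ (u * v) = signedPow s δ u * signedPow s δ v := by
  rw [signedPow, signedPow, signedPow, sgnPow_mul, abs_mul, Complex.ofReal_mul,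
    Complex.mul_cpow_ofReal_nonneg (abs_nonneg _) (abs_nonneg _)]
  ring

lemma signedPow_of_pos (s : ℂ) (δ : ZMod 2) {u : ℝ} (hu : 0 < u) :
    signedPow s δ u = (u : ℂ) ^ s := by
  rw [signedPow, abs_of_pos hu, sgnPow_of_pos δ hu, mul_one]

lemma norm_signedPow (s : ℂ) (δ : ZMod 2) {u : ℝ} (hu : u ≠ 0) :
    ‖signedPow s δ u‖ = |u| ^ s.re := by
  rw [signedPow, norm_mul, norm_sgnPow δ hu, mul_one,
    Complex.norm_cpow_eq_rpow_re_of_pos (abs_pos.2 hu)]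

section

variable {E : Type} [NormedAddCommGroup E] [InnerProductSpace ℝ E] [FiniteDimensional ℝ E]
  [MeasurableSpace E] [BorelSpace E]

lemma integrableOn_ball_abs_inner_rpow {s : ℝ} (hs : -1 < s) {Z : E} (hZ : Z ≠ 0) (R : ℝ) :
    IntegrableOn (fun X : E => |inner ℝ X Z| ^ s) (Metric.ball 0 R) := by
  obtain ⟨C, hC, h⟩ := exists_lintegral_ball_inner_rpow_le (E := E) hs R
  have hn : ‖Z‖ ≠ 0 := norm_ne_zero_iff.2 hZ
  have h1 : IntegrableOn (fun X : E => |inner ℝ X (‖Z‖⁻¹ • Z)| ^ s) (Metric.ball 0 R) := by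
    refine ⟨(by fun_prop : Measurable fun X : E =>
      |inner ℝ X (‖Z‖⁻¹ • Z)| ^ s).aestronglyMeasurable, ?_⟩
    rw [hasFiniteIntegral_iff_norm]
    refine lt_of_le_of_lt (lintegral_mono_ae ?_) ((h (‖Z‖⁻¹ • Z)
        (by simp [norm_smul, hn])).trans_lt hC)
    filter_upwards [ae_restrict_of_ae (ae_inner_ne_zero
        (smul_ne_zero (inv_ne_zero hn) hZ))] with X hX
    rw [Real.norm_of_nonneg (Real.rpow_nonneg (abs_nonneg _) _),
      ENNReal.ofReal_rpow_of_pos (abs_pos.2 hX)]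
  refine (h1.const_mul (‖Z‖ ^ s)).congr (Eventually.of_forall fun X => ?_)
  simp only
  rw [← Real.mul_rpow (norm_nonneg _) (abs_nonneg _), real_inner_smul_right, abs_mul, abs_inv,
    abs_norm, mul_inv_cancel_left₀ hn]

lemma locallyIntegrable_signedPow_inner {s : ℂ} (hs : -1 < s.re) (δ : ZMod 2) {Z : E} (hZ : Z ≠ 0) :
    LocallyIntegrable fun X : E => signedPow s δ (inner ℝ X Z) := by
  rw [locallyIntegrable_iff]
  intro K hK
  obtain ⟨R, hR⟩ := hK.isBounded.subset_ball 0
  refine IntegrableOn.mono_set ?_ hR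
  refine (integrableOn_ball_abs_inner_rpow hs hZ R).mono' ?_ ?_
  · exact ((measurable_signedPow s δ).comp (by fun_prop)).aestronglyMeasurable
  · filter_upwards [ae_restrict_of_ae (ae_inner_ne_zero hZ)] with X hX
    rw [norm_signedPow s δ hX]

lemma integrable_mul_signedPow_inner {s : ℂ} (hs : -1 < s.re) (δ : ZMod 2) {Z : E} (hZ : Z ≠ 0)
    {H : E → ℂ} (hH : Continuous H) (hc : HasCompactSupport H) :
    Integrable fun X => H X * signedPow s δ (inner ℝ X Z) := by
  simpa [smul_eq_mul] using
    (locallyIntegrable_signedPow_inner hs δ hZ).integrable_smul_left_of_hasCompactSupport hH hc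

/-- The integral of a test function against a signed power of `⟨X, Z⟩` is smooth in `Z ≠ 0`,
although the power is not. A reflection exchanging the directions of `Z` and `-Z₀`, which depends
smoothly on `Z` near `Z₀`, moves the dependence on `Z` to the test function. -/
lemma contDiffOn_integral_signedPow_inner {s : ℂ} (hs : -1 < s.re) (δ : ZMod 2) {H : E → ℂ}
    (hH : ContDiff ℝ ∞ H) (hc : HasCompactSupport H) :
    ContDiffOn ℝ ∞ (fun Z => ∫ X, H X * signedPow s δ (inner ℝ X Z)) {0}ᶜ := by
  intro Z₀ hZ₀
  obtain ⟨R, hR⟩ := hc.isCompact.isBounded.subset_closedBall 0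
  -- the reflection in the hyperplane orthogonal to `u Z` maps `Z` to a negative multiple of `Z₀`
  set u : E → E := fun Z => ‖Z₀‖ • Z + ‖Z‖ • Z₀ with hu
  set S : Set E := {Z | Z ≠ 0 ∧ u Z ≠ 0} with hS
  have hucont : Continuous u := by fun_prop
  have hSo : IsOpen S := (isOpen_ne).inter (isOpen_ne.preimage hucont)
  have hZ₀S : Z₀ ∈ S := by
    refine ⟨hZ₀, ?_⟩
    rw [hu]
    simp only
    rw [← two_smul ℝ, smul_smul]
    have : ‖Z₀‖ ≠ 0 := norm_ne_zero_iff.2 hZ₀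
    exact smul_ne_zero (by positivity) hZ₀
  have huS : ContDiffOn ℝ ∞ u S := by
    refine ContDiffOn.add (by fun_prop) (ContDiffOn.smul ?_ contDiffOn_const)
    exact contDiffOn_id.norm ℝ fun Z hZ => hZ.1
  have hn : ∀ X, ‖X‖ > R → H X = 0 := fun X hX => by
    by_contra h
    have := hR (subset_tsupport _ h)
    rw [mem_closedBall_zero_iff] at this
    linarith
  set refl : E → E → E := fun Z X => X - (2 * inner ℝ (u Z) X / ‖u Z‖ ^ 2) • u Z with hrefl
  have hr : ∀ Z X, refl Z X = (ℝ ∙ u Z)ᗮ.reflection X := fun Z X => by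
    rw [Submodule.reflection_orthogonal_apply, Submodule.reflection_singleton_apply, hrefl]
    simp only [RCLike.ofReal_real_eq_id, id_eq]
    module
  -- the integral is a convolution evaluated at `0`, with a parameter in the smooth factor; this
  -- form gives access to the differentiability of parametric convolutions
  have hconv : ContDiffOn ℝ ∞ (fun Z => convolution (fun X : E => signedPow s δ (inner ℝ X (-Z₀)))
      (fun X => H (refl Z (-X))) (ContinuousLinearMap.mul ℝ ℂ) volume 0) S := by
    refine contDiffOn_convolution_right_with_param_comp (n := ⊤) _ contDiffOn_const hSo
      (k := Metric.closedBall (0 : E) R) (isCompact_closedBall 0 R) ?_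
      (locallyIntegrable_signedPow_inner hs δ (neg_ne_zero.2 hZ₀)) ?_
    · intro Z X _ hX
      refine hn _ ?_
      rw [hr, LinearIsometryEquiv.norm_map, norm_neg]
      simpa using hX
    · refine hH.comp_contDiffOn ?_
      have h2 : ContDiffOn ℝ ∞ (fun q : E × E => u q.1) (S ×ˢ Set.univ) :=
        huS.comp contDiffOn_fst fun q hq => hq.1
      refine ContDiffOn.sub contDiffOn_snd.neg (ContDiffOn.smul (ContDiffOn.div
        (contDiffOn_const.mul (h2.inner ℝ contDiffOn_snd.neg)) (h2.norm_sq ℝ) ?_) h2)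
      rintro q hq
      have : ‖u q.1‖ ≠ 0 := norm_ne_zero_iff.2 hq.1.2
      positivity
  have hfac : ContDiffOn ℝ ∞ (fun Z : E => ((‖Z‖ / ‖Z₀‖ : ℝ) : ℂ) ^ s) S := by
    refine contDiffOn_ofReal_cpow ((contDiffOn_id.norm ℝ fun Z hZ => hZ.1).div_const _)
        (fun Z hZ => ?_) s
    exact div_pos (norm_pos_iff.2 hZ.1) (norm_pos_iff.2 hZ₀)
  have heq : ∀ Z ∈ S, ∫ X, H X * signedPow s δ (inner ℝ X Z) = ((‖Z‖ / ‖Z₀‖ : ℝ) : ℂ) ^ s *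
      convolution (fun X : E => signedPow s δ (inner ℝ X (-Z₀)))
      (fun X => H (refl Z (-X))) (ContinuousLinearMap.mul ℝ ℂ) volume 0 := by
    intro Z hZ
    have hc : 0 < ‖Z‖ / ‖Z₀‖ := div_pos (norm_pos_iff.2 hZ.1) (norm_pos_iff.2 hZ₀)
    have hZ₀n : ‖Z₀‖ ≠ 0 := norm_ne_zero_iff.2 hZ₀
    have hRZ : (ℝ ∙ u Z)ᗮ.reflection Z = (‖Z‖ / ‖Z₀‖) • (-Z₀) := by
      have h1 := Submodule.reflection_sub (v := ‖Z₀‖ • Z) (w := -(‖Z‖ • Z₀)) (by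
        rw [norm_neg, norm_smul, norm_smul, norm_norm, norm_norm, mul_comm])
      rw [sub_neg_eq_add, map_smul] at h1
      have h2 := congrArg (fun v => ‖Z₀‖⁻¹ • v) h1
      simp only [smul_smul, inv_mul_cancel₀ hZ₀n, one_smul] at h2
      rw [hu, h2, div_eq_inv_mul, smul_neg, smul_smul, smul_neg]
    rw [← (LinearIsometryEquiv.measurePreserving (ℝ ∙ u Z)ᗮ.reflection).integral_comp
      (ℝ ∙ u Z)ᗮ.reflection.toHomeomorph.measurableEmbedding, convolution_def, ← integral_const_mul]
    refine integral_congr_ae (Eventually.of_forall fun X => ?_)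
    simp only [ContinuousLinearMap.mul_apply', zero_sub, neg_neg]
    have hin : ∀ (K : Submodule ℝ E) (W : E), inner ℝ (K.reflection X) W =
        inner ℝ X (K.reflection W) := fun K W => by
      conv_lhs => rw [← Submodule.reflection_reflection K W]
      rw [LinearIsometryEquiv.inner_map_map]
    rw [hr, hin, hRZ, real_inner_smul_right, signedPow_mul, signedPow_of_pos s δ hc]
    ring
  exact (((hfac.mul hconv).congr heq).contDiffAt (hSo.mem_nhds hZ₀S)).contDiffWithinAt

end

/-! ### The symplectic Fourier transform -/

/-- The complex structure `J (y, η) = (-η, y)`, for which `ω(X, Y) = ⟨X, J Y⟩`. -/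
def symplecticJ (m : ℕ) : Ambient m ≃ₗᵢ[ℝ] Ambient m where
  toFun Y := WithLp.toLp 2 (Sum.elim (fun i => -Y (Sum.inr i)) (fun i => Y (Sum.inl i)))
  invFun Y := WithLp.toLp 2 (Sum.elim (fun i => Y (Sum.inr i)) (fun i => -Y (Sum.inl i)))
  map_add' X Y := by
    ext i
    rcases i with i | i <;> simp [add_comm]
  map_smul' r X := by
    ext i
    rcases i with i | i <;> simp
  left_inv Y := by
    ext i
    rcases i with i | i <;> simp
  right_inv Y := by
    ext i
    rcases i with i | i <;> simp
  norm_map' Y := by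
    simp [EuclideanSpace.norm_eq, Fintype.sum_sum_type, add_comm]

lemma omega_eq_inner {m : ℕ} (X Y : Ambient m) : omega X Y = inner ℝ X (symplecticJ m Y) := by
  simp [omega, symplecticJ, PiLp.inner_apply, Fintype.sum_sum_type]
  simp [mul_comm, sub_eq_neg_add]

lemma omega_smul_left {m : ℕ} (r : ℝ) (X Y : Ambient m) : omega (r • X) Y = r * omega X Y := by
  rw [omega_eq_inner, omega_eq_inner, real_inner_smul_left]

lemma omega_smul_right {m : ℕ} (r : ℝ) (X Y : Ambient m) : omega X (r • Y) = r * omega X Y := by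
  rw [omega_eq_inner, omega_eq_inner, map_smul, real_inner_smul_right]

lemma finrank_ambient (m : ℕ) : Module.finrank ℝ (Ambient m) = 2 * (m + 1) := by
  simp [two_mul]

instance (m : ℕ) : Nontrivial (Ambient m) :=
  Module.nontrivial_of_finrank_pos (R := ℝ) (by rw [finrank_ambient]; positivity)

/-- The symplectic Fourier transform `∫ Φ(X) exp(-2πi ω(X, Y)) dX`. -/
def symplecticFourier {m : ℕ} (Φ : 𝓢(Ambient m, ℂ)) : 𝓢(Ambient m, ℂ) :=
  SchwartzMap.compCLMOfContinuousLinearEquiv ℂ (symplecticJ m).toContinuousLinearEquiv (𝓕 Φ)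

lemma symplecticFourier_apply {m : ℕ} (Φ : 𝓢(Ambient m, ℂ)) (Y : Ambient m) :
    symplecticFourier Φ Y = 𝓕 (Φ : Ambient m → ℂ) (symplecticJ m Y) := by
  simp [symplecticFourier, SchwartzMap.fourier_coe]

/-! ### Homogeneous functions as Mellin averages of test functions -/

/-- A bump function supported in `[1, 3]`. -/
def cutoffBump : ContDiffBump (2 : ℝ) := ⟨1 / 2, 1, by norm_num, by norm_num⟩

/-- A smooth cut-off function supported in `[1, 3]`, normalized by `∫ χ(t) dt / t = 1`. -/
def cutoff (t : ℝ) : ℝ := cutoffBump t / ∫ s in Set.Ioi (0 : ℝ), cutoffBump s * s⁻¹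

lemma cutoffBump_eq_zero {t : ℝ} (ht : t ∉ Set.Icc (1 : ℝ) 3) : cutoffBump t = 0 := by
  refine cutoffBump.zero_of_le_dist ?_
  rw [Set.mem_Icc, not_and_or, not_le, not_le] at ht
  change (1 : ℝ) ≤ _
  rw [Real.dist_eq]
  rcases ht with h | h
  · rw [abs_of_neg (by linarith)]; linarith
  · rw [abs_of_pos (by linarith)]; linarith

lemma continuous_mul_of_eq_zero {g k : ℝ → ℂ} (hg : Continuous g) (hz : ∀ t, t ≤ 1 → g t = 0)
    (hk : ContinuousOn k (Set.Ioi 0)) : Continuous fun t => g t * k t := by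
  rw [continuous_iff_continuousAt]
  intro t
  rcases lt_or_ge t 1 with ht | ht
  · have : (fun _ => (0 : ℂ)) =ᶠ[𝓝 t] fun t => g t * k t := by
      filter_upwards [gt_mem_nhds ht] with s hs
      rw [hz s hs.le, zero_mul]
    exact continuousAt_const.congr this
  · exact hg.continuousAt.mul (hk.continuousAt (Ioi_mem_nhds (by linarith)))

lemma integrable_cutoffBump_mul_inv : Integrable fun s : ℝ => cutoffBump s * s⁻¹ := by
  have h : Continuous fun s : ℝ => (cutoffBump s : ℂ) * ((s⁻¹ : ℝ) : ℂ) := by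
    refine continuous_mul_of_eq_zero (Complex.continuous_ofReal.comp cutoffBump.continuous) ?_ ?_
    · intro t ht
      have : cutoffBump t = 0 := by
        refine cutoffBump.zero_of_le_dist ?_
        change (1 : ℝ) ≤ _
        rw [Real.dist_eq, abs_of_neg (by linarith)]; linarith
      simp [this]
    · exact Complex.continuous_ofReal.comp_continuousOn
        (continuousOn_inv₀.mono fun x hx => ne_of_gt hx)
  have h2 : Integrable fun s : ℝ => (cutoffBump s : ℂ) * ((s⁻¹ : ℝ) : ℂ) := by
    refine h.integrable_of_hasCompactSupport (HasCompactSupport.intro (isCompact_Icc (a := (1 : ℝ))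
      (b := 3)) fun t ht => ?_)
    rw [cutoffBump_eq_zero ht]
    simp
  have := h2.re
  simpa [← Complex.ofReal_mul, ← Complex.ofReal_inv, -Complex.ofReal_inv] using this

lemma integral_cutoffBump_pos : 0 < ∫ s in Set.Ioi (0 : ℝ), cutoffBump s * s⁻¹ := by
  rw [setIntegral_pos_iff_support_of_nonneg_ae _ integrable_cutoffBump_mul_inv.integrableOn]
  · refine lt_of_lt_of_le ?_ (measure_mono (s := Set.Ioo (3 / 2 : ℝ) 2) fun t ht => ?_)
    · simp; norm_num
    · refine ⟨?_, by simp; linarith [ht.1]⟩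
      rw [Function.mem_support]
      refine mul_ne_zero (ne_of_gt (cutoffBump.pos_of_mem_ball ?_))
          (by linarith [ht.1, inv_pos.2 (by linarith [ht.1] : 0 < t)] |> ne_of_gt)
      change dist t 2 < 1
      rw [Real.dist_eq, abs_of_neg (by linarith [ht.2])]
      linarith [ht.1]
  · filter_upwards [ae_restrict_mem measurableSet_Ioi] with s hs
    exact mul_nonneg cutoffBump.nonneg (inv_nonneg.2 (le_of_lt hs))

lemma cutoff_eq_zero {t : ℝ} (ht : t ∉ Set.Icc (1 : ℝ) 3) : cutoff t = 0 := by
  rw [cutoff, cutoffBump_eq_zero ht, zero_div]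

lemma cutoff_eq_zero_of_le {t : ℝ} (ht : t ≤ 1) : cutoff t = 0 := by
  have : cutoffBump t = 0 := by
    refine cutoffBump.zero_of_le_dist ?_
    change (1 : ℝ) ≤ _
    rw [Real.dist_eq, abs_of_neg (by linarith)]; linarith
  rw [cutoff, this, zero_div]

lemma contDiff_cutoff : ContDiff ℝ ∞ cutoff := cutoffBump.contDiff.div_const _

lemma integral_cutoff : ∫ t in Set.Ioi (0 : ℝ), cutoff t * t⁻¹ = 1 := by
  have : ∀ t, cutoff t * t⁻¹ = (∫ s in Set.Ioi (0 : ℝ), cutoffBump s * s⁻¹)⁻¹ *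
      (cutoffBump t * t⁻¹) := fun t => by rw [cutoff]; ring
  simp_rw [this]
  rw [integral_const_mul, inv_mul_cancel₀ integral_cutoffBump_pos.ne']

lemma integral_cutoff_mul {c : ℝ} (hc : 0 < c) :
    ∫ t in Set.Ioi (0 : ℝ), cutoff (t * c) * t⁻¹ = 1 := by
  have h := integral_comp_mul_right_Ioi (fun t => cutoff t * t⁻¹) 0 hc
  rw [zero_mul, integral_cutoff, smul_eq_mul, mul_one] at h
  have e : ∀ t, cutoff (t * c) * t⁻¹ = c * (cutoff (t * c) * (t * c)⁻¹) := fun t => by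
    rw [mul_inv]
    field_simp
  simp_rw [e]
  rw [integral_const_mul, h, mul_inv_cancel₀ hc.ne']

lemma integrable_cutoff_cpow (s : ℂ) :
    Integrable fun t : ℝ => (cutoff t : ℂ) * (t : ℂ) ^ s := by
  have h : Continuous fun t : ℝ => (cutoff t : ℂ) * (t : ℂ) ^ s := by
    refine continuous_mul_of_eq_zero (Complex.continuous_ofReal.comp contDiff_cutoff.continuous)
      (fun t ht => by simp [cutoff_eq_zero_of_le ht]) ?_
    intro t ht
    exact (Complex.continuousAt_ofReal_cpow_const t s (Or.inr (ne_of_gt ht))).continuousWithinAt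
  refine h.integrable_of_hasCompactSupport (HasCompactSupport.intro (isCompact_Icc (a := (1 : ℝ))
    (b := 3)) fun t ht => ?_)
  rw [cutoff_eq_zero ht]
  simp

/-- The Mellin transform of the cut-off function. -/
def cutoffMellin (s : ℂ) : ℂ := ∫ t in Set.Ioi (0 : ℝ), (cutoff t : ℂ) * (t : ℂ) ^ (s - 1)

lemma cutoffMellin_zero : cutoffMellin 0 = 1 := by
  have h := congrArg (fun x : ℝ => (x : ℂ)) integral_cutoff
  simp only [Complex.ofReal_one] at h
  rw [← h, ← integral_complex_ofReal, cutoffMellin]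
  refine integral_congr_ae (Eventually.of_forall fun t => ?_)
  simp [Complex.cpow_neg_one]

lemma differentiable_cutoffMellin : Differentiable ℂ cutoffMellin := by
  have h : DifferentiableOn ℂ (fun s : ℂ => ∫ t in Set.Ioi (0 : ℝ), (cutoff t : ℂ) * (t : ℂ) ^ s)
      Set.univ := by
    refine differentiableOn_integral_mul_cpow ?_ (by fun_prop) (ae_restrict_mem measurableSet_Ioi)
      isOpen_univ fun s _ => ?_
    · exact (Complex.continuous_ofReal.comp contDiff_cutoff.continuous).aestronglyMeasurable
    · refine (integrable_cutoff_cpow s).integrableOn.norm.congr ?_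
      filter_upwards [ae_restrict_mem measurableSet_Ioi] with t ht
      rw [norm_mul, Complex.norm_cpow_eq_rpow_re_of_pos ht]
  exact (differentiableOn_univ.1 h).comp (differentiable_id.sub_const 1)

/-- The function `χ(|X|) f(X)`, from which a homogeneous function `f` is recovered by a Mellin
average. -/
def truncate {m : ℕ} (f : Ambient m → ℂ) (X : Ambient m) : ℂ := (cutoff ‖X‖ : ℂ) * f X

lemma truncate_eq_zero {m : ℕ} (f : Ambient m → ℂ) {X : Ambient m} (hX : ‖X‖ ∉ Set.Icc (1 : ℝ) 3) :
    truncate f X = 0 := by rw [truncate, cutoff_eq_zero hX]; simp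

lemma hasCompactSupport_truncate {m : ℕ} (f : Ambient m → ℂ) : HasCompactSupport (truncate f) := by
  refine HasCompactSupport.intro (isCompact_closedBall (0 : Ambient m) 3) fun X hX => ?_
  refine truncate_eq_zero f fun h => hX ?_
  simpa using h.2

lemma contDiff_truncate {m : ℕ} {f : Ambient m → ℂ} (hf : ContDiffOn ℝ ∞ f {0}ᶜ) :
    ContDiff ℝ ∞ (truncate f) := by
  rw [contDiff_iff_contDiffAt]
  intro X
  by_cases hX : X = 0
  · have : (fun _ => (0 : ℂ)) =ᶠ[𝓝 X] truncate f := by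
      filter_upwards [Metric.ball_mem_nhds X one_pos] with Y hY
      rw [hX, mem_ball_zero_iff] at hY
      exact (truncate_eq_zero f fun h => absurd h.1 (not_le.2 hY)).symm
    exact contDiffAt_const.congr_of_eventuallyEq this.symm
  · refine ContDiffAt.mul ?_ (hf.contDiffAt (isOpen_compl_singleton.mem_nhds hX))
    exact Complex.ofRealCLM.contDiff.contDiffAt.comp X
      (contDiff_cutoff.contDiffAt.comp X (contDiffAt_norm ℝ hX))

/-- The test function `χ(|X|) f(X)` as a Schwartz function. -/
def generator {m : ℕ} {f : Ambient m → ℂ} (hf : ContDiffOn ℝ ∞ f {0}ᶜ) : 𝓢(Ambient m, ℂ) :=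
  (hasCompactSupport_truncate f).toSchwartzMap (contDiff_truncate hf)

lemma generator_apply {m : ℕ} {f : Ambient m → ℂ} (hf : ContDiffOn ℝ ∞ f {0}ᶜ) (X : Ambient m) :
    generator hf X = truncate f X := rfl

lemma IsHomog.smul_pos {m : ℕ} {μ : ℂ} {δ : ZMod 2} {f : Ambient m → ℂ} (hf : IsHomog m μ δ f)
    {r : ℝ} (hr : 0 < r) {X : Ambient m} (hX : X ≠ 0) :
    f (r • X) = (r : ℂ) ^ (-((m + 1 : ℕ) : ℂ) - μ) * f X := by
  rw [hf r hr.ne' X hX, sgnPow_of_pos δ hr, one_mul, abs_of_pos hr]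

lemma IsHomog.neg {m : ℕ} {μ : ℂ} {δ : ZMod 2} {f : Ambient m → ℂ} (hf : IsHomog m μ δ f)
    {X : Ambient m} (hX : X ≠ 0) : f (-X) = sgnPow δ (-1) * f X := by
  have := hf (-1) (by norm_num) X hX
  simpa using this

lemma truncate_neg {m : ℕ} {μ : ℂ} {δ : ZMod 2} {f : Ambient m → ℂ} (hf : IsHomog m μ δ f)
    (X : Ambient m) : truncate f (-X) = sgnPow δ (-1) * truncate f X := by
  by_cases hX : X = 0
  · subst hX
    rw [neg_zero, truncate_eq_zero f (by simp), mul_zero]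
  · rw [truncate, truncate, norm_neg, hf.neg hX]
    ring

lemma integrand_truncate {m : ℕ} {μ : ℂ} {δ : ZMod 2} {f : Ambient m → ℂ}
    (hf : IsHomog m (-μ) δ f) {X : Ambient m} (hX : X ≠ 0) {r : ℝ} (hr : 0 < r) :
    (r : ℂ) ^ (((m + 1 : ℕ) : ℂ) - 1 - μ) * truncate f (r • X) =
      ((cutoff (r * ‖X‖) * r⁻¹ : ℝ) : ℂ) * f X := by
  have hr' : (r : ℂ) ≠ 0 := by exact_mod_cast hr.ne'
  rw [truncate, hf.smul_pos hr hX, norm_smul, Real.norm_of_nonneg hr.le]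
  have : (r : ℂ) ^ (((m + 1 : ℕ) : ℂ) - 1 - μ) * (r : ℂ) ^ (-((m + 1 : ℕ) : ℂ) - -μ) =
      (r : ℂ)⁻¹ := by
    rw [← Complex.cpow_add _ _ hr', ← Complex.cpow_neg_one]
    congr 1
    ring
  rw [mul_left_comm, ← mul_assoc ((r : ℂ) ^ _), this]
  push_cast
  ring

/-- A homogeneous function is the Mellin average of its truncation. -/
lemma rayMellin_truncate {m : ℕ} {μ : ℂ} {δ : ZMod 2} {f : Ambient m → ℂ}
    (hf : IsHomog m (-μ) δ f) {X : Ambient m} (hX : X ≠ 0) :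
    rayMellin (((m + 1 : ℕ) : ℂ) - 1 - μ) (truncate f) X = f X := by
  rw [rayMellin, setIntegral_congr_fun measurableSet_Ioi fun r hr => by
    rw [smul_eq_mul, integrand_truncate hf hX hr], integral_mul_const, integral_complex_ofReal,
    integral_cutoff_mul (norm_pos_iff.2 hX), Complex.ofReal_one, one_mul]

/-! ### The Knapp–Stein integral in terms of the symplectic Fourier transform -/

lemma mul_I_cpow_of_pos {y : ℝ} (hy : 0 < y) (b : ℂ) :
    ((y : ℂ) * Complex.I) ^ (-b) = (y : ℂ) ^ (-b) * Complex.exp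
        (-(Real.pi * b / 2 * Complex.I)) := by
  have hI : Complex.I ≠ 0 := Complex.I_ne_zero
  rw [Complex.cpow_def_of_ne_zero (mul_ne_zero (by exact_mod_cast hy.ne') hI),
    Complex.log_ofReal_mul hy hI, Complex.cpow_def_of_ne_zero (by exact_mod_cast hy.ne'),
    ← Complex.exp_add, Complex.log_I, ← Complex.ofReal_log hy.le]
  congr 1
  ring

lemma neg_mul_I_cpow_of_pos {y : ℝ} (hy : 0 < y) (b : ℂ) :
    (((-y : ℝ) : ℂ) * Complex.I) ^ (-b) =
      (y : ℂ) ^ (-b) * Complex.exp (Real.pi * b / 2 * Complex.I) := by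
  have hI : -Complex.I ≠ 0 := neg_ne_zero.2 Complex.I_ne_zero
  rw [show (((-y : ℝ) : ℂ) * Complex.I) = (y : ℂ) * (-Complex.I) by push_cast; ring,
    Complex.cpow_def_of_ne_zero (mul_ne_zero (by exact_mod_cast hy.ne') hI),
    Complex.log_ofReal_mul hy hI, Complex.cpow_def_of_ne_zero (by exact_mod_cast hy.ne'),
    ← Complex.exp_add, Complex.log_neg_I, ← Complex.ofReal_log hy.le]
  congr 1
  ring

/-- The inverse of the even normalizing constant at `ν = b - n`, by the functional equation of the
`Γ`-factor `Γ_ℝ`. -/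
lemma normConst_inv_zero (m : ℕ) {b : ℂ} (h0 : 0 < b.re) :
    (normConst m (b - ((m + 1 : ℕ) : ℂ)) 0)⁻¹ =
      Complex.Gamma b * (2 * Real.pi : ℂ) ^ (-b) * Complex.cos (Real.pi * b / 2) := by
  have hn : ∀ n : ℕ, b ≠ -n := fun n h => by
    rw [h] at h0
    simp at h0
    linarith [(Nat.cast_nonneg n : (0 : ℝ) ≤ n)]
  have h := Complex.inv_Gammaℝ_one_sub hn
  have hG : Complex.Gammaℝ b ≠ 0 := Complex.Gammaℝ_ne_zero_of_re_pos h0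
  have hpi : (Real.pi : ℂ) ≠ 0 := by exact_mod_cast Real.pi_pos.ne'
  have h2 : Complex.Gamma b * (2 * Real.pi : ℂ) ^ (-b) * Complex.cos (Real.pi * b / 2) =
      (Complex.Gammaℝ (1 - b))⁻¹ * Complex.Gammaℝ b / 2 := by
    rw [h, Complex.Gammaℂ_def]
    field_simp
  rw [h2, normConst, if_pos rfl, Complex.Gammaℝ_def, Complex.Gammaℝ_def]
  have e1 : (1 - (b - ((m + 1 : ℕ) : ℂ)) - ((m + 1 : ℕ) : ℂ)) / 2 = (1 - b) / 2 := by ring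
  have e2 : (b - ((m + 1 : ℕ) : ℂ) + ((m + 1 : ℕ) : ℂ)) / 2 = b / 2 := by ring
  have e3 : b - ((m + 1 : ℕ) : ℂ) + ((m + 1 : ℕ) : ℂ) - 1 / 2 =
      -(b * -1 / 2 + (1 - b) / 2) := by ring
  have e4 : (Real.pi : ℂ) ^ (b - ((m + 1 : ℕ) : ℂ) + ((m + 1 : ℕ) : ℂ) - 1 / 2) =
      (Real.pi : ℂ) ^ (-(1 - b) / 2) * ((Real.pi : ℂ) ^ (-b / 2))⁻¹ := by
    rw [← Complex.cpow_neg, ← Complex.cpow_add _ _ hpi]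
    congr 1
    ring
  rw [e1, e2, e4]
  simp only [mul_inv, inv_inv, inv_div]
  ring

/-- The inverse of the odd normalizing constant at `ν = b - n`, by the functional equation of the
`Γ`-factor `Γ_ℝ`. -/
lemma normConst_inv_one (m : ℕ) {b : ℂ} (h0 : 0 < b.re) :
    (normConst m (b - ((m + 1 : ℕ) : ℂ)) 1)⁻¹ =
      -Complex.I * (Complex.Gamma b * (2 * Real.pi : ℂ) ^ (-b) * Complex.sin
          (Real.pi * b / 2)) := by
  have hn : ∀ n : ℕ, b ≠ -n := fun n h => by
    rw [h] at h0
    simp at h0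
    linarith [(Nat.cast_nonneg n : (0 : ℝ) ≤ n)]
  have h := Complex.inv_Gammaℝ_two_sub hn
  have hG : Complex.Gammaℝ (b + 1) ≠ 0 := Complex.Gammaℝ_ne_zero_of_re_pos (by simp; linarith)
  have hpi : (Real.pi : ℂ) ≠ 0 := by exact_mod_cast Real.pi_pos.ne'
  have h2 : Complex.Gamma b * (2 * Real.pi : ℂ) ^ (-b) * Complex.sin (Real.pi * b / 2) =
      (Complex.Gammaℝ (2 - b))⁻¹ * Complex.Gammaℝ (b + 1) / 2 := by
    rw [h, Complex.Gammaℂ_def]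
    field_simp
  rw [h2, normConst, if_neg (by decide), Complex.Gammaℝ_def, Complex.Gammaℝ_def]
  have e1 : (2 - (b - ((m + 1 : ℕ) : ℂ)) - ((m + 1 : ℕ) : ℂ)) / 2 = (2 - b) / 2 := by ring
  have e2 : (b - ((m + 1 : ℕ) : ℂ) + ((m + 1 : ℕ) : ℂ) + 1) / 2 = (b + 1) / 2 := by ring
  have e4 : (Real.pi : ℂ) ^ (b - ((m + 1 : ℕ) : ℂ) + ((m + 1 : ℕ) : ℂ) - 1 / 2) =
      (Real.pi : ℂ) ^ (-(2 - b) / 2) * ((Real.pi : ℂ) ^ (-(b + 1) / 2))⁻¹ := by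
    rw [← Complex.cpow_neg, ← Complex.cpow_add _ _ hpi]
    congr 1
    ring
  rw [e1, e2, e4]
  simp only [mul_inv, inv_inv, inv_div, Complex.inv_I]
  ring

lemma sgnPow_neg_one_zero : sgnPow 0 (-1) = 1 := sgnPow_zero _

lemma sgnPow_neg_one_one : sgnPow 1 (-1) = -1 := by
  rw [sgnPow_one, Real.sign_of_neg (by norm_num)]; simp

lemma signedPow_neg (s : ℂ) (δ : ZMod 2) (u : ℝ) :
    signedPow s δ (-u) = sgnPow δ (-1) * signedPow s δ u := by
  rw [neg_eq_neg_one_mul, signedPow_mul]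
  congr 1
  simp [signedPow]

/-- The parity part of the boundary value of `Γ(b) z ^ (-b)` on the imaginary axis is a multiple of
the signed power, and the multiple is the inverse of the normalizing constant. -/
lemma gamma_mul_boundary_values (m : ℕ) (δ : ZMod 2) {b : ℂ} (h0 : 0 < b.re) {y : ℝ} (hy : y ≠ 0) :
    Complex.Gamma b * (((2 * Real.pi * y : ℝ) * Complex.I) ^ (-b) +
      sgnPow δ (-1) * ((2 * Real.pi * (-y) : ℝ) * Complex.I) ^ (-b)) =
      2 * (normConst m (b - ((m + 1 : ℕ) : ℂ)) δ)⁻¹ * signedPow (-b) δ y := by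
  have hpos : ∀ {y : ℝ}, 0 < y → Complex.Gamma b * (((2 * Real.pi * y : ℝ) * Complex.I) ^ (-b) +
      sgnPow δ (-1) * ((2 * Real.pi * (-y) : ℝ) * Complex.I) ^ (-b)) =
      2 * (normConst m (b - ((m + 1 : ℕ) : ℂ)) δ)⁻¹ * signedPow (-b) δ y := by
    intro y hy
    have hy2 : 0 < 2 * Real.pi * y := by positivity
    have hsplit : ((2 * Real.pi * y : ℝ) : ℂ) ^ (-b) = (2 * Real.pi : ℂ) ^ (-b) * (y : ℂ) ^
        (-b) := by
      rw [Complex.ofReal_mul, Complex.mul_cpow_ofReal_nonneg (by positivity) hy.le]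
      push_cast
      rfl
    rw [mul_neg, mul_I_cpow_of_pos hy2, neg_mul_I_cpow_of_pos hy2, signedPow_of_pos _ _ hy, hsplit]
    rcases zmod_two_cases δ with rfl | rfl
    · rw [normConst_inv_zero m h0, sgnPow_neg_one_zero, Complex.cos]
      ring_nf
    · rw [normConst_inv_one m h0, sgnPow_neg_one_one, Complex.sin]
      ring_nf
      rw [Complex.I_sq]
      ring
  rcases lt_or_gt_of_ne hy with h | h
  · have h1 := hpos (neg_pos.2 h)
    have h2 : sgnPow δ (-1) * sgnPow δ (-1) = 1 := sgnPow_mul_self δ (by norm_num)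
    rw [signedPow_neg] at h1
    have h3 := congrArg (fun z => sgnPow δ (-1) * z) h1
    simp only [neg_neg] at h3
    calc _ = sgnPow δ (-1) * (Complex.Gamma b * (((2 * Real.pi * (-y) : ℝ) * Complex.I) ^ (-b) +
          sgnPow δ (-1) * ((2 * Real.pi * y : ℝ) * Complex.I) ^ (-b))) := by
          linear_combination (-Complex.Gamma b * ((2 * Real.pi * y : ℝ) * Complex.I) ^ (-b)) * h2
      _ = _ := by
          rw [h3]
          linear_combination (2 * (normConst m (b - ((m + 1 : ℕ) : ℂ)) δ)⁻¹ * signedPow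
              (-b) δ y) * h2
  · exact hpos h

lemma knappSteinIntegral_eq (m : ℕ) (μ : ℂ) (δ : ZMod 2) (f : Ambient m → ℂ) (Y : Ambient m) :
    knappSteinIntegral m μ δ f Y = ∫ ξ : Metric.sphere (0 : Ambient m) 1,
      f ξ * signedPow (-μ - ((m + 1 : ℕ) : ℂ)) δ (omega (ξ : Ambient m) Y) ∂(sphereMeasure m) := by
  simp only [knappSteinIntegral, signedPow, mul_assoc]

lemma sphere_ne_zero {m : ℕ} (ξ : Metric.sphere (0 : Ambient m) 1) : (ξ : Ambient m) ≠ 0 := by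
  have : ‖(ξ : Ambient m)‖ = 1 := by simp
  exact norm_ne_zero_iff.1 (by rw [this]; exact one_ne_zero)

/-- The Knapp–Stein integral as an integral over the whole space: in polar coordinates the radial
integral is a Mellin transform of the cut-off function. -/
lemma integral_truncate_mul_signedPow {m : ℕ} {μ ν : ℂ} {δ : ZMod 2} {f : Ambient m → ℂ}
    (hf : f ∈ VSmooth m (-μ) δ) (hν : ν.re < 1 - ((m + 1 : ℕ) : ℝ)) {Y : Ambient m} (hY : Y ≠ 0) :
    ∫ X, truncate f X * signedPow (-ν - ((m + 1 : ℕ) : ℂ)) δ (omega X Y) =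
      cutoffMellin (μ - ν) * knappSteinIntegral m ν δ f Y := by
  have hs : -1 < (-ν - ((m + 1 : ℕ) : ℂ)).re := by
    simp only [Complex.sub_re, Complex.neg_re, Complex.natCast_re]; linarith
  have hint : Integrable fun X => truncate f X * signedPow (-ν - ((m + 1 : ℕ) : ℂ)) δ
      (omega X Y) := by
    simp_rw [omega_eq_inner]
    exact integrable_mul_signedPow_inner hs δ (by simpa using hY)
        (contDiff_truncate hf.1).continuous
      (hasCompactSupport_truncate f)
  rw [integral_polar hint, knappSteinIntegral_eq, ← integral_const_mul]
  refine integral_congr_ae (Eventually.of_forall fun ξ => ?_)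
  have hξ : ‖(ξ : Ambient m)‖ = 1 := by simp
  simp only
  rw [cutoffMellin, ← integral_mul_const]
  refine setIntegral_congr_fun measurableSet_Ioi fun r hr => ?_
  have hr0 : (0 : ℝ) < r := hr
  have hr' : (r : ℂ) ≠ 0 := by exact_mod_cast hr0.ne'
  rw [truncate, hf.2.smul_pos hr (sphere_ne_zero ξ), norm_smul, hξ, mul_one,
    Real.norm_of_nonneg hr0.le, omega_smul_left, signedPow_mul, signedPow_of_pos _ _ hr0,
    finrank_ambient, ← Complex.cpow_natCast]
  have : (r : ℂ) ^ (((2 * (m + 1) - 1 : ℕ) : ℂ)) * (r : ℂ) ^ (-((m + 1 : ℕ) : ℂ) - -μ) *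
      (r : ℂ) ^ (-ν - ((m + 1 : ℕ) : ℂ)) = (r : ℂ) ^ (μ - ν - 1) := by
    rw [← Complex.cpow_add _ _ hr', ← Complex.cpow_add _ _ hr',
      Nat.cast_sub (by omega : 1 ≤ 2 * (m + 1))]
    congr 1
    push_cast
    ring
  rw [← this]
  ring

/-- The symplectic Fourier transform of `χ(|X|) f(X)`, whose Mellin averages are the images of `f`
under the normalized Knapp–Stein operators. -/
def generatorFourier {m : ℕ} {f : Ambient m → ℂ} (hf : ContDiffOn ℝ ∞ f {0}ᶜ) : 𝓢(Ambient m, ℂ) :=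
  symplecticFourier (generator hf)

/-- In the strip `-n < Re ν < 1 - n` the normalized Knapp–Stein integral is the Mellin average of
the symplectic Fourier transform. -/
lemma rayMellin_generatorFourier {m : ℕ} {μ ν : ℂ} {δ : ZMod 2} {f : Ambient m → ℂ}
    (hf : f ∈ VSmooth m (-μ) δ) (hν0 : -((m + 1 : ℕ) : ℝ) < ν.re)
    (hν : ν.re < 1 - ((m + 1 : ℕ) : ℝ)) {Y : Ambient m} (hY : Y ≠ 0) :
    rayMellin (((m + 1 : ℕ) : ℂ) - 1 + ν) (generatorFourier hf.1) Y =
      cutoffMellin (μ - ν) * ((normConst m ν δ)⁻¹ * knappSteinIntegral m ν δ f Y) := by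
  set b : ℂ := ν + ((m + 1 : ℕ) : ℂ) with hb
  have hb0 : 0 < b.re := by rw [hb, Complex.add_re, Complex.natCast_re]; linarith
  have hb1 : b.re < 1 := by rw [hb, Complex.add_re, Complex.natCast_re]; linarith
  have hZ : symplecticJ m Y ≠ 0 := by simpa using hY
  have hs : -1 < (-b).re := by rw [Complex.neg_re]; linarith
  have hsb : -b = -ν - ((m + 1 : ℕ) : ℂ) := by rw [hb]; ring
  have hH := contDiff_truncate hf.1
  have hcs := hasCompactSupport_truncate f
  have hae := ae_inner_ne_zero hZ
  have hint := integrable_mul_signedPow_inner hs δ hZ hH.continuous hcs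
  have hint1 : Integrable fun X => ‖truncate f X‖ * |inner ℝ X (symplecticJ m Y)| ^ (-b.re) := by
    refine hint.norm.congr ?_
    filter_upwards [hae] with X hX
    rw [norm_mul, norm_signedPow _ _ hX, Complex.neg_re]
  have hray := integrableOn_ray (generatorFourier hf.1) (a := b - 1)
    (by rw [Complex.sub_re, Complex.one_re]; linarith) hY
  have key := mellin_fourier_ray (H := truncate f) (hH.continuous.integrable_of_hasCompactSupport hcs)
    hb0 hae hint1 (by
      refine hray.congr_fun (fun r _ => ?_) measurableSet_Ioi
      simp only [smul_eq_mul]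
      rw [generatorFourier, symplecticFourier_apply, map_smul]
      rfl)
  have hL : rayMellin (((m + 1 : ℕ) : ℂ) - 1 + ν) (generatorFourier hf.1) Y =
      ∫ r in Set.Ioi (0 : ℝ), (r : ℂ) ^ (b - 1) * 𝓕 (truncate f) (r • symplecticJ m Y) := by
    refine integral_congr_ae (Eventually.of_forall fun r => ?_)
    simp only [smul_eq_mul]
    rw [generatorFourier, symplecticFourier_apply, map_smul,
      show ((m + 1 : ℕ) : ℂ) - 1 + ν = b - 1 by rw [hb]; ring]
    rfl
  rw [hL, key]
  set w : Ambient m → ℂ := fun X =>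
    ((2 * Real.pi * inner ℝ X (symplecticJ m Y) : ℝ) * Complex.I) ^ (-b) with hw
  have hwint : Integrable fun X => truncate f X * w X := by
    refine (hint1.const_mul (Real.exp (Real.pi * |b.im|) * (2 * Real.pi) ^ (-b.re))).mono' ?_ ?_
    · refine hH.continuous.aestronglyMeasurable.mul ?_
      exact (by fun_prop : Measurable fun X : Ambient m =>
        ((2 * Real.pi * inner ℝ X (symplecticJ m Y) : ℝ) * Complex.I)).pow_const _
          |>.aestronglyMeasurable
    · filter_upwards [hae] with X hX
      have h1 := norm_add_cpow_le (ε := 0) (y := 2 * Real.pi * inner ℝ X (symplecticJ m Y))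
        (mul_ne_zero (by positivity) hX) hb0.le
      rw [Complex.ofReal_zero, zero_add] at h1
      rw [norm_mul]
      refine (mul_le_mul_of_nonneg_left h1 (norm_nonneg _)).trans (le_of_eq ?_)
      rw [abs_mul, Real.mul_rpow (abs_nonneg _) (abs_nonneg _),
        abs_of_pos (by positivity : 0 < 2 * Real.pi)]
      ring
  -- only the part of `w` of the parity of `f` contributes
  have hneg : ∫ X, truncate f X * w X = ∫ X, sgnPow δ (-1) * truncate f X * w (-X) := by
    rw [← integral_neg_eq_self]
    refine integral_congr_ae (Eventually.of_forall fun X => ?_)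
    simp only
    rw [truncate_neg hf.2]
  have hwint' : Integrable fun X => sgnPow δ (-1) * truncate f X * w (-X) := by
    refine hwint.comp_neg.congr (Eventually.of_forall fun X => ?_)
    simp only
    rw [truncate_neg hf.2]
  have h2 : Complex.Gamma b * ∫ X, truncate f X * w X =
      (normConst m ν δ)⁻¹ * ∫ X, truncate f X * signedPow (-ν - ((m + 1 : ℕ) : ℂ)) δ
          (omega X Y) := by
    have h3 : (2 : ℂ) * ∫ X, truncate f X * w X =
        ∫ X, (truncate f X * w X + sgnPow δ (-1) * truncate f X * w (-X)) := by
      rw [integral_add hwint hwint', ← hneg, two_mul]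
    have h4 : Complex.Gamma b * ∫ X, (truncate f X * w X + sgnPow δ (-1) * truncate f X * w (-X)) =
        2 * ((normConst m ν δ)⁻¹ *
          ∫ X, truncate f X * signedPow (-ν - ((m + 1 : ℕ) : ℂ)) δ (omega X Y)) := by
      rw [← mul_assoc, ← integral_const_mul, ← integral_const_mul]
      refine integral_congr_ae ?_
      filter_upwards [hae] with X hX
      have := gamma_mul_boundary_values m δ hb0 hX
      rw [hsb, show b - ((m + 1 : ℕ) : ℂ) = ν by rw [hb]; ring] at this
      simp only [hw, inner_neg_left, hsb, omega_eq_inner]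
      linear_combination truncate f X * this
    have h5 : (2 : ℂ) ≠ 0 := two_ne_zero
    apply mul_left_cancel₀ h5
    rw [← h4, ← h3]
    ring
  rw [h2, integral_truncate_mul_signedPow hf hν hY]
  ring

/-! ### Meromorphic continuation -/

lemma ae_sphere_omega_ne_zero {m : ℕ} {Y : Ambient m} (hY : Y ≠ 0) :
    ∀ᵐ ξ : Metric.sphere (0 : Ambient m) 1 ∂sphereMeasure m, omega (ξ : Ambient m) Y ≠ 0 := by
  obtain ⟨C, hC, h⟩ := exists_lintegral_sphere_inner_rpow_le (E := Ambient m) (s := -1 / 2)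
      (by norm_num)
  set Z := symplecticJ m Y with hZdef
  have hZ : ‖Z‖ ≠ 0 := by simpa [hZdef] using hY
  have h1 := (h (‖Z‖⁻¹ • Z) (by rw [norm_smul, norm_inv, norm_norm,
      inv_mul_cancel₀ hZ])).trans_lt hC
  filter_upwards [ae_lt_top (by fun_prop) h1.ne] with ξ hξ h0
  rw [omega_eq_inner, ← hZdef] at h0
  rw [real_inner_smul_right, h0] at hξ
  simp [ENNReal.zero_rpow_def] at hξ
  norm_num at hξ

/-- Powers of `ω(ξ, Y)` are integrable over the sphere, locally uniformly in `Y`. -/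
lemma exists_integral_sphere_omega_rpow_le (m : ℕ) {s : ℝ} (hs : -1 < s) :
    ∃ C : ℝ, ∀ Y : Ambient m, Y ≠ 0 →
      Integrable (fun ξ : Metric.sphere (0 : Ambient m) 1 => |omega (ξ : Ambient m) Y| ^ s)
        (sphereMeasure m) ∧
      ∫ ξ : Metric.sphere (0 : Ambient m) 1, |omega (ξ : Ambient m) Y| ^ s ∂(sphereMeasure m) ≤
        C * ‖Y‖ ^ s := by
  obtain ⟨C, hC, h⟩ := exists_lintegral_sphere_inner_rpow_le (E := Ambient m) hs
  have hom : ∀ Y : Ambient m, Measurable fun ξ : Metric.sphere (0 : Ambient m) 1 =>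
      |omega (ξ : Ambient m) Y| ^ s := fun Y => by
    simp_rw [omega_eq_inner]; fun_prop
  have hunit : ∀ Y : Ambient m, ‖Y‖ = 1 → ∫⁻ ξ : Metric.sphere (0 : Ambient m) 1,
      ENNReal.ofReal (|omega (ξ : Ambient m) Y| ^ s) ∂(sphereMeasure m) ≤ C := fun Y hY => by
    have hY0 : Y ≠ 0 := norm_ne_zero_iff.1 (by rw [hY]; exact one_ne_zero)
    refine le_trans (lintegral_mono_ae ?_) (h (symplecticJ m Y) (by simpa using hY))
    filter_upwards [ae_sphere_omega_ne_zero hY0] with ξ hξ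
    rw [← ENNReal.ofReal_rpow_of_pos (abs_pos.2 hξ), omega_eq_inner]
  have hunit_int : ∀ Y : Ambient m, ‖Y‖ = 1 → Integrable (fun ξ : Metric.sphere (0 : Ambient m) 1 =>
      |omega (ξ : Ambient m) Y| ^ s) (sphereMeasure m) := fun Y hY => by
    refine ⟨(hom Y).aestronglyMeasurable, ?_⟩
    rw [hasFiniteIntegral_iff_ofReal (Eventually.of_forall fun ξ => Real.rpow_nonneg
        (abs_nonneg _) _)]
    exact (hunit Y hY).trans_lt hC
  refine ⟨C.toReal, fun Y hY => ?_⟩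
  have hn : ‖Y‖ ≠ 0 := norm_ne_zero_iff.2 hY
  have hu : ‖‖Y‖⁻¹ • Y‖ = 1 := by rw [norm_smul, norm_inv, norm_norm, inv_mul_cancel₀ hn]
  have e : ∀ ξ : Metric.sphere (0 : Ambient m) 1, |omega (ξ : Ambient m) Y| ^ s =
      ‖Y‖ ^ s * |omega (ξ : Ambient m) (‖Y‖⁻¹ • Y)| ^ s := fun ξ => by
    rw [← Real.mul_rpow (norm_nonneg _) (abs_nonneg _), omega_smul_right, abs_mul, abs_inv,
        abs_norm,
      mul_inv_cancel_left₀ hn]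
  simp_rw [e]
  refine ⟨(hunit_int _ hu).const_mul _, ?_⟩
  rw [integral_const_mul, mul_comm]
  refine mul_le_mul_of_nonneg_right ?_ (Real.rpow_nonneg (norm_nonneg _) _)
  rw [integral_eq_lintegral_of_nonneg_ae
    (Eventually.of_forall fun ξ => Real.rpow_nonneg (abs_nonneg _) _) (hom _).aestronglyMeasurable]
  exact ENNReal.toReal_mono hC.ne (hunit _ hu)

lemma continuous_sphere {m : ℕ} {f : Ambient m → ℂ} (hf : ContDiffOn ℝ ∞ f {0}ᶜ) :
    Continuous fun ξ : Metric.sphere (0 : Ambient m) 1 => f ξ :=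
  hf.continuousOn.comp_continuous continuous_subtype_val fun ξ => sphere_ne_zero ξ

lemma exists_norm_sphere_le {m : ℕ} {f : Ambient m → ℂ} (hf : ContDiffOn ℝ ∞ f {0}ᶜ) :
    ∃ C : ℝ, ∀ ξ : Metric.sphere (0 : Ambient m) 1, ‖f ξ‖ ≤ C := by
  obtain ⟨C, hC⟩ := isCompact_univ.exists_bound_of_continuousOn (continuous_sphere hf).continuousOn
  exact ⟨C, fun ξ => hC ξ (Set.mem_univ _)⟩

lemma continuous_omega_left {m : ℕ} (Y : Ambient m) :
    Continuous fun ξ : Metric.sphere (0 : Ambient m) 1 => omega (ξ : Ambient m) Y := by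
  simp_rw [omega_eq_inner]; fun_prop

lemma isOpen_re_lt (c : ℝ) : IsOpen {ν : ℂ | ν.re < c} :=
  isOpen_lt Complex.continuous_re continuous_const

lemma isOpen_lt_re (c : ℝ) : IsOpen {ν : ℂ | c < ν.re} :=
  isOpen_lt continuous_const Complex.continuous_re

lemma differentiableOn_knappSteinIntegral {m : ℕ} (δ : ZMod 2) {f : Ambient m → ℂ}
    (hf : ContDiffOn ℝ ∞ f {0}ᶜ) {Y : Ambient m} (hY : Y ≠ 0) :
    DifferentiableOn ℂ (fun ν => knappSteinIntegral m ν δ f Y)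
      {ν | ν.re < 1 - ((m + 1 : ℕ) : ℝ)} := by
  obtain ⟨C, hC⟩ := exists_norm_sphere_le hf
  have h : DifferentiableOn ℂ (fun s : ℂ => ∫ ξ : Metric.sphere (0 : Ambient m) 1,
      (f ξ * sgnPow δ (omega (ξ : Ambient m) Y)) * ((|omega (ξ : Ambient m) Y| : ℝ) : ℂ) ^ s
        ∂(sphereMeasure m)) {s | -1 < s.re} := by
    have hm : AEStronglyMeasurable (fun ξ : Metric.sphere (0 : Ambient m) 1 =>
        f ξ * sgnPow δ (omega (ξ : Ambient m) Y)) (sphereMeasure m) :=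
      (continuous_sphere hf).aestronglyMeasurable.mul
        ((measurable_sgnPow δ).comp (continuous_omega_left Y).measurable).aestronglyMeasurable
    refine differentiableOn_integral_mul_cpow hm
      (continuous_omega_left Y).measurable.norm.aemeasurable
      ((ae_sphere_omega_ne_zero hY).mono fun ξ hξ => abs_pos.2 hξ) (isOpen_lt_re _) ?_
    intro s hs
    obtain ⟨C', hC'⟩ := exists_integral_sphere_omega_rpow_le m hs
    refine ((hC' Y hY).1.bdd_mul hm.norm (c := C) (Eventually.of_forall fun ξ => ?_))
    rw [norm_norm, norm_mul]
    exact (mul_le_of_le_one_right (norm_nonneg _) (norm_sgnPow_le _ _)).trans (hC ξ)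
  have h2 : (fun ν => knappSteinIntegral m ν δ f Y) = (fun s : ℂ =>
      ∫ ξ : Metric.sphere (0 : Ambient m) 1,
      (f ξ * sgnPow δ (omega (ξ : Ambient m) Y)) * ((|omega (ξ : Ambient m) Y| : ℝ) : ℂ) ^ s
        ∂(sphereMeasure m)) ∘ fun ν : ℂ => -ν - ((m + 1 : ℕ) : ℂ) := by
    funext ν
    simp only [knappSteinIntegral, Function.comp_apply]
    refine integral_congr_ae (Eventually.of_forall fun ξ => ?_)
    simp only
    ring
  rw [h2]
  refine h.comp (by fun_prop) fun ν hν => ?_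
  simp only [Set.mem_ofPred_eq, Complex.sub_re, Complex.neg_re, Complex.natCast_re] at hν ⊢
  linarith

/-- The inverse of the normalizing constant is a quotient of entire functions, with denominator
`1 / Γ` vanishing only at the poles. -/
lemma exists_normConst_inv_eq (m : ℕ) (δ : ZMod 2) : ∃ p q : ℂ → ℂ, Differentiable ℂ p ∧
    Differentiable ℂ q ∧ (∀ ν, (normConst m ν δ)⁻¹ = p ν * (q ν)⁻¹) ∧
    ∀ ν, ν ∉ poles m δ → q ν ≠ 0 := by
  have hpi : (Real.pi : ℂ) ≠ 0 := by exact_mod_cast Real.pi_pos.ne'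
  have hG : ∀ g : ℂ → ℂ, Differentiable ℂ g → Differentiable ℂ fun ν => (Complex.Gamma (g ν))⁻¹ :=
    fun g hg => Complex.differentiable_one_div_Gamma.comp hg
  have hP : Differentiable ℂ fun ν : ℂ => (2 * (Real.pi : ℂ) ^
      (ν + ((m + 1 : ℕ) : ℂ) - 1 / 2))⁻¹ := by
    intro ν
    refine DifferentiableAt.inv (DifferentiableAt.const_mul ?_ _) ?_
    · exact DifferentiableAt.const_cpow (by fun_prop) (Or.inl hpi)
    · exact mul_ne_zero two_ne_zero (by rw [Complex.cpow_ne_zero_iff]; exact Or.inl hpi)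
  rcases zmod_two_cases δ with rfl | rfl
  · refine ⟨fun ν => (2 * (Real.pi : ℂ) ^ (ν + ((m + 1 : ℕ) : ℂ) - 1 / 2))⁻¹ *
      (Complex.Gamma ((1 - ν - ((m + 1 : ℕ) : ℂ)) / 2))⁻¹,
      fun ν => (Complex.Gamma ((ν + ((m + 1 : ℕ) : ℂ)) / 2))⁻¹, hP.mul (hG _ (by fun_prop)),
      hG _ (by fun_prop), fun ν => ?_, fun ν hν => ?_⟩
    · rw [normConst, if_pos rfl, mul_inv, inv_div, inv_inv]
      ring
    · refine inv_ne_zero (Complex.Gamma_ne_zero fun k hk => hν ⟨k, ?_⟩)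
      rw [ZMod.val_zero]
      push_cast at hk ⊢
      linear_combination 2 * hk
  · refine ⟨fun ν => (2 * (Real.pi : ℂ) ^ (ν + ((m + 1 : ℕ) : ℂ) - 1 / 2))⁻¹ *
      (-Complex.I * (Complex.Gamma ((2 - ν - ((m + 1 : ℕ) : ℂ)) / 2))⁻¹),
      fun ν => (Complex.Gamma ((ν + ((m + 1 : ℕ) : ℂ) + 1) / 2))⁻¹,
      hP.mul ((hG _ (by fun_prop)).const_mul _), hG _ (by fun_prop), fun ν => ?_, fun ν hν => ?_⟩
    · rw [normConst, if_neg (by decide), mul_inv, mul_inv Complex.I, inv_div, inv_inv,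
          Complex.inv_I]
      ring
    · refine inv_ne_zero (Complex.Gamma_ne_zero fun k hk => hν ⟨k, ?_⟩)
      rw [ZMod.val_one]
      push_cast at hk ⊢
      linear_combination 2 * hk

/-- For `f` homogeneous of degree `μ - n`, the homogeneous function of degree `ν - n` with the same
restriction to the sphere as `f`. -/
def twist {m : ℕ} (μ ν : ℂ) (f : Ambient m → ℂ) (X : Ambient m) : ℂ := (‖X‖ : ℂ) ^ (ν - μ) * f X

lemma twist_sphere {m : ℕ} (μ ν : ℂ) (f : Ambient m → ℂ) (ξ : Metric.sphere (0 : Ambient m) 1) :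
    twist μ ν f ξ = f ξ := by
  have hξ : ‖(ξ : Ambient m)‖ = 1 := by simp
  simp [twist, hξ]

lemma twist_mem {m : ℕ} {μ : ℂ} {δ : ZMod 2} {f : Ambient m → ℂ} (hf : f ∈ VSmooth m (-μ) δ)
    (ν : ℂ) :
    twist μ ν f ∈ VSmooth m (-ν) δ := by
  refine ⟨(contDiffOn_ofReal_cpow (contDiffOn_id.norm ℝ fun X hX => hX)
    (fun X hX => norm_pos_iff.2 (Set.mem_compl_singleton_iff.1 hX)) _).mul hf.1,
        fun r hr X hX => ?_⟩
  have hr0 : 0 < |r| := abs_pos.2 hr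
  have hr' : ((|r| : ℝ) : ℂ) ≠ 0 := by exact_mod_cast hr0.ne'
  rw [twist, twist, hf.2 r hr X hX, norm_smul, Real.norm_eq_abs, Complex.ofReal_mul,
    Complex.mul_cpow_ofReal_nonneg (abs_nonneg _) (norm_nonneg _),
    show -((m + 1 : ℕ) : ℂ) - -ν = (ν - μ) + (-((m + 1 : ℕ) : ℂ) - -μ) by ring,
    Complex.cpow_add _ _ hr']
  ring

lemma knappSteinIntegral_congr {m : ℕ} {ν : ℂ} {δ : ZMod 2} {f₁ f₂ : Ambient m → ℂ}
    (h : ∀ ξ : Metric.sphere (0 : Ambient m) 1, f₁ ξ = f₂ ξ) (Y : Ambient m) :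
    knappSteinIntegral m ν δ f₁ Y = knappSteinIntegral m ν δ f₂ Y := by
  simp only [knappSteinIntegral, h]

lemma differentiableOn_rayMellin_generatorFourier {m : ℕ} {f : Ambient m → ℂ}
    (hf : ContDiffOn ℝ ∞ f {0}ᶜ) {Y : Ambient m} (hY : Y ≠ 0) :
    DifferentiableOn ℂ (fun ν => rayMellin (((m + 1 : ℕ) : ℂ) - 1 + ν) (generatorFourier hf) Y)
      {ν | -((m + 1 : ℕ) : ℝ) < ν.re} := by
  refine (differentiableOn_rayMellin (generatorFourier hf) hY).comp
    (f := fun ν : ℂ => ((m + 1 : ℕ) : ℂ) - 1 + ν) (by fun_prop) fun ν hν => ?_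
  simp only [Set.mem_ofPred_eq, Complex.add_re, Complex.sub_re, Complex.natCast_re,
    Complex.one_re] at hν ⊢
  linarith

/-- The Mellin averages of the transforms of two extensions of the same function on the sphere
are proportional, first in the strip of convergence and then by analytic continuation. -/
lemma rayMellin_generatorFourier_mul_eq {m : ℕ} {μ₁ μ₂ : ℂ} {δ : ZMod 2} {f₁ f₂ : Ambient m → ℂ}
    (h₁ : f₁ ∈ VSmooth m (-μ₁) δ) (h₂ : f₂ ∈ VSmooth m (-μ₂) δ)
    (h : ∀ ξ : Metric.sphere (0 : Ambient m) 1, f₁ ξ = f₂ ξ) {ν : ℂ}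
    (hν : -((m + 1 : ℕ) : ℝ) < ν.re) {Y : Ambient m} (hY : Y ≠ 0) :
    rayMellin (((m + 1 : ℕ) : ℂ) - 1 + ν) (generatorFourier h₁.1) Y * cutoffMellin (μ₂ - ν) =
      rayMellin (((m + 1 : ℕ) : ℂ) - 1 + ν) (generatorFourier h₂.1) Y * cutoffMellin (μ₁ - ν) := by
  have hc : ∀ μ : ℂ, DifferentiableOn ℂ (fun ν => cutoffMellin (μ - ν))
      {ν | -((m + 1 : ℕ) : ℝ) < ν.re} := fun μ =>
    (differentiable_cutoffMellin.comp (by fun_prop : Differentiable ℂ fun ν : ℂ =>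
        μ - ν)).differentiableOn
  have hA := ((differentiableOn_rayMellin_generatorFourier h₁.1 hY).mul (hc μ₂)).analyticOnNhd
    (isOpen_lt_re _)
  have hB := ((differentiableOn_rayMellin_generatorFourier h₂.1 hY).mul (hc μ₁)).analyticOnNhd
    (isOpen_lt_re _)
  have hz : -((m + 1 : ℕ) : ℝ) < ((1 / 2 - ((m + 1 : ℕ) : ℝ) : ℝ) : ℂ).re := by
    rw [Complex.ofReal_re]; linarith
  have hz1 : ((1 / 2 - ((m + 1 : ℕ) : ℝ) : ℝ) : ℂ).re < 1 - ((m + 1 : ℕ) : ℝ) := by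
    rw [Complex.ofReal_re]; linarith
  refine hA.eqOn_of_preconnected_of_eventuallyEq hB (convex_halfSpace_re_gt _).isPreconnected hz ?_ hν
  filter_upwards [(isOpen_lt_re _).mem_nhds hz, (isOpen_re_lt _).mem_nhds hz1] with ν h0 h1
  simp only [Pi.mul_apply]
  rw [rayMellin_generatorFourier h₁ h0 h1 hY, rayMellin_generatorFourier h₂ h0 h1 hY,
    knappSteinIntegral_congr h]
  ring

open Classical in
/-- The continuation: the normalized integral for `Re ν < 1 - n`, and otherwise the Mellin average
attached to the function of degree `ν - n` with the same restriction to the sphere as `f`. -/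
def continued {m : ℕ} {μ : ℂ} {δ : ZMod 2} {f : Ambient m → ℂ} (hf : f ∈ VSmooth m (-μ) δ)
    (Y : Ambient m) (ν : ℂ) : ℂ :=
  if ν.re < 1 - ((m + 1 : ℕ) : ℝ) then (normConst m ν δ)⁻¹ * knappSteinIntegral m ν δ f Y
  else rayMellin (((m + 1 : ℕ) : ℂ) - 1 + ν) (generatorFourier (twist_mem hf ν).1) Y

/-- The continuation is, for `Re ν > -n` and up to the factor `cutoffMellin (ν₀ - ν)`, the Mellin
average attached to any fixed homogeneous extension `f₀` of the restriction of `f` to the sphere.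
The Mellin average is holomorphic in `ν`, and the factor is `1` at `ν = ν₀`. -/
lemma continued_mul {m : ℕ} {μ : ℂ} {δ : ZMod 2} {f : Ambient m → ℂ} (hf : f ∈ VSmooth m (-μ) δ)
    {Y : Ambient m} (hY : Y ≠ 0) {ν₀ : ℂ} {f₀ : Ambient m → ℂ} (hf₀ : f₀ ∈ VSmooth m (-ν₀) δ)
    (h : ∀ ξ : Metric.sphere (0 : Ambient m) 1, f₀ ξ = f ξ)
    {ν : ℂ} (hν : -((m + 1 : ℕ) : ℝ) < ν.re) :
    continued hf Y ν * cutoffMellin (ν₀ - ν) =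
      rayMellin (((m + 1 : ℕ) : ℂ) - 1 + ν) (generatorFourier hf₀.1) Y := by
  rw [continued]
  split_ifs with h1
  · rw [rayMellin_generatorFourier hf₀ hν h1 hY, knappSteinIntegral_congr h]
    ring
  · rw [rayMellin_generatorFourier_mul_eq (twist_mem hf ν) hf₀
      (fun ξ => by rw [twist_sphere, h]) hν hY, sub_self, cutoffMellin_zero, mul_one]

lemma re_le_of_mem_poles {m : ℕ} {δ : ZMod 2} {ν : ℂ} (h : ν ∈ poles m δ) :
    ν.re ≤ -((m + 1 : ℕ) : ℝ) := by
  obtain ⟨k, rfl⟩ := h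
  simp only [Complex.sub_re, Complex.neg_re, Complex.natCast_re, Complex.mul_re, Complex.re_ofNat,
    Complex.im_ofNat, Complex.natCast_im]
  have h1 : (0 : ℝ) ≤ (δ.val : ℝ) := Nat.cast_nonneg _
  have h2 : (0 : ℝ) ≤ (k : ℝ) := Nat.cast_nonneg _
  linarith

lemma isContinuation_continued {m : ℕ} {μ : ℂ} {δ : ZMod 2} {f : Ambient m → ℂ}
    (hf : f ∈ VSmooth m (-μ) δ) {Y : Ambient m} (hY : Y ≠ 0) :
    IsContinuation m δ f Y (continued hf Y) := by
  obtain ⟨p, q, hp, hq, hpq, hq0⟩ := exists_normConst_inv_eq m δ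
  have hleft : ∀ ν₀ : ℂ, ν₀.re < 1 - ((m + 1 : ℕ) : ℝ) →
      (fun ν => p ν * (q ν)⁻¹ * knappSteinIntegral m ν δ f Y) =ᶠ[𝓝 ν₀] continued hf Y := by
    intro ν₀ h₀
    filter_upwards [(isOpen_re_lt _).mem_nhds h₀] with ν hν
    rw [continued, if_pos hν, hpq]
  have hK : ∀ ν₀ : ℂ, ν₀.re < 1 - ((m + 1 : ℕ) : ℝ) →
      AnalyticAt ℂ (fun ν => knappSteinIntegral m ν δ f Y) ν₀ := fun ν₀ h₀ =>
    (differentiableOn_knappSteinIntegral δ hf.1 hY).analyticOnNhd (isOpen_re_lt _) ν₀ h₀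
  have han : AnalyticOnNhd ℂ (continued hf Y) (poles m δ)ᶜ := by
    intro ν₀ hν₀
    rcases lt_or_ge ν₀.re (1 - ((m + 1 : ℕ) : ℝ)) with h₀ | h₀
    · exact (((hp.analyticAt ν₀).mul ((hq.analyticAt ν₀).inv (hq0 _ hν₀))).mul (hK ν₀ h₀)).congr
        (hleft ν₀ h₀)
    · have h1 : -((m + 1 : ℕ) : ℝ) < ν₀.re := by linarith
      have hc : AnalyticAt ℂ (fun ν => cutoffMellin (ν₀ - ν)) ν₀ :=
        (differentiable_cutoffMellin.comp
          (by fun_prop : Differentiable ℂ fun ν : ℂ => ν₀ - ν)).analyticAt _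
      have hc0 : cutoffMellin (ν₀ - ν₀) ≠ 0 := by simp [cutoffMellin_zero]
      refine (((differentiableOn_rayMellin_generatorFourier (twist_mem hf ν₀).1 hY).analyticOnNhd
        (isOpen_lt_re _) ν₀ h1).div hc hc0).congr ?_
      filter_upwards [(isOpen_lt_re _).mem_nhds h1, hc.continuousAt.eventually_ne hc0] with ν hν hν'
      rw [Pi.div_apply, div_eq_iff hν', continued_mul hf hY (twist_mem hf ν₀)
        (fun ξ => twist_sphere _ _ _ ξ) hν]
  refine ⟨fun ν₀ _ => ?_, han, fun ν hν _ => by rw [continued, if_pos hν]⟩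
  by_cases hν₀ : ν₀ ∈ poles m δ
  · have h₀ : ν₀.re < 1 - ((m + 1 : ℕ) : ℝ) := by linarith [re_le_of_mem_poles hν₀]
    exact (((hp.analyticAt ν₀).meromorphicAt.mul (hq.analyticAt ν₀).meromorphicAt.inv).mul
      (hK ν₀ h₀).meromorphicAt).congr ((hleft ν₀ h₀).filter_mono nhdsWithin_le_nhds)
  · exact (han ν₀ hν₀).meromorphicAt

/-- The continuation is unique outside the poles, whose complement is connected. -/
lemma IsContinuation.eqOn {m : ℕ} {δ : ZMod 2} {f : Ambient m → ℂ} {Y : Ambient m} {G₁ G₂ : ℂ → ℂ}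
    (h₁ : IsContinuation m δ f Y G₁) (h₂ : IsContinuation m δ f Y G₂) :
    Set.EqOn G₁ G₂ (poles m δ)ᶜ := by
  have hcount : (poles m δ).Countable := by
    refine (Set.countable_range fun k : ℕ => -((m + 1 : ℕ) : ℂ) - (δ.val : ℂ) - 2 * (k : ℂ)).mono ?_
    rintro ν ⟨k, rfl⟩
    exact ⟨k, rfl⟩
  have hz : -((m + 1 : ℕ) : ℝ) < ((1 / 2 - ((m + 1 : ℕ) : ℝ) : ℝ) : ℂ).re := by
    rw [Complex.ofReal_re]; linarith
  have hz1 : ((1 / 2 - ((m + 1 : ℕ) : ℝ) : ℝ) : ℂ).re < 1 - ((m + 1 : ℕ) : ℝ) := by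
    rw [Complex.ofReal_re]; linarith
  have hnp : ∀ ν : ℂ, -((m + 1 : ℕ) : ℝ) < ν.re → ν ∉ poles m δ := fun ν hν hp =>
    absurd (re_le_of_mem_poles hp) (not_le.2 hν)
  refine h₁.2.1.eqOn_of_preconnected_of_eventuallyEq h₂.2.1
    (hcount.isPathConnected_compl_of_one_lt_rank (by simp)).isConnected.isPreconnected (hnp _ hz) ?_
  filter_upwards [(isOpen_lt_re _).mem_nhds hz, (isOpen_re_lt _).mem_nhds hz1] with ν h0 h1
  rw [h₁.2.2 ν h1 (hnp ν h0), h₂.2.2 ν h1 (hnp ν h0)]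

lemma isContinuation_continuation {m : ℕ} {μ : ℂ} {δ : ZMod 2} {f : Ambient m → ℂ}
    (hf : f ∈ VSmooth m (-μ) δ) {Y : Ambient m} (hY : Y ≠ 0) :
    IsContinuation m δ f Y (continuation m δ f Y) :=
  Classical.epsilon_spec ⟨_, isContinuation_continued hf hY⟩

lemma knappStein_eq_integral {m : ℕ} {μ : ℂ} {δ : ZMod 2} (hμ : μ ∉ poles m δ) {f : Ambient m → ℂ}
    (hf : f ∈ VSmooth m (-μ) δ) (hμ' : μ.re < 1 - ((m + 1 : ℕ) : ℝ)) {Y : Ambient m} (hY : Y ≠ 0) :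
    knappStein m μ δ f Y = (normConst m μ δ)⁻¹ * knappSteinIntegral m μ δ f Y :=
  (isContinuation_continuation hf hY).2.2 μ hμ' hμ

lemma knappStein_eq_rayMellin {m : ℕ} {μ : ℂ} {δ : ZMod 2} {f : Ambient m → ℂ}
    (hf : f ∈ VSmooth m (-μ) δ) (hμ : -((m + 1 : ℕ) : ℝ) < μ.re) {Y : Ambient m} (hY : Y ≠ 0) :
    knappStein m μ δ f Y = rayMellin (((m + 1 : ℕ) : ℂ) - 1 + μ) (generatorFourier hf.1) Y := by
  have h := (isContinuation_continuation hf hY).eqOn (isContinuation_continued hf hY)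
    (fun hp => absurd (re_le_of_mem_poles hp) (not_le.2 hμ) : μ ∈ (poles m δ)ᶜ)
  rw [knappStein, h, ← continued_mul hf hY hf (fun _ => rfl) hμ, sub_self,
      cutoffMellin_zero, mul_one]

lemma knappSteinIntegral_smul {m : ℕ} (ν : ℂ) (δ : ZMod 2) (f : Ambient m → ℂ) (r : ℝ)
    (Y : Ambient m) : knappSteinIntegral m ν δ f (r • Y) =
      signedPow (-ν - ((m + 1 : ℕ) : ℂ)) δ r * knappSteinIntegral m ν δ f Y := by
  rw [knappSteinIntegral_eq, knappSteinIntegral_eq, ← integral_const_mul]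
  refine integral_congr_ae (Eventually.of_forall fun ξ => ?_)
  simp only
  rw [omega_smul_right, signedPow_mul]
  ring

lemma isHomog_knappStein {m : ℕ} {μ : ℂ} {δ : ZMod 2} (hμ : μ ∉ poles m δ) {f : Ambient m → ℂ}
    (hf : f ∈ VSmooth m (-μ) δ) : IsHomog m μ δ (knappStein m μ δ f) := by
  intro r hr Y hY
  have hr' : ((|r| : ℝ) : ℂ) ≠ 0 := by exact_mod_cast (abs_pos.2 hr).ne'
  have hrY : r • Y ≠ 0 := smul_ne_zero hr hY
  have h1 := isContinuation_continuation hf hY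
  have han : Differentiable ℂ fun ν : ℂ => signedPow (-ν - ((m + 1 : ℕ) : ℂ)) δ r := by
    intro ν
    unfold signedPow
    exact (DifferentiableAt.const_cpow (by fun_prop) (Or.inl hr')).mul_const _
  have h2 : IsContinuation m δ f (r • Y)
      (fun ν => signedPow (-ν - ((m + 1 : ℕ) : ℂ)) δ r * continuation m δ f Y ν) := by
    refine ⟨fun ν _ => (han.analyticAt ν).meromorphicAt.mul (h1.1 ν (Set.mem_univ _)),
      fun ν hν => (han.analyticAt ν).mul (h1.2.1 ν hν), fun ν hν hν' => ?_⟩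
    simp only
    rw [h1.2.2 ν hν hν', knappSteinIntegral_smul]
    ring
  have h3 := (isContinuation_continuation hf hrY).eqOn h2 hμ
  rw [knappStein, h3, signedPow, knappStein]
  ring_nf

/-- The image of a smooth vector is smooth. For `Re μ > -n` it is a Mellin average of a Schwartz
function, and otherwise it is the absolutely convergent integral. -/
lemma contDiffOn_knappStein {m : ℕ} {μ : ℂ} {δ : ZMod 2} (hμ : μ ∉ poles m δ) {f : Ambient m → ℂ}
    (hf : f ∈ VSmooth m (-μ) δ) : ContDiffOn ℝ ∞ (knappStein m μ δ f) {0}ᶜ := by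
  rcases lt_or_ge (-((m + 1 : ℕ) : ℝ)) μ.re with h | h
  · refine (contDiffOn_rayMellin (generatorFourier hf.1) (a := ((m + 1 : ℕ) : ℂ) - 1 + μ) ?_).congr
      fun Y hY => knappStein_eq_rayMellin hf h hY
    simp only [Complex.add_re, Complex.sub_re, Complex.natCast_re, Complex.one_re]
    linarith
  · have h' : μ.re < 1 - ((m + 1 : ℕ) : ℝ) := by linarith
    have h1 := contDiffOn_integral_signedPow_inner (s := -μ - ((m + 1 : ℕ) : ℂ)) (by
      simp only [Complex.sub_re, Complex.neg_re, Complex.natCast_re]; linarith) δ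
      (contDiff_truncate hf.1) (hasCompactSupport_truncate f)
    have h2 := h1.comp (symplecticJ m).contDiff.contDiffOn (t := {0}ᶜ) (s := {0}ᶜ) (fun Y hY => by
      simpa using hY)
    refine ((contDiffOn_const (c := (normConst m μ δ)⁻¹)).mul h2).congr fun Y hY => ?_
    · rw [knappStein_eq_integral hμ hf h' hY]
      have h3 := integral_truncate_mul_signedPow hf h' hY
      rw [sub_self, cutoffMellin_zero, one_mul] at h3
      simp only [Function.comp_apply, ← omega_eq_inner]
      rw [h3]

/-- The normalized operator preserves smooth vectors. -/
lemma knappStein_mem {m : ℕ} {μ : ℂ} {δ : ZMod 2} (hμ : μ ∉ poles m δ) {f : Ambient m → ℂ}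
    (hf : f ∈ VSmooth m (-μ) δ) : knappStein m μ δ f ∈ VSmooth m μ δ :=
  ⟨contDiffOn_knappStein hμ hf, isHomog_knappStein hμ hf⟩

lemma memLp_sphere {m : ℕ} {f : Ambient m → ℂ} (hf : ContDiffOn ℝ ∞ f {0}ᶜ) :
    MemLp (fun ξ : Metric.sphere (0 : Ambient m) 1 => f ξ) 2 (sphereMeasure m) := by
  obtain ⟨C, hC⟩ := exists_norm_sphere_le hf
  exact MemLp.of_bound (continuous_sphere hf).aestronglyMeasurable C (Eventually.of_forall hC)

lemma knappSteinGraph_knappStein {m : ℕ} {μ : ℂ} {δ : ZMod 2} (hμ : μ ∉ poles m δ)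
    {f : Ambient m → ℂ} (hf : f ∈ VSmooth m (-μ) δ) :
    KnappSteinGraph m μ δ f (knappStein m μ δ f) := by
  refine ⟨⟨hf.2, memLp_sphere hf.1⟩,
    ⟨(knappStein_mem hμ hf).2, memLp_sphere (knappStein_mem hμ hf).1⟩, fun _ => f, fun _ =>
        hf, ?_, ?_⟩
  · simp
  · simp

/-! ### The partial Fourier transform of a Schwartz function on a product -/

section PartialFourier

variable {E F : Type} [NormedAddCommGroup E] [NormedSpace ℝ E]
  [NormedAddCommGroup F]

theorem norm_iteratedFDeriv_slice_le [NormedSpace ℝ F] (Φ : 𝓢(E × F, ℂ)) (u : E) (w : F) (n : ℕ) :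
    ‖iteratedFDeriv ℝ n (fun w => Φ (u, w)) w‖ ≤ ‖iteratedFDeriv ℝ n Φ (u, w)‖ := by
  have h1 : (fun w => Φ (u, w)) =
      (fun p => Φ (p + (u, 0))) ∘ (ContinuousLinearMap.inr ℝ E F) := by
    ext w; simp
  have h2 : ContDiff ℝ ∞ (fun p => Φ (p + (u, 0))) :=
    (Φ.smooth ⊤).comp (contDiff_id.add contDiff_const)
  rw [h1, ContinuousLinearMap.iteratedFDeriv_comp_right _ h2 w (by exact_mod_cast le_top),
    iteratedFDeriv_comp_add_right]
  refine (ContinuousMultilinearMap.norm_compContinuousLinearMap_le _ _).trans ?_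
  have h3 : ‖ContinuousLinearMap.inr ℝ E F‖ ≤ 1 :=
    ContinuousLinearMap.opNorm_le_bound _ zero_le_one (fun x => by simp [Prod.norm_def])
  have h4 : (ContinuousLinearMap.inr ℝ E F) w + (u, (0:F)) = (u, w) := by simp
  rw [h4]
  refine mul_le_of_le_one_right (norm_nonneg _) ?_
  exact Finset.prod_le_one (fun _ _ => norm_nonneg _) fun _ _ => h3

/-- The slice `w ↦ Φ (u, w)` of a Schwartz function `Φ` on a product. -/
def slice [NormedSpace ℝ F] (Φ : 𝓢(E × F, ℂ)) (u : E) : 𝓢(F, ℂ) where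
  toFun w := Φ (u, w)
  smooth' := (Φ.smooth ⊤).comp (contDiff_const.prodMk contDiff_id)
  decay' k n := by
    obtain ⟨C, hC⟩ := Φ.decay' k n
    refine ⟨C, fun w => le_trans ?_ (hC (u, w))⟩
    refine mul_le_mul ?_ (norm_iteratedFDeriv_slice_le Φ u w n) (norm_nonneg _) (by positivity)
    exact pow_le_pow_left₀ (norm_nonneg _) (norm_snd_le (u, w)) _

@[simp] theorem slice_apply [NormedSpace ℝ F] (Φ : 𝓢(E × F, ℂ)) (u : E) (w : F) :
    slice Φ u w = Φ (u, w) := rfl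

theorem exists_seminorm_slice_le [NormedSpace ℝ F] (Φ : 𝓢(E × F, ℂ)) (j k n : ℕ) :
    ∃ C, 0 ≤ C ∧ ∀ u, ‖u‖ ^ j * SchwartzMap.seminorm ℝ k n (slice Φ u) ≤ C := by
  obtain ⟨C, hC⟩ := Φ.decay' (j + k) n
  have hC0 : 0 ≤ C := le_trans (by positivity) (hC 0)
  refine ⟨C, hC0, fun u => ?_⟩
  rcases (norm_nonneg u).eq_or_lt' with hu | hu
  · rcases Nat.eq_zero_or_pos j with rfl | hj
    · rw [pow_zero, one_mul]
      refine SchwartzMap.seminorm_le_bound ℝ k n _ hC0 fun w => le_trans ?_ (hC (u, w))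
      refine mul_le_mul ?_ (norm_iteratedFDeriv_slice_le Φ u w n) (norm_nonneg _) (by positivity)
      simpa using pow_le_pow_left₀ (norm_nonneg _) (norm_snd_le (u, w)) _
    · rw [hu, zero_pow hj.ne', zero_mul]; exact hC0
  · rw [← le_div_iff₀' (by positivity)]
    refine SchwartzMap.seminorm_le_bound ℝ k n _ (by positivity) fun w => ?_
    rw [le_div_iff₀' (by positivity), ← mul_assoc]
    refine le_trans ?_ (hC (u, w))
    refine mul_le_mul ?_ (norm_iteratedFDeriv_slice_le Φ u w n) (norm_nonneg _) (by positivity)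
    rw [pow_add]
    gcongr
    · exact norm_fst_le (u, w)
    · exact norm_snd_le (u, w)

variable [InnerProductSpace ℝ F] [FiniteDimensional ℝ F] [MeasurableSpace F] [BorelSpace F]

/-- The Fourier transform of a Schwartz function on `E × F` in the second variable. -/
def partialFourier (Φ : 𝓢(E × F, ℂ)) (p : E × F) : ℂ := 𝓕 (slice Φ p.1) p.2

theorem partialFourier_eq_integral (Φ : 𝓢(E × F, ℂ)) (p : E × F) :
    partialFourier Φ p = ∫ w, Real.fourierChar (-inner ℝ w p.2) • Φ (p.1, w) := by
  rw [partialFourier, SchwartzMap.fourier_coe, Real.fourier_eq]; rfl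

/-- The partial Fourier transform decays rapidly in both variables: the Schwartz seminorms of the
slices decay rapidly, and the Fourier transform is continuous for the Schwartz seminorms. -/
theorem exists_partialFourier_bound_aux (Φ : 𝓢(E × F, ℂ)) (j k : ℕ) :
    ∃ C, 0 ≤ C ∧ ∀ p : E × F, ‖p.1‖ ^ j * (‖p.2‖ ^ k * ‖partialFourier Φ p‖) ≤ C := by
  -- the seminorm `‖w‖ ^ k ‖𝓕 ψ w‖` is bounded by finitely many Schwartz seminorms of `ψ`
  have hcont : Continuous ((SchwartzMap.seminorm ℝ k 0).comp
      (FourierTransform.fourierCLM ℝ 𝓢(F, ℂ)).toLinearMap) :=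
    ((schwartz_withSeminorms ℝ F ℂ).continuous_seminorm (k, 0)).comp
      (FourierTransform.fourierCLM ℝ 𝓢(F, ℂ)).continuous
  obtain ⟨s, B, -, hB⟩ := Seminorm.bound_of_continuous (schwartz_withSeminorms ℝ F ℂ) _ hcont
  choose C hC0 hC using fun i : ℕ × ℕ => exists_seminorm_slice_le Φ j i.1 i.2
  refine ⟨B * ∑ i ∈ s, C i, mul_nonneg B.2 (Finset.sum_nonneg fun i _ => hC0 i), fun p => ?_⟩
  have h1 : ‖p.2‖ ^ k * ‖partialFourier Φ p‖ ≤
      B * ∑ i ∈ s, SchwartzMap.seminorm ℝ i.1 i.2 (slice Φ p.1) := by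
    refine (SchwartzMap.norm_pow_mul_le_seminorm ℝ (𝓕 (slice Φ p.1)) k p.2).trans ?_
    refine (hB (slice Φ p.1)).trans ?_
    rw [smul_apply, NNReal.smul_def, smul_eq_mul]
    refine mul_le_mul_of_nonneg_left ?_ B.2
    refine Seminorm.finset_sup_apply_le (Finset.sum_nonneg fun i _ =>
        apply_nonneg _ _) fun i hi => ?_
    exact Finset.single_le_sum
      (f := fun i : ℕ × ℕ => SchwartzMap.seminorm ℝ i.1 i.2 (slice Φ p.1))
      (fun i _ => apply_nonneg _ _) hi
  calc ‖p.1‖ ^ j * (‖p.2‖ ^ k * ‖partialFourier Φ p‖)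
      ≤ ‖p.1‖ ^ j * (B * ∑ i ∈ s, SchwartzMap.seminorm ℝ i.1 i.2 (slice Φ p.1)) := by gcongr
    _ = B * ∑ i ∈ s, ‖p.1‖ ^ j * SchwartzMap.seminorm ℝ i.1 i.2 (slice Φ p.1) := by
      rw [Finset.mul_sum, Finset.mul_sum, Finset.mul_sum]
      exact Finset.sum_congr rfl fun _ _ => by ring
    _ ≤ B * ∑ i ∈ s, C i := by
      gcongr with i
      exact hC i p.1

theorem exists_partialFourier_bound (Φ : 𝓢(E × F, ℂ)) (j k : ℕ) :
    ∃ C, 0 ≤ C ∧ ∀ p : E × F, (1 + ‖p.1‖) ^ j * ((1 + ‖p.2‖) ^ k * ‖partialFourier Φ p‖) ≤ C := by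
  obtain ⟨C1, h1, H1⟩ := exists_partialFourier_bound_aux Φ 0 0
  obtain ⟨C2, h2, H2⟩ := exists_partialFourier_bound_aux Φ j 0
  obtain ⟨C3, h3, H3⟩ := exists_partialFourier_bound_aux Φ 0 k
  obtain ⟨C4, h4, H4⟩ := exists_partialFourier_bound_aux Φ j k
  have key : ∀ (x : ℝ) (n : ℕ), 0 ≤ x → (1 + x) ^ n ≤ 2 ^ n * (1 + x ^ n) := by
    intro x n hx
    calc (1 + x) ^ n ≤ (2 * max 1 x) ^ n := by
          gcongr; rcases le_total 1 x with h | h <;> simp [h] <;> linarith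
      _ = 2 ^ n * max 1 x ^ n := mul_pow _ _ _
      _ ≤ _ := by
        gcongr
        rcases le_total 1 x with h | h
        · simp [h]
        · simp [h]; positivity
  refine ⟨2 ^ j * 2 ^ k * (C1 + C2 + C3 + C4), by positivity, fun p => ?_⟩
  have e1 := H1 p
  have e2 := H2 p
  have e3 := H3 p
  have e4 := H4 p
  simp only [pow_zero, one_mul] at e1 e2 e3
  calc (1 + ‖p.1‖) ^ j * ((1 + ‖p.2‖) ^ k * ‖partialFourier Φ p‖)
      ≤ (2 ^ j * (1 + ‖p.1‖ ^ j)) * ((2 ^ k * (1 + ‖p.2‖ ^ k)) * ‖partialFourier Φ p‖) := by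
        gcongr
        · exact key _ _ (norm_nonneg _)
        · exact key _ _ (norm_nonneg _)
    _ = 2 ^ j * 2 ^ k * (‖partialFourier Φ p‖ + ‖p.1‖ ^ j * ‖partialFourier Φ p‖ +
          ‖p.2‖ ^ k * ‖partialFourier Φ p‖ +
          ‖p.1‖ ^ j * (‖p.2‖ ^ k * ‖partialFourier Φ p‖)) := by ring
    _ ≤ _ := by gcongr

theorem continuous_partialFourier (Φ : 𝓢(E × F, ℂ)) : Continuous (partialFourier Φ) := by
  have h0 : partialFourier Φ =
      fun p => ∫ w, Real.fourierChar (-inner ℝ w p.2) • Φ (p.1, w) :=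
    funext (partialFourier_eq_integral Φ)
  rw [h0]
  set k := (volume : Measure F).integrablePower with hk
  obtain ⟨C1, h1⟩ := Φ.decay' 0 0
  obtain ⟨C2, h2⟩ := Φ.decay' k 0
  have hint : Integrable (fun w : F => 2 ^ k * (C1 + C2) * (1 + ‖w‖) ^ (-(k : ℝ))) :=
    (Measure.integrable_pow_neg_integrablePower (volume : Measure F)).const_mul _
  refine continuous_of_dominated (fun p => ?_) (fun p => ?_) hint ?_
  · refine Continuous.aestronglyMeasurable ?_
    have hc : Continuous fun w => Φ (p.1, w) := Φ.continuous.comp (by fun_prop)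
    have hi : Continuous fun w : F => -inner ℝ w p.2 := by fun_prop
    exact Continuous.smul (continuous_subtype_val.comp (Real.continuous_fourierChar.comp hi)) hc
  · filter_upwards with w
    rw [Circle.norm_smul]
    have a1 := h1 (p.1, w)
    have a2 := h2 (p.1, w)
    rw [norm_iteratedFDeriv_zero] at a1 a2
    rw [pow_zero, one_mul] at a1
    change ‖Φ (p.1, w)‖ ≤ C1 at a1
    change _ * ‖Φ (p.1, w)‖ ≤ C2 at a2
    have a3 : ‖w‖ ^ k * ‖Φ (p.1, w)‖ ≤ C2 := le_trans (by
      gcongr; exact norm_snd_le (p.1, w)) a2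
    exact pow_mul_le_of_le_of_pow_mul_le (k := 0) (l := k) (norm_nonneg _) (norm_nonneg _)
      a1 (by simpa using a3) |> fun h => by simpa using h
  · filter_upwards with w
    have hc : Continuous fun p : E × F => Φ (p.1, w) := Φ.continuous.comp (by fun_prop)
    have hi : Continuous fun p : E × F => -inner ℝ w p.2 := by fun_prop
    exact Continuous.smul (continuous_subtype_val.comp (Real.continuous_fourierChar.comp hi)) hc

end PartialFourier

/-! ### Coordinates on the ambient space and the `N`-picture -/

/-- `ℝⁿ` with `n = m + 1`, split as `ℝ × ℝᵐ`. -/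
abbrev Half (m : ℕ) : Type := WithLp 2 (ℝ × EuclideanSpace ℝ (Fin m))

variable {m : ℕ}

/-- The point of `ℝ²ⁿ` with halves `u` and `v`. -/
def pair (u v : Half m) : Ambient m :=
  WithLp.toLp 2 (Sum.elim (Fin.cons u.fst fun i => u.snd i) (Fin.cons v.fst fun i => v.snd i))

theorem norm_pair_sq (u v : Half m) : ‖pair u v‖ ^ 2 = ‖u‖ ^ 2 + ‖v‖ ^ 2 := by
  rw [WithLp.prod_norm_sq_eq_of_L2, WithLp.prod_norm_sq_eq_of_L2, EuclideanSpace.norm_sq_eq,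
    EuclideanSpace.norm_sq_eq, EuclideanSpace.norm_sq_eq]
  simp [pair, Fin.sum_univ_succ]

/-- The isometry `ℝⁿ × ℝⁿ ≃ ℝ²ⁿ`. -/
def pairIsometry (m : ℕ) : WithLp 2 (Half m × Half m) ≃ₗᵢ[ℝ] Ambient m :=
  LinearIsometry.toLinearIsometryEquiv
    { toFun := fun p => pair p.fst p.snd
      map_add' := fun p q => by
        ext i
        rcases i with i | i <;> refine Fin.cases ?_ (fun j => ?_) i <;> simp [pair]
      map_smul' := fun c p => by
        ext i
        rcases i with i | i <;> refine Fin.cases ?_ (fun j => ?_) i <;> simp [pair]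
      norm_map' := fun p => by
        have h : ‖pair p.fst p.snd‖ ^ 2 = ‖p‖ ^ 2 := by
          rw [norm_pair_sq, WithLp.prod_norm_sq_eq_of_L2 p]
        exact (sq_eq_sq₀ (norm_nonneg _) (norm_nonneg _)).1 h }
    (by
      rw [finrank_ambient, (WithLp.linearEquiv 2 ℝ (Half m × Half m)).finrank_eq,
        Module.finrank_prod, (WithLp.linearEquiv 2 ℝ (ℝ × EuclideanSpace ℝ (Fin m))).finrank_eq,
        Module.finrank_prod]
      simp; ring)

/-- The linear equivalence `ℝⁿ × ℝⁿ ≃ ℝ²ⁿ`. -/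
def pairEquiv (m : ℕ) : (Half m × Half m) ≃L[ℝ] Ambient m :=
  (WithLp.prodContinuousLinearEquiv 2 ℝ (Half m) (Half m)).symm.trans
    (pairIsometry m).toContinuousLinearEquiv

@[simp] theorem pairEquiv_apply (p : Half m × Half m) : pairEquiv m p = pair p.1 p.2 := rfl

theorem measurePreserving_pairEquiv : MeasurePreserving (pairEquiv m) :=
  (pairIsometry m).measurePreserving.comp (WithLp.volume_preserving_toLp (Half m) (Half m))

theorem pair_smul (c : ℝ) (u v : Half m) : pair (c • u) (c • v) = c • pair u v :=
  (pairEquiv m).map_smul c (u, v)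

theorem inner_pair (u v u' v' : Half m) :
    inner ℝ (pair u v) (pair u' v') = inner ℝ u u' + inner ℝ v v' :=
  (pairIsometry m).inner_map_map (WithLp.toLp 2 (u, v)) (WithLp.toLp 2 (u', v'))

theorem symplecticJ_pair (u v : Half m) : symplecticJ m (pair u v) = pair (-v) u := by
  ext i
  rcases i with i | i <;> refine Fin.cases ?_ (fun j => ?_) i <;> simp [pair, symplecticJ]

/-- The equivalence `ℝᵐ × ℝⁿ ≃ ℝ × ℝᵐ × ℝᵐ`, `(x, (t, ξ)) ↦ (t, x, ξ)`. -/
def heisEquiv (m : ℕ) : (EuclideanSpace ℝ (Fin m) × Half m) ≃L[ℝ] Heis m :=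
  LinearEquiv.toContinuousLinearEquiv
    { toFun := fun p => (p.2.fst, p.1, p.2.snd)
      invFun := fun p => (p.2.1, WithLp.toLp 2 (p.1, p.2.2))
      map_add' := fun _ _ => rfl
      map_smul' := fun _ _ => rfl
      left_inv := fun _ => rfl
      right_inv := fun _ => rfl }

@[simp] theorem heisEquiv_apply (p : EuclideanSpace ℝ (Fin m) × Half m) :
    heisEquiv m p = (p.2.fst, p.1, p.2.snd) := rfl

@[simp] theorem heisEquiv_symm_apply (p : Heis m) :
    (heisEquiv m).symm p = (p.2.1, WithLp.toLp 2 (p.1, p.2.2)) := rfl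

theorem measurePreserving_heisEquiv : MeasurePreserving (heisEquiv m) := by
  have h1 : MeasurePreserving (fun p : EuclideanSpace ℝ (Fin m) × Half m => (p.1, p.2.ofLp)) :=
    (MeasurePreserving.id _).prod (WithLp.volume_preserving_ofLp ℝ (EuclideanSpace ℝ (Fin m)))
  have h2 : MeasurePreserving (fun p : EuclideanSpace ℝ (Fin m) × ℝ × EuclideanSpace ℝ (Fin m) =>
      ((p.1, p.2.1), p.2.2)) := volume_preserving_prodAssoc.symm
  have h3 : MeasurePreserving (fun p : (EuclideanSpace ℝ (Fin m) × ℝ) × EuclideanSpace ℝ (Fin m) =>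
      ((p.1.2, p.1.1), p.2)) := Measure.measurePreserving_swap.prod (MeasurePreserving.id _)
  exact (volume_preserving_prodAssoc.comp h3).comp (h2.comp h1)

theorem embed_eq_pair (p : Heis m) :
    embed p = pair (WithLp.toLp 2 (1, p.2.1)) (WithLp.toLp 2 (2 * p.1, p.2.2)) := rfl

theorem continuous_embed : Continuous (embed : Heis m → Ambient m) := by
  have h : (embed : Heis m → Ambient m) = fun p => pairEquiv m
      (WithLp.toLp 2 (1, p.2.1), WithLp.toLp 2 (2 * p.1, p.2.2)) := rfl
  rw [h]
  exact (pairEquiv m).continuous.comp (by fun_prop)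

theorem one_le_norm_embed (p : Heis m) : 1 ≤ ‖embed p‖ := by
  have h : 1 ≤ ‖embed p‖ ^ 2 := by
    rw [embed_eq_pair, norm_pair_sq, WithLp.prod_norm_sq_eq_of_L2]
    simp only [WithLp.toLp_fst, WithLp.toLp_snd, norm_one, one_pow, add_assoc]
    exact le_add_of_nonneg_right (by positivity)
  nlinarith [norm_nonneg (embed p)]

theorem embed_ne_zero (p : Heis m) : embed p ≠ 0 := by
  intro h
  have := one_le_norm_embed p
  rw [h, norm_zero] at this
  linarith

/-- The chart `(s, (t, x, ξ)) ↦ (s, x, 2t, ξ)` of `ℝ²ⁿ`. -/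
def coneEquiv (m : ℕ) : (ℝ × Heis m) ≃L[ℝ] Ambient m :=
  LinearEquiv.toContinuousLinearEquiv <|
    LinearEquiv.trans
      { toFun := fun p => (WithLp.toLp 2 (p.1, p.2.2.1), WithLp.toLp 2 (2 * p.2.1, p.2.2.2))
        invFun := fun q => (q.1.fst, q.2.fst / 2, q.1.snd, q.2.snd)
        map_add' := fun p q => Prod.ext rfl
          (congrArg (WithLp.toLp 2) (Prod.ext (mul_add 2 p.2.1 q.2.1) rfl))
        map_smul' := fun c p => Prod.ext rfl
          (congrArg (WithLp.toLp 2) (Prod.ext (mul_left_comm 2 c p.2.1) rfl))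
        left_inv := fun p => by ext <;> simp
        right_inv := fun p => by
          refine Prod.ext ?_ ?_
          · rfl
          · show WithLp.toLp 2 (2 * (p.2.fst / 2), p.2.snd) = p.2
            rw [mul_div_cancel₀ _ (two_ne_zero)]; rfl }
      (pairEquiv m).toLinearEquiv

theorem coneEquiv_smul (s : ℝ) (p : Heis m) : coneEquiv m (s, s • p) = s • embed p := by
  have : (s, s • p) = s • ((1 : ℝ), p) := by ext <;> simp
  rw [this, map_smul]; rfl

theorem finrank_heis : Module.finrank ℝ (Heis m) = 2 * m + 1 := by
  simp [Heis]; ring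

instance : (volume : Measure (Heis m)).IsAddHaarMeasure :=
  have : (volume : Measure (EuclideanSpace ℝ (Fin m) × EuclideanSpace ℝ
      (Fin m))).IsAddHaarMeasure :=
    Measure.prod.instIsAddHaarMeasure _ _
  Measure.prod.instIsAddHaarMeasure _ _

/-- The chart `coneEquiv` transports Lebesgue measure to a multiple of Lebesgue measure. -/
theorem exists_volume_eq_smul_map_coneEquiv (m : ℕ) : ∃ c : NNReal, c ≠ 0 ∧
    (volume : Measure (Ambient m)) = c • (volume : Measure (ℝ × Heis m)).map (coneEquiv m) := by
  have : (volume : Measure (ℝ × Heis m)).IsAddHaarMeasure :=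
    Measure.prod.instIsAddHaarMeasure _ _
  have := (coneEquiv m).isAddHaarMeasure_map (volume : Measure (ℝ × Heis m))
  have h := Measure.isAddLeftInvariant_eq_smul (volume : Measure (Ambient m))
    ((volume : Measure (ℝ × Heis m)).map (coneEquiv m))
  exact ⟨_, (Measure.addHaarScalarFactor_pos_of_isAddHaarMeasure _ _).ne', h⟩

theorem lintegral_heis_eq_mul_lintegral_smul {F : Heis m → ENNReal} (hF : Measurable F) {s : ℝ}
    (hs : 0 < s) : ∫⁻ p, F p = ENNReal.ofReal (s ^ (2 * m + 1)) * ∫⁻ p, F (s • p) := by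
  have h := Measure.map_addHaar_smul (volume : Measure (Heis m)) hs.ne'
  have h2 : ∫⁻ p, F (s • p) = ENNReal.ofReal |(s ^ (2 * m + 1))⁻¹| * ∫⁻ p, F p := by
    rw [← lintegral_map hF (measurable_const_smul s), h, lintegral_smul_measure, finrank_heis]
    rfl
  rw [h2, ← mul_assoc, ← ENNReal.ofReal_mul (by positivity), abs_of_pos (by positivity),
    mul_inv_cancel₀ (by positivity), ENNReal.ofReal_one, one_mul]

/-- Integration over the `N`-picture is dominated by integration over the sphere, for functions
which are homogeneous of degree `-2n`. Both sides are compared with the integral over the shell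
`1 < ‖X‖ ≤ 2`. -/
theorem exists_lintegral_embed_le (m : ℕ) : ∃ C : ENNReal, C ≠ ⊤ ∧
    ∀ G : Ambient m → ENNReal, Measurable G →
      (∀ r : ℝ, 0 < r → ∀ X : Ambient m, X ≠ 0 →
        G (r • X) = ENNReal.ofReal (r ^ (2 * (m + 1)))⁻¹ * G X) →
      ∫⁻ p : Heis m, G (embed p) ≤
        C * ∫⁻ ξ : Metric.sphere (0 : Ambient m) 1, G ξ ∂(sphereMeasure m) := by
  obtain ⟨c, hc, hvol⟩ := exists_volume_eq_smul_map_coneEquiv m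
  refine ⟨2 / c, ENNReal.div_ne_top (by simp) (by simpa using hc), fun G hG hhom => ?_⟩
  set T : Set (Ambient m) := {X | ‖X‖ ∈ Set.Ioc (1:ℝ) 2} with hT
  have hTm : MeasurableSet T := measurable_norm measurableSet_Ioc
  have hTG : Measurable (T.indicator G) := hG.indicator hTm
  -- on the shell, in polar coordinates, `G (r ξ) r ^ (2n - 1) = r⁻¹ G ξ ≤ G ξ`
  have upper : ∫⁻ X, T.indicator G X ≤
      ∫⁻ ξ : Metric.sphere (0 : Ambient m) 1, G ξ ∂(sphereMeasure m) := by
    rw [lintegral_polar hTG, finrank_ambient]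
    refine lintegral_mono fun ξ => ?_
    have hmeas : Measurable fun r : ℝ => T.indicator G (r • (ξ : Ambient m)) :=
      hTG.comp (measurable_id.smul_const _)
    rw [lintegral_rayMeasure _ hmeas, ← lintegral_indicator measurableSet_Ioi]
    have hξ : ‖(ξ : Ambient m)‖ = 1 := norm_eq_of_mem_sphere ξ
    calc _ ≤ ∫⁻ r, (Set.Ioc (1 : ℝ) 2).indicator (fun _ => G ξ) r := by
          refine lintegral_mono fun r => ?_
          by_cases hr0 : r ∈ Set.Ioi (0 : ℝ)
          swap
          · rw [Set.indicator_of_notMem hr0]; exact zero_le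
          rw [Set.indicator_of_mem hr0]
          have hrn : ‖r • (ξ : Ambient m)‖ = r := by
            rw [norm_smul, hξ, mul_one, Real.norm_of_nonneg (le_of_lt hr0)]
          by_cases hr : r ∈ Set.Ioc (1 : ℝ) 2
          · rw [Set.indicator_of_mem hr, Set.indicator_of_mem
                (by rw [hT, Set.mem_ofPred_eq, hrn]; exact hr),
              hhom r hr0 _ (sphere_ne_zero ξ), ← mul_assoc,
              ← ENNReal.ofReal_mul (pow_nonneg (le_of_lt hr0) _)]
            refine mul_le_of_le_one_left zero_le ?_
            rw [← ENNReal.ofReal_one]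
            refine ENNReal.ofReal_le_ofReal ?_
            have hr0' : 0 < r := hr0
            rw [← div_eq_mul_inv, div_le_one (by positivity)]
            exact pow_le_pow_right₀ hr.1.le (Nat.sub_le _ _)
          · rw [Set.indicator_of_notMem hr, Set.indicator_of_notMem
              (by rw [hT, Set.mem_ofPred_eq, hrn]; exact hr), mul_zero]
      _ = G ξ := by
        rw [lintegral_indicator measurableSet_Ioc, setLIntegral_const, Real.volume_Ioc]
        norm_num
  -- the ray through `embed p` meets the shell for `s` in an interval of length `1 / e`, on which
  -- the integrand `s⁻¹ G (embed p)` is at least `e / 2` times `G (embed p)`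
  have inner : ∀ p : Heis m, 2⁻¹ * G (embed p) ≤
      ∫⁻ s in Set.Ioi (0 : ℝ), ENNReal.ofReal (s ^ (2 * m + 1)) * T.indicator G (s • embed p) := by
    intro p
    set e := ‖embed p‖ with he
    have he0 : 0 < e := zero_lt_one.trans_le (one_le_norm_embed p)
    have hsub : Set.Ioc (1 / e) (2 / e) ⊆ Set.Ioi 0 := fun s hs =>
      lt_trans (by positivity) hs.1
    calc 2⁻¹ * G (embed p) = ∫⁻ s in Set.Ioc (1 / e) (2 / e), ENNReal.ofReal (e / 2) *
          G (embed p) := by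
          rw [setLIntegral_const, Real.volume_Ioc, mul_right_comm, ← ENNReal.ofReal_mul
              (by positivity)]
          congr 1
          rw [show e / 2 * (2 / e - 1 / e) = 2⁻¹ by field_simp; norm_num]
          rw [ENNReal.ofReal_inv_of_pos two_pos]; simp
      _ ≤ ∫⁻ s in Set.Ioc (1 / e) (2 / e),
          ENNReal.ofReal (s ^ (2 * m + 1)) * T.indicator G (s • embed p) := by
        refine setLIntegral_mono' measurableSet_Ioc fun s hs => ?_
        have hs0 : 0 < s := hsub hs
        have hsT : s • embed p ∈ T := by
          rw [hT, Set.mem_ofPred_eq, norm_smul, Real.norm_of_nonneg hs0.le, ← he]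
          exact ⟨(div_lt_iff₀ he0).1 hs.1, (le_div_iff₀ he0).1 hs.2⟩
        rw [Set.indicator_of_mem hsT, hhom s hs0 _ (embed_ne_zero p), ← mul_assoc,
          ← ENNReal.ofReal_mul (by positivity)]
        gcongr
        rw [show s ^ (2 * m + 1) * (s ^ (2 * (m + 1)))⁻¹ = s⁻¹ by field_simp; ring,
          div_le_iff₀ two_pos, ← div_eq_inv_mul, le_div_iff₀ hs0]
        exact (mul_comm e s).trans_le ((le_div_iff₀ he0).1 hs.2)
      _ ≤ _ := lintegral_mono_set hsub
  -- in the chart `(s, p) ↦ coneEquiv (s, s p) = s embed p` of the half space, with Jacobian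
  -- proportional to `s ^ (2m + 1)`
  have lower : (c : ENNReal) * (2⁻¹ * ∫⁻ p : Heis m, G (embed p)) ≤ ∫⁻ X, T.indicator G X := by
    have hcone : Measurable (coneEquiv m) := (coneEquiv m).continuous.measurable
    have hGe : Measurable fun p : Heis m => G (embed p) := hG.comp continuous_embed.measurable
    rw [hvol, lintegral_smul_measure, lintegral_map hTG hcone, ← lintegral_const_mul _ hGe]
    have h1 : ∫⁻ q : ℝ × Heis m, T.indicator G (coneEquiv m q) =
        ∫⁻ s, ∫⁻ p, T.indicator G (coneEquiv m (s, p)) :=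
      lintegral_prod _ (hTG.comp hcone).aemeasurable
    rw [h1]
    have hjoint : Measurable fun q : ℝ × Heis m =>
        ENNReal.ofReal (q.1 ^ (2 * m + 1)) * T.indicator G (q.1 • embed q.2) :=
      (measurable_fst.pow_const _).ennreal_ofReal.mul
        (hTG.comp (measurable_fst.smul (continuous_embed.measurable.comp measurable_snd)))
    have h2 : ∫⁻ p, 2⁻¹ * G (embed p) ≤ ∫⁻ s, ∫⁻ p, T.indicator G (coneEquiv m (s, p)) := by
      calc _ ≤ ∫⁻ p : Heis m, ∫⁻ s in Set.Ioi (0 : ℝ),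
            ENNReal.ofReal (s ^ (2 * m + 1)) * T.indicator G (s • embed p) := lintegral_mono inner
        _ = ∫⁻ s in Set.Ioi (0 : ℝ), ∫⁻ p : Heis m,
            ENNReal.ofReal (s ^ (2 * m + 1)) * T.indicator G (s • embed p) :=
          lintegral_lintegral_swap (hjoint.comp measurable_swap).aemeasurable
        _ = ∫⁻ s in Set.Ioi (0 : ℝ), ∫⁻ p, T.indicator G (coneEquiv m (s, p)) := by
          refine setLIntegral_congr_fun measurableSet_Ioi fun s hs => ?_
          have hm1 : Measurable fun p => T.indicator G (coneEquiv m (s, p)) :=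
            hTG.comp (hcone.comp measurable_prodMk_left)
          rw [lintegral_heis_eq_mul_lintegral_smul hm1 hs, lintegral_const_mul]
          · simp_rw [coneEquiv_smul]
          · exact hTG.comp (continuous_embed.measurable.const_smul s)
        _ ≤ _ := setLIntegral_le_lintegral _ _
    exact mul_le_mul_right h2 _
  have hfin := lower.trans upper
  have hc' : (c : ENNReal) ≠ 0 := by simpa using hc
  calc ∫⁻ p : Heis m, G (embed p)
      = 2 / c * (c * (2⁻¹ * ∫⁻ p : Heis m, G (embed p))) := by
        rw [← mul_assoc, ENNReal.div_mul_cancel hc' ENNReal.coe_ne_top, ← mul_assoc,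
          ENNReal.mul_inv_cancel (by simp) (by simp), one_mul]
    _ ≤ _ := by gcongr

/-! ### Square integrability in the `N`-picture -/

variable {m : ℕ}

/-- The radial projection of the point `(1, x, 2t, ξ)` to the unit sphere. -/
def toSphere (p : Heis m) : Metric.sphere (0 : Ambient m) 1 :=
  ⟨‖embed p‖⁻¹ • embed p, by
    rw [mem_sphere_zero_iff_norm, norm_smul, norm_inv, norm_norm,
      inv_mul_cancel₀ (norm_ne_zero_iff.2 (embed_ne_zero p))]⟩

theorem norm_embed_pos (p : Heis m) : 0 < ‖embed p‖ := norm_pos_iff.2 (embed_ne_zero p)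

theorem norm_smul_toSphere (p : Heis m) : ‖embed p‖ • (toSphere p : Ambient m) = embed p := by
  rw [toSphere, smul_smul, mul_inv_cancel₀ (norm_embed_pos p).ne', one_smul]

theorem measurable_toSphere : Measurable (toSphere : Heis m → _) :=
  ((continuous_embed.norm.measurable.inv).smul continuous_embed.measurable).subtype_mk

/-- The radial projection to the sphere transports Lebesgue measure, with density
`‖embed p‖ ^ (-2n)`, to a measure dominated by the surface measure. -/
theorem exists_lintegral_toSphere_le (m : ℕ) : ∃ C : ENNReal, C ≠ ⊤ ∧
    ∀ F : Metric.sphere (0 : Ambient m) 1 → ENNReal, Measurable F →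
      ∫⁻ p : Heis m, ENNReal.ofReal (‖embed p‖ ^ (2 * (m + 1)))⁻¹ * F (toSphere p) ≤
        C * ∫⁻ ξ, F ξ ∂(sphereMeasure m) := by
  obtain ⟨C, hC, H⟩ := exists_lintegral_embed_le m
  refine ⟨C, hC, fun F hF => ?_⟩
  obtain ⟨F', hF', hFF'⟩ := (MeasurableEmbedding.subtype_coe
    (Metric.isClosed_sphere (x := (0 : Ambient m)) (ε := 1)).measurableSet).exists_measurable_extend
      hF (fun _ => ⟨0⟩)
  have hval : ∀ ξ : Metric.sphere (0 : Ambient m) 1, F' ξ = F ξ := fun ξ => congrFun hFF' ξ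
  have h := H (fun X => ENNReal.ofReal (‖X‖ ^ (2 * (m + 1)))⁻¹ * F' (‖X‖⁻¹ • X))
    (((measurable_norm.pow_const _).inv.ennreal_ofReal).mul
      (hF'.comp (measurable_norm.inv.smul measurable_id))) (fun r hr X hX => by
        rw [norm_smul, Real.norm_of_nonneg hr.le, smul_smul, mul_pow, mul_inv (r ^ _),
          ENNReal.ofReal_mul (by positivity), mul_assoc, mul_inv r, mul_assoc, mul_comm ‖X‖⁻¹,
          ← mul_assoc r⁻¹, inv_mul_cancel₀ hr.ne', one_mul])
  refine le_trans (le_of_eq ?_) (h.trans (le_of_eq ?_))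
  · refine lintegral_congr fun p => ?_
    rw [← hval (toSphere p)]; rfl
  · congr 1
    refine lintegral_congr fun ξ => ?_
    have hξ : ‖(ξ : Ambient m)‖ = 1 := norm_eq_of_mem_sphere ξ
    simp only [hξ, one_pow, inv_one, ENNReal.ofReal_one, one_mul, one_smul, hval]

theorem quasiMeasurePreserving_toSphere :
    Measure.QuasiMeasurePreserving (toSphere : Heis m → _) volume (sphereMeasure m) := by
  refine ⟨measurable_toSphere, Measure.AbsolutelyContinuous.mk fun s hs h0 => ?_⟩
  rw [Measure.map_apply measurable_toSphere hs]
  obtain ⟨C, hC, H⟩ := exists_lintegral_toSphere_le m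
  have h1 := H (s.indicator 1) (measurable_one.indicator hs)
  rw [lintegral_indicator_one hs, h0, mul_zero, nonpos_iff_eq_zero, lintegral_eq_zero_iff] at h1
  · have h2 : ∀ᵐ p : Heis m, p ∉ toSphere ⁻¹' s := by
      filter_upwards [h1] with p hp hps
      rw [Set.mem_preimage] at hps
      simp only [Set.indicator_of_mem hps, Pi.one_apply, mul_one, Pi.zero_apply,
        ENNReal.ofReal_eq_zero] at hp
      have := norm_embed_pos p
      exact absurd hp (not_le.2 (by positivity))
    simp only [ae_iff, not_not] at h2
    exact h2
  · exact ((continuous_embed.norm.measurable.pow_const _).inv.ennreal_ofReal).mul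
      ((measurable_one.indicator hs).comp measurable_toSphere)

variable {ν : ℂ} {δ : ZMod 2} {h : Ambient m → ℂ}

theorem IsHomog.toN_eq (hh : IsHomog m ν δ h) (p : Heis m) :
    toN h p = ((‖embed p‖ : ℝ) : ℂ) ^ (-((m + 1 : ℕ) : ℂ) - ν) * h (toSphere p) := by
  rw [toN]
  conv_lhs => rw [← norm_smul_toSphere p]
  rw [hh.smul_pos (norm_embed_pos p) (sphere_ne_zero _)]

theorem IsHomog.aestronglyMeasurable_toN (hh : IsHomog m ν δ h)
    (hm : AEStronglyMeasurable (fun ξ : Metric.sphere (0 : Ambient m) 1 => h ξ)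
      (sphereMeasure m)) : AEStronglyMeasurable (toN h) := by
  have h1 : toN h = fun p => ((‖embed p‖ : ℝ) : ℂ) ^ (-((m + 1 : ℕ) : ℂ) - ν) * h (toSphere p) :=
    funext hh.toN_eq
  rw [h1]
  refine AEStronglyMeasurable.mul ?_ (hm.comp_quasiMeasurePreserving quasiMeasurePreserving_toSphere)
  exact ((Complex.measurable_ofReal.comp continuous_embed.norm.measurable).pow_const
    _).aestronglyMeasurable

/-- A homogeneous function which is square integrable on the sphere is square integrable in the
`N`-picture with respect to a power weight. -/
theorem exists_lintegral_toN_le (m : ℕ) : ∃ C : ENNReal, C ≠ ⊤ ∧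
    ∀ (ν : ℂ) (δ : ZMod 2) (h : Ambient m → ℂ), IsHomog m ν δ h →
      AEStronglyMeasurable (fun ξ : Metric.sphere (0 : Ambient m) 1 => h ξ) (sphereMeasure m) →
      ∫⁻ p, (ENNReal.ofReal (‖embed p‖ ^ ν.re) * ‖toN h p‖ₑ) ^ (2 : ℝ) ≤
        C * eLpNorm (fun ξ : Metric.sphere (0 : Ambient m) 1 => h ξ) 2 (sphereMeasure m) ^
            (2 : ℝ) := by
  obtain ⟨C, hC, H⟩ := exists_lintegral_toSphere_le m
  refine ⟨C, hC, fun ν δ h hh hm => ?_⟩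
  have e1 : ∀ p : Heis m, (ENNReal.ofReal (‖embed p‖ ^ ν.re) * ‖toN h p‖ₑ) ^ (2 : ℝ) =
      ENNReal.ofReal (‖embed p‖ ^ (2 * (m + 1)))⁻¹ * ‖h (toSphere p)‖ₑ ^ (2 : ℝ) := by
    intro p
    have hp := norm_embed_pos p
    have e2 : ‖((‖embed p‖ : ℝ) : ℂ) ^ (-((m + 1 : ℕ) : ℂ) - ν)‖ₑ =
        ENNReal.ofReal (‖embed p‖ ^ (-((m + 1 : ℕ) : ℝ) - ν.re)) := by
      rw [← ofReal_norm, Complex.norm_cpow_eq_rpow_re_of_pos hp, Complex.sub_re, Complex.neg_re,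
        Complex.natCast_re]
    rw [hh.toN_eq, enorm_mul, e2, ← mul_assoc, ← ENNReal.ofReal_mul (by positivity),
      ← Real.rpow_add hp, ENNReal.mul_rpow_of_nonneg _ _ zero_le_two,
      ENNReal.ofReal_rpow_of_nonneg (by positivity) zero_le_two, ← Real.rpow_mul hp.le]
    congr 2
    rw [show (ν.re + (-((m + 1 : ℕ) : ℝ) - ν.re)) * 2 = -((2 * (m + 1) : ℕ) : ℝ) by push_cast; ring,
      Real.rpow_neg hp.le, Real.rpow_natCast]
  simp_rw [e1]
  have e3 : eLpNorm (fun ξ : Metric.sphere (0 : Ambient m) 1 => h ξ) 2 (sphereMeasure m) ^ (2 : ℝ) =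
      ∫⁻ ξ : Metric.sphere (0 : Ambient m) 1, ‖h ξ‖ₑ ^ (2 : ℝ) ∂(sphereMeasure m) := by
    rw [eLpNorm_eq_lintegral_rpow_enorm_toReal (by simp) (by simp), ← ENNReal.rpow_mul]
    simp
  rw [e3]
  have hkm : StronglyMeasurable (hm.mk _) := hm.stronglyMeasurable_mk
  have hka := hm.ae_eq_mk
  have hka2 := quasiMeasurePreserving_toSphere.ae_eq_comp hka
  calc _ = ∫⁻ p : Heis m, ENNReal.ofReal (‖embed p‖ ^ (2 * (m + 1)))⁻¹ *
        ‖hm.mk _ (toSphere p)‖ₑ ^ (2 : ℝ) := by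
        refine lintegral_congr_ae ?_
        filter_upwards [hka2] with p hp
        simp only [Function.comp_apply] at hp
        rw [hp]
    _ ≤ C * ∫⁻ ξ, ‖hm.mk _ ξ‖ₑ ^ (2 : ℝ) ∂(sphereMeasure m) :=
        H (fun ξ => ‖hm.mk _ ξ‖ₑ ^ (2 : ℝ)) (hkm.measurable.enorm.pow_const _)
    _ = _ := by
        congr 1
        refine lintegral_congr_ae ?_
        filter_upwards [hka] with ξ hξ
        rw [hξ]

/-- Pairings in the `N`-picture with rapidly decaying functions are continuous for the norm of
`L²(S)`. -/
theorem exists_lintegral_toN_mul_le {ψ : Heis m → ℂ} (hψ : AEStronglyMeasurable ψ) (ν : ℂ)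
    (hdec : ∫⁻ p, (ENNReal.ofReal (‖embed p‖ ^ (-ν.re)) * ‖ψ p‖ₑ) ^ (2 : ℝ) ≠ ⊤) :
    ∃ K : ENNReal, K ≠ ⊤ ∧ ∀ (δ : ZMod 2) (h : Ambient m → ℂ), IsHomog m ν δ h →
      AEStronglyMeasurable (fun ξ : Metric.sphere (0 : Ambient m) 1 => h ξ) (sphereMeasure m) →
      ∫⁻ p, ‖toN h p * ψ p‖ₑ ≤
        K * eLpNorm (fun ξ : Metric.sphere (0 : Ambient m) 1 => h ξ) 2 (sphereMeasure m) := by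
  obtain ⟨C, hC, H⟩ := exists_lintegral_toN_le m
  refine ⟨C ^ (1 / 2 : ℝ) *
    (∫⁻ p, (ENNReal.ofReal (‖embed p‖ ^ (-ν.re)) * ‖ψ p‖ₑ) ^ (2 : ℝ)) ^ (1 / 2 : ℝ),
    ENNReal.mul_ne_top (ENNReal.rpow_ne_top_of_nonneg (by norm_num) hC)
      (ENNReal.rpow_ne_top_of_nonneg (by norm_num) hdec), fun δ h hh hm => ?_⟩
  have hw : ∀ a : ℝ, Measurable fun p : Heis m => ENNReal.ofReal (‖embed p‖ ^ a) := fun a =>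
    (continuous_embed.norm.measurable.pow_const _).ennreal_ofReal
  have hN := hh.aestronglyMeasurable_toN hm
  calc ∫⁻ p, ‖toN h p * ψ p‖ₑ
      = ∫⁻ p, ((fun p => ENNReal.ofReal (‖embed p‖ ^ ν.re) * ‖toN h p‖ₑ) *
          fun p => ENNReal.ofReal (‖embed p‖ ^ (-ν.re)) * ‖ψ p‖ₑ) p := by
        refine lintegral_congr fun p => ?_
        have hp := norm_embed_pos p
        rw [Pi.mul_apply, mul_mul_mul_comm, ← ENNReal.ofReal_mul (by positivity),
          ← Real.rpow_add hp, add_neg_cancel, Real.rpow_zero, ENNReal.ofReal_one, one_mul,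
              enorm_mul]
    _ ≤ _ := ENNReal.lintegral_mul_le_Lp_mul_Lq volume Real.HolderConjugate.two_two
        ((hw _).aemeasurable.mul hN.enorm) ((hw _).aemeasurable.mul hψ.enorm)
    _ ≤ (C * eLpNorm (fun ξ : Metric.sphere (0 : Ambient m) 1 => h ξ) 2 (sphereMeasure m) ^ (2 : ℝ))
          ^ (1 / 2 : ℝ) *
        (∫⁻ p, (ENNReal.ofReal (‖embed p‖ ^ (-ν.re)) * ‖ψ p‖ₑ) ^ (2 : ℝ)) ^ (1 / 2 : ℝ) := by
        gcongr
        exact H ν δ h hh hm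
    _ = _ := by
        rw [ENNReal.mul_rpow_of_nonneg _ _ (by norm_num), ← ENNReal.rpow_mul]
        norm_num
        ring

theorem memLp_toN (hν : ν.re = 0) {f : Ambient m → ℂ} (hf : f ∈ V m ν δ) : MemLp (toN f) 2 := by
  obtain ⟨C, hC, H⟩ := exists_lintegral_toN_le m
  refine ⟨hf.1.aestronglyMeasurable_toN hf.2.1, ?_⟩
  have h1 := H ν δ f hf.1 hf.2.1
  simp only [hν, Real.rpow_zero, ENNReal.ofReal_one, one_mul] at h1
  rw [eLpNorm_lt_top_iff_lintegral_rpow_enorm_lt_top (by simp) (by simp)]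
  rw [ENNReal.toReal_ofNat]
  refine lt_of_le_of_lt h1 (ENNReal.mul_lt_top hC.lt_top ?_)
  exact ENNReal.rpow_lt_top_of_nonneg zero_le_two hf.2.2.ne

/-! ### The partial Fourier transform in the `N`-picture -/

variable {m : ℕ}

/-- A Schwartz function of `(t, x, ξ)` as a function of `(x, (t, ξ))`. -/
def splitHeis (φ : 𝓢(Heis m, ℂ)) : 𝓢(EuclideanSpace ℝ (Fin m) × Half m, ℂ) :=
  SchwartzMap.compCLMOfContinuousLinearEquiv ℂ (heisEquiv m) φ

@[simp] theorem splitHeis_apply (φ : 𝓢(Heis m, ℂ)) (p : EuclideanSpace ℝ (Fin m) × Half m) :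
    splitHeis φ p = φ (heisEquiv m p) := rfl

/-- The transform `F_ξ F_t` of a function on `ℝ × ℝᵐ × ℝᵐ`. -/
abbrev fourierHeis (φ : Heis m → ℂ) : Heis m → ℂ := fourierXi (fourierT φ)

theorem fourierHeis_heisEquiv (φ : 𝓢(Heis m, ℂ)) (p : EuclideanSpace ℝ (Fin m) × Half m) :
    fourierHeis φ (heisEquiv m p) = partialFourier (splitHeis φ) p := by
  obtain ⟨x, w⟩ := p
  have hmp := WithLp.volume_preserving_toLp ℝ (EuclideanSpace ℝ (Fin m))
  have hemb : MeasurableEmbedding (WithLp.toLp 2 : ℝ × EuclideanSpace ℝ (Fin m) → Half m) :=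
    (MeasurableEquiv.toLp 2 (ℝ × EuclideanSpace ℝ (Fin m))).measurableEmbedding
  rw [partialFourier_eq_integral, ← hmp.integral_comp hemb]
  have hint : Integrable (fun w' : Half m =>
      Real.fourierChar (-inner ℝ w' w) • splitHeis φ (x, w')) :=
    (Real.fourierIntegral_convergent_iff w).2 (slice (splitHeis φ) x).integrable
  have hint2 := (hmp.integrable_comp_emb hemb).2 hint
  have h1 : ∫ q : ℝ × EuclideanSpace ℝ (Fin m), Real.fourierChar
        (-inner ℝ (WithLp.toLp 2 q : Half m) w) • splitHeis φ (x, WithLp.toLp 2 q) =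
      ∫ ξ : EuclideanSpace ℝ (Fin m), ∫ t : ℝ, Real.fourierChar
        (-inner ℝ (WithLp.toLp 2 (t, ξ) : Half m) w) • splitHeis φ (x, WithLp.toLp 2 (t, ξ)) :=
    integral_prod_symm _ hint2
  rw [h1, fourierHeis, fourierXi, Real.fourier_eq]
  refine integral_congr_ae (Eventually.of_forall fun ξ => ?_)
  simp only [fourierT, heisEquiv_apply]
  rw [Real.fourier_eq, Circle.smul_def, ← integral_smul]
  refine integral_congr_ae (Eventually.of_forall fun t => ?_)
  simp only [WithLp.prod_inner_apply, splitHeis_apply, heisEquiv_apply, neg_add,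
      AddChar.map_add_eq_mul,
    Circle.smul_def, Circle.coe_mul, smul_eq_mul]
  rw [← mul_assoc]
  exact congrArg₂ _ (mul_comm _ _) rfl

theorem fourierHeis_eq (φ : 𝓢(Heis m, ℂ)) (p : Heis m) :
    fourierHeis φ p = partialFourier (splitHeis φ) ((heisEquiv m).symm p) := by
  rw [← fourierHeis_heisEquiv, ContinuousLinearEquiv.apply_symm_apply]

theorem continuous_fourierHeis (φ : 𝓢(Heis m, ℂ)) : Continuous (fourierHeis (φ : Heis m → ℂ)) := by
  rw [funext (fourierHeis_eq φ)]
  exact (continuous_partialFourier _).comp (heisEquiv m).symm.continuous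

theorem norm_embed_le (p : Heis m) : ‖embed p‖ ≤
    2 * ((1 + ‖((heisEquiv m).symm p).1‖) * (1 + ‖((heisEquiv m).symm p).2‖)) := by
  set x := ((heisEquiv m).symm p).1
  set w := ((heisEquiv m).symm p).2
  have h0 : ‖embed p‖ ^ 2 = 1 + ‖x‖ ^ 2 + ((2 * ‖w.fst‖) ^ 2 + ‖w.snd‖ ^ 2) := by
    rw [embed_eq_pair, norm_pair_sq, WithLp.prod_norm_sq_eq_of_L2, WithLp.prod_norm_sq_eq_of_L2]
    simp [x, w]
  have h1 : ‖w‖ ^ 2 = ‖w.fst‖ ^ 2 + ‖w.snd‖ ^ 2 := WithLp.prod_norm_sq_eq_of_L2 w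
  refine le_of_sq_le_sq ?_ (by positivity)
  nlinarith [norm_nonneg x, norm_nonneg w, mul_nonneg (norm_nonneg x) (norm_nonneg w),
    sq_nonneg (‖x‖ * ‖w‖), mul_nonneg (norm_nonneg x) (sq_nonneg ‖w‖),
    mul_nonneg (norm_nonneg w) (sq_nonneg ‖x‖), sq_nonneg ‖w.snd‖]

/-- An integrable function on `ℝ × ℝᵐ × ℝᵐ` dominating all rapidly decaying functions. -/
def rapidWeight (p : Heis m) : ℝ :=
  (1 + ‖((heisEquiv m).symm p).1‖) ^
      (-((volume : Measure (EuclideanSpace ℝ (Fin m))).integrablePower : ℝ)) *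
    (1 + ‖((heisEquiv m).symm p).2‖) ^
      (-((volume : Measure (Half m)).integrablePower : ℝ))

theorem rapidWeight_nonneg (p : Heis m) : 0 ≤ rapidWeight p := by
  unfold rapidWeight; positivity

theorem rapidWeight_le_one (p : Heis m) : rapidWeight p ≤ 1 := by
  refine mul_le_one₀ ?_ (by positivity) ?_ <;>
  exact Real.rpow_le_one_of_one_le_of_nonpos (by simp) (by simp)

theorem integrable_rapidWeight : Integrable (rapidWeight : Heis m → ℝ) := by
  have h1 : Integrable (fun q : EuclideanSpace ℝ (Fin m) × Half m =>
      (1 + ‖q.1‖) ^ (-((volume : Measure (EuclideanSpace ℝ (Fin m))).integrablePower : ℝ)) *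
      (1 + ‖q.2‖) ^ (-((volume : Measure (Half m)).integrablePower : ℝ))) :=
    (Measure.integrable_pow_neg_integrablePower _).mul_prod
      (Measure.integrable_pow_neg_integrablePower _)
  have h2 := (measurePreserving_heisEquiv (m := m)).integrable_comp_emb
    (heisEquiv m).toHomeomorph.measurableEmbedding (g := rapidWeight)
  refine h2.1 (h1.congr (Eventually.of_forall fun q => ?_))
  rw [Function.comp_apply, rapidWeight, ContinuousLinearEquiv.symm_apply_apply]

theorem exists_fourierHeis_le (φ : 𝓢(Heis m, ℂ)) (k : ℕ) :
    ∃ C, 0 ≤ C ∧ ∀ p, ‖embed p‖ ^ k * ‖fourierHeis φ p‖ ≤ C * rapidWeight p := by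
  set a := (volume : Measure (EuclideanSpace ℝ (Fin m))).integrablePower with ha
  set b := (volume : Measure (Half m)).integrablePower with hb
  obtain ⟨C, hC, H⟩ := exists_partialFourier_bound (splitHeis φ) (k + a) (k + b)
  refine ⟨2 ^ k * C, by positivity, fun p => ?_⟩
  have h := H ((heisEquiv m).symm p)
  rw [← fourierHeis_eq] at h
  have hle := norm_embed_le p
  rw [rapidWeight, ← ha, ← hb]
  set x := ‖((heisEquiv m).symm p).1‖ with hx
  set w := ‖((heisEquiv m).symm p).2‖ with hw
  have hx0 : 0 ≤ x := norm_nonneg _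
  have hw0 : 0 ≤ w := norm_nonneg _
  rw [Real.rpow_neg (by positivity), Real.rpow_neg (by positivity), Real.rpow_natCast,
    Real.rpow_natCast, ← mul_inv, ← div_eq_mul_inv, le_div_iff₀ (by positivity)]
  calc _ ≤ (2 * ((1 + x) * (1 + w))) ^ k * ‖fourierHeis φ p‖ * ((1 + x) ^ a * (1 + w) ^ b) := by
        gcongr
    _ = 2 ^ k * ((1 + x) ^ (k + a) * ((1 + w) ^ (k + b) * ‖fourierHeis φ p‖)) := by
        rw [mul_pow, mul_pow, pow_add, pow_add]; ring
    _ ≤ _ := by gcongr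

theorem exists_rpow_fourierHeis_le (φ : 𝓢(Heis m, ℂ)) (a : ℝ) :
    ∃ C, 0 ≤ C ∧ ∀ p, ‖embed p‖ ^ a * ‖fourierHeis φ p‖ ≤ C * rapidWeight p := by
  obtain ⟨C, hC, H⟩ := exists_fourierHeis_le φ ⌈a⌉₊
  refine ⟨C, hC, fun p => le_trans ?_ (H p)⟩
  gcongr
  rw [← Real.rpow_natCast]
  exact Real.rpow_le_rpow_of_exponent_le (one_le_norm_embed p) (Nat.le_ceil a)

theorem integrable_rpow_fourierHeis (φ : 𝓢(Heis m, ℂ)) (a : ℝ) :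
    Integrable (fun p => ‖embed p‖ ^ a * ‖fourierHeis φ p‖) := by
  obtain ⟨C, hC, H⟩ := exists_rpow_fourierHeis_le φ a
  refine (integrable_rapidWeight.const_mul C).mono'
    ((continuous_embed.norm.measurable.pow_const _).aestronglyMeasurable.mul
      (continuous_fourierHeis φ).norm.aestronglyMeasurable) (Eventually.of_forall fun p => ?_)
  rw [Real.norm_of_nonneg (by positivity)]
  exact H p

theorem lintegral_rpow_fourierHeis_sq_ne_top (φ : 𝓢(Heis m, ℂ)) (a : ℝ) :
    ∫⁻ p, (ENNReal.ofReal (‖embed p‖ ^ a) * ‖fourierHeis φ p‖ₑ) ^ (2 : ℝ) ≠ ⊤ := by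
  obtain ⟨C, hC, H⟩ := exists_rpow_fourierHeis_le φ a
  have h1 : Integrable (fun p : Heis m => C ^ 2 * rapidWeight p) :=
    integrable_rapidWeight.const_mul _
  refine ne_top_of_le_ne_top h1.lintegral_lt_top.ne (lintegral_mono fun p => ?_)
  rw [← ofReal_norm, ← ENNReal.ofReal_mul (by positivity),
    ENNReal.ofReal_rpow_of_nonneg (by positivity) zero_le_two]
  refine ENNReal.ofReal_le_ofReal ?_
  have h0 := rapidWeight_nonneg p
  calc _ ≤ (C * rapidWeight p) ^ (2 : ℝ) := by
        exact Real.rpow_le_rpow (by positivity) (H p) zero_le_two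
    _ = C ^ 2 * (rapidWeight p * rapidWeight p) := by
        rw [Real.rpow_two]; ring
    _ ≤ C ^ 2 * (rapidWeight p * 1) := by
        gcongr; exact rapidWeight_le_one p
    _ = _ := by rw [mul_one]

/-- The pairing of the `N`-picture with `F_ξ F_t φ` is continuous for the norm of `L²(S)`. -/
theorem exists_lintegral_toN_mul_fourierHeis_le (φ : 𝓢(Heis m, ℂ)) (ν : ℂ) :
    ∃ K : ENNReal, K ≠ ⊤ ∧ ∀ (δ : ZMod 2) (h : Ambient m → ℂ), IsHomog m ν δ h →
      AEStronglyMeasurable (fun ξ : Metric.sphere (0 : Ambient m) 1 => h ξ) (sphereMeasure m) →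
      ∫⁻ p, ‖toN h p * fourierHeis φ p‖ₑ ≤
        K * eLpNorm (fun ξ : Metric.sphere (0 : Ambient m) 1 => h ξ) 2 (sphereMeasure m) :=
  exists_lintegral_toN_mul_le (continuous_fourierHeis φ).aestronglyMeasurable ν
    (lintegral_rpow_fourierHeis_sq_ne_top φ _)

theorem integrable_toN_mul_fourierHeis (φ : 𝓢(Heis m, ℂ)) {ν : ℂ} {δ : ZMod 2}
    {h : Ambient m → ℂ} (hh : h ∈ V m ν δ) :
    Integrable (fun p => toN h p * fourierHeis φ p) := by
  obtain ⟨K, hK, H⟩ := exists_lintegral_toN_mul_fourierHeis_le φ ν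
  exact ⟨(hh.1.aestronglyMeasurable_toN hh.2.1).mul
    (continuous_fourierHeis φ).aestronglyMeasurable,
    (H δ h hh.1 hh.2.1).trans_lt (ENNReal.mul_lt_top hK.lt_top hh.2.2)⟩

theorem IsHomog.sub {ν : ℂ} {δ : ZMod 2} {f g : Ambient m → ℂ} (hf : IsHomog m ν δ f)
    (hg : IsHomog m ν δ g) : IsHomog m ν δ (fun X => f X - g X) := fun r hr X hX => by
  simp only [hf r hr X hX, hg r hr X hX, mul_sub]

/-- Convergence in `L²(S)` implies convergence of the transforms in the sense of distributions. -/
theorem tendsto_fourierDist (φ : 𝓢(Heis m, ℂ)) {ν : ℂ} {δ : ZMod 2} {F : ℕ → Ambient m → ℂ}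
    {f : Ambient m → ℂ} (hF : ∀ k, F k ∈ V m ν δ) (hf : f ∈ V m ν δ)
    (hlim : Tendsto (fun k => eLpNorm (fun ξ : Metric.sphere (0 : Ambient m) 1 => F k ξ - f ξ) 2
      (sphereMeasure m)) atTop (𝓝 0)) :
    Tendsto (fun k => fourierDist (toN (F k)) φ) atTop (𝓝 (fourierDist (toN f) φ)) := by
  obtain ⟨K, hK, H⟩ := exists_lintegral_toN_mul_fourierHeis_le φ ν
  have hK0 : Tendsto (fun k => K * eLpNorm (fun ξ : Metric.sphere (0 : Ambient m) 1 => F k ξ - f ξ)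
      2 (sphereMeasure m)) atTop (𝓝 0) := by
    simpa using ENNReal.Tendsto.const_mul hlim (Or.inr hK)
  have hL : Tendsto (fun k => ∫⁻ p, ‖toN (F k) p * fourierHeis φ p - toN f p * fourierHeis φ p‖ₑ)
      atTop (𝓝 0) := by
    refine tendsto_of_tendsto_of_tendsto_of_le_of_le tendsto_const_nhds hK0 (fun _ => zero_le)
      fun k => ?_
    have h1 : IsHomog m ν δ (fun X => F k X - f X) := (hF k).1.sub hf.1
    have h2 : AEStronglyMeasurable (fun ξ : Metric.sphere (0 : Ambient m) 1 => F k ξ - f ξ)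
      (sphereMeasure m) := (hF k).2.aestronglyMeasurable.sub hf.2.aestronglyMeasurable
    refine le_trans (le_of_eq ?_) (H δ (fun X => F k X - f X) h1 h2)
    refine lintegral_congr fun p => ?_
    rw [← sub_mul]; rfl
  have hI : ∀ k, Integrable (fun p => toN (F k) p * fourierHeis φ p) :=
    fun k => integrable_toN_mul_fourierHeis φ (hF k)
  have hm : AEStronglyMeasurable (fun p => toN f p * fourierHeis φ p) :=
    (integrable_toN_mul_fourierHeis φ hf).aestronglyMeasurable
  exact tendsto_integral_of_L1 (fun p => toN f p * fourierHeis φ p) hm (Eventually.of_forall hI) hL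

/-! ### The pairing of a dilated Schwartz function with a transform -/

variable {m : ℕ}

/-- The partial Fourier transform of a Schwartz function on `ℝ²ⁿ` in the last `n` variables. -/
def halfFourier (H : 𝓢(Ambient m, ℂ)) : Half m × Half m → ℂ :=
  partialFourier (SchwartzMap.compCLMOfContinuousLinearEquiv ℂ (pairEquiv m) H)

/-- The points `(r, r x)` and `r⁻¹ (ρ / 2, η)` of `ℝⁿ`, for `p = (ρ, x, η)`. -/
def rayPoint (r : ℝ) (p : Heis m) : Half m × Half m :=
  (r • WithLp.toLp 2 (1, p.2.1), r⁻¹ • WithLp.toLp 2 (p.1 / 2, p.2.2))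

/-- The dilation `(t, ξ) ↦ (2 t, ξ)` of `ℝⁿ`. -/
def dilation (m : ℕ) : Half m ≃L[ℝ] Half m :=
  LinearEquiv.toContinuousLinearEquiv
    { toFun := fun w => WithLp.toLp 2 (2 * w.fst, w.snd)
      invFun := fun w => WithLp.toLp 2 (w.fst / 2, w.snd)
      map_add' := fun p q => congrArg (WithLp.toLp 2) (Prod.ext (mul_add 2 p.fst q.fst) rfl)
      map_smul' := fun c p => congrArg (WithLp.toLp 2) (Prod.ext (mul_left_comm 2 c p.fst) rfl)
      left_inv := fun p => congrArg (WithLp.toLp 2)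
        (Prod.ext (mul_div_cancel_left₀ p.fst two_ne_zero) rfl)
      right_inv := fun p => congrArg (WithLp.toLp 2)
        (Prod.ext (mul_div_cancel₀ p.fst two_ne_zero) rfl) }

theorem dilation_apply (w : Half m) : dilation m w = WithLp.toLp 2 (2 * w.fst, w.snd) := rfl

theorem inner_dilation (v w : Half m) : inner ℝ (dilation m v) w = inner ℝ v (dilation m w) := by
  simp only [dilation_apply, WithLp.prod_inner_apply]
  simp
  ring

/-- The dilation scales Lebesgue measure. The value of the constant `c` is immaterial, as it enters
both sides of the final identity. -/
theorem exists_integral_comp_dilation (m : ℕ) :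
    ∃ c : ℝ, ∀ G : Half m → ℂ, ∫ w, G (dilation m w) = c • ∫ w, G w := by
  have := (dilation m).isAddHaarMeasure_map (volume : Measure (Half m))
  have h := Measure.isAddLeftInvariant_eq_smul ((volume : Measure (Half m)).map (dilation m))
    (volume : Measure (Half m))
  refine ⟨((Measure.addHaarScalarFactor ((volume : Measure (Half m)).map (dilation m))
    (volume : Measure (Half m)) : NNReal) : ℝ), fun G => ?_⟩
  have h1 := (dilation m).toHomeomorph.measurableEmbedding.integral_map
    (μ := (volume : Measure (Half m))) G
  change ∫ w, G w ∂((volume : Measure (Half m)).map (dilation m)) = ∫ w, G (dilation m w) at h1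
  rw [← h1]
  conv_lhs => rw [h, integral_smul_nnreal_measure]
  rfl

theorem finrank_half : Module.finrank ℝ (Half m) = m + 1 := by
  rw [(WithLp.linearEquiv 2 ℝ (ℝ × EuclideanSpace ℝ (Fin m))).finrank_eq, Module.finrank_prod]
  simp; ring

/-- The `N`-picture of a dilated Schwartz function is paired with a transform by Parseval's formula
in `(t, ξ)`. -/
theorem exists_integral_smul_embed_mul_fourierHeis (m : ℕ) : ∃ c : ℂ,
    ∀ (H : 𝓢(Ambient m, ℂ)) (φ : 𝓢(Heis m, ℂ)) (r : ℝ), 0 < r →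
      ∫ p, H (r • embed p) * fourierHeis φ p =
        c * ((r : ℂ) ^ (m + 1))⁻¹ * ∫ p, φ p * halfFourier H (rayPoint r p) := by
  obtain ⟨c, hc⟩ := exists_integral_comp_dilation m
  refine ⟨c, fun H φ r hr => ?_⟩
  set HP := SchwartzMap.compCLMOfContinuousLinearEquiv ℂ (pairEquiv m) H with hHP
  have hHPv : ∀ q, HP q = H (pair q.1 q.2) := fun q => rfl
  set A : Half m ≃L[ℝ] Half m :=
    (dilation m).trans (ContinuousLinearEquiv.smulLeft (Units.mk0 r hr.ne')) with hA
  have hAv : ∀ w, A w = r • dilation m w := fun w => rfl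
  -- the integral over `(t, ξ)`, for fixed `x`
  have key : ∀ x : EuclideanSpace ℝ (Fin m),
      ∫ w, H (r • embed (heisEquiv m (x, w))) * partialFourier (splitHeis φ) (x, w) =
      ∫ w, c * ((r : ℂ) ^ (m + 1))⁻¹ *
        (φ (heisEquiv m (x, w)) * halfFourier H (rayPoint r (heisEquiv m (x, w)))) := by
    intro x
    set ψ := slice HP (r • WithLp.toLp 2 (1, x)) with hψ
    set h := SchwartzMap.compCLMOfContinuousLinearEquiv ℂ A ψ with hh
    have hhv : ∀ w, h w = H (r • embed (heisEquiv m (x, w))) := by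
      intro w
      have e1 : h w = H (pair (r • WithLp.toLp 2 (1, x)) (r • dilation m w)) := rfl
      rw [e1, pair_smul]; rfl
    have hF : ∀ w, 𝓕 h w = c * ((r : ℂ) ^ (m + 1))⁻¹ *
        halfFourier H (rayPoint r (heisEquiv m (x, w))) := by
      intro w
      have e2 : halfFourier H (rayPoint r (heisEquiv m (x, w))) =
          𝓕 ψ (r⁻¹ • (dilation m).symm w) := rfl
      rw [e2, SchwartzMap.fourier_coe, SchwartzMap.fourier_coe, Real.fourier_eq, Real.fourier_eq]
      have e3 : ∀ v, Real.fourierChar (-inner ℝ v w) • h v =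
          (fun v => Real.fourierChar (-inner ℝ v (r⁻¹ • (dilation m).symm w)) • ψ v)
            (r • dilation m v) := by
        intro v
        have e4 : inner ℝ (r • dilation m v) (r⁻¹ • (dilation m).symm w) = inner ℝ v w := by
          rw [inner_smul_left, inner_smul_right, inner_dilation,
            ContinuousLinearEquiv.apply_symm_apply]
          simp [hr.ne']
        simp only [e4]
        rfl
      simp_rw [e3]
      have e5 := Measure.integral_comp_smul (volume : Measure (Half m)) (fun v : Half m =>
        Real.fourierChar (-inner ℝ v (r⁻¹ • (dilation m).symm w)) • ψ v) r
      rw [finrank_half, abs_of_pos (by positivity)] at e5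
      rw [hc (fun v => (fun v => Real.fourierChar (-inner ℝ v (r⁻¹ • (dilation m).symm w)) • ψ v)
        (r • v))]
      refine (congrArg (fun z : ℂ => c • z) e5).trans ?_
      simp only [Complex.real_smul]
      push_cast
      ring
    calc _ = ∫ w, h w * 𝓕 (slice (splitHeis φ) x) w := by
          refine integral_congr_ae (Eventually.of_forall fun w => ?_)
          simp only [hhv]; rfl
      _ = ∫ w, 𝓕 h w * slice (splitHeis φ) x w := (SchwartzMap.integral_fourier_mul_eq _ _).symm
      _ = _ := by
          refine integral_congr_ae (Eventually.of_forall fun w => ?_)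
          simp only [hF, slice_apply, splitHeis_apply]; ring
  obtain ⟨B, hB⟩ : ∃ B, ∀ X, ‖H X‖ ≤ B := by
    obtain ⟨B, hB⟩ := H.decay' 0 0
    exact ⟨B, fun X => by have := hB X; rwa [pow_zero, one_mul, norm_iteratedFDeriv_zero] at this⟩
  have hFint : Integrable (fun p => fourierHeis (φ : Heis m → ℂ) p) := by
    have h1 := integrable_rpow_fourierHeis φ 0
    simp only [Real.rpow_zero, one_mul] at h1
    exact (integrable_norm_iff (continuous_fourierHeis φ).aestronglyMeasurable).1 h1
  have i1 : Integrable (fun p => H (r • embed p) * fourierHeis φ p) :=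
    hFint.bdd_mul (H.continuous.comp (continuous_embed.const_smul r)).aestronglyMeasurable
      (Eventually.of_forall fun p => hB _)
  obtain ⟨B', -, hB'⟩ := exists_partialFourier_bound HP 0 0
  have hcray : Continuous (rayPoint r : Heis m → _) := by
    unfold rayPoint; fun_prop
  have i2 : Integrable (fun p => φ p * halfFourier H (rayPoint r p)) :=
    φ.integrable.mul_bdd ((continuous_partialFourier HP).comp hcray).aestronglyMeasurable
      (Eventually.of_forall fun p => (by simpa using hB' (rayPoint r p) :
        ‖partialFourier HP (rayPoint r p)‖ ≤ B'))
  have hmp := measurePreserving_heisEquiv (m := m)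
  have hemb := (heisEquiv m).toHomeomorph.measurableEmbedding
  rw [← hmp.integral_comp hemb, ← hmp.integral_comp hemb, ← integral_const_mul]
  have j1 := (hmp.integrable_comp_emb hemb).2 i1
  have j2 := ((hmp.integrable_comp_emb hemb).2 i2).const_mul ((c : ℂ) * ((r : ℂ) ^ (m + 1))⁻¹)
  have f1 := integral_prod _ j1
  have f2 := integral_prod _ j2
  refine f1.trans (Eq.trans ?_ f2.symm)
  refine integral_congr_ae (Eventually.of_forall fun x => ?_)
  refine Eq.trans ?_ (key x)
  refine integral_congr_ae (Eventually.of_forall fun w => ?_)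
  exact congrArg _ (fourierHeis_heisEquiv φ (x, w))

/-- The pairing of a Mellin transform along rays with a transform, as a Mellin transform of the
pairings with the dilated functions. -/
theorem exists_integral_rayMellin_mul_fourierHeis (m : ℕ) : ∃ c : ℂ,
    ∀ (H : 𝓢(Ambient m, ℂ)) (φ : 𝓢(Heis m, ℂ)) (a : ℂ) (k : ℕ) (g : ℝ → ℝ),
      IntegrableOn g (Set.Ioi 0) →
      (∀ p : Heis m, ∀ r, 0 < r → r ^ a.re * ‖H (r • embed p)‖ ≤ ‖embed p‖ ^ k * g r) →
      ∫ p, rayMellin a H (embed p) * fourierHeis φ p =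
        c * ∫ r in Set.Ioi (0 : ℝ), (r : ℂ) ^ (a - ((m + 1 : ℕ) : ℂ)) *
          ∫ p, φ p * halfFourier H (rayPoint r p) := by
  obtain ⟨c, hc⟩ := exists_integral_smul_embed_mul_fourierHeis m
  refine ⟨c, fun H φ a k g hg hmaj => ?_⟩
  have hgm : Integrable (fun q : Heis m × ℝ => (‖embed q.1‖ ^ k * ‖fourierHeis φ q.1‖) * g q.2)
      (volume.prod (volume.restrict (Set.Ioi 0))) := by
    have h1 := integrable_rpow_fourierHeis φ k
    simp only [Real.rpow_natCast] at h1
    exact h1.mul_prod hg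
  have hint : Integrable (fun q : Heis m × ℝ =>
      ((q.2 : ℂ) ^ a * H (q.2 • embed q.1)) * fourierHeis φ q.1)
      (volume.prod (volume.restrict (Set.Ioi 0))) := by
    refine hgm.mono' ?_ ?_
    · refine (AEStronglyMeasurable.mul ?_ ?_).mul ?_
      · exact ((Complex.measurable_ofReal.comp measurable_snd).pow_const a).aestronglyMeasurable
      · exact (H.continuous.comp
          (continuous_snd.smul (continuous_embed.comp continuous_fst))).aestronglyMeasurable
      · exact ((continuous_fourierHeis φ).comp continuous_fst).aestronglyMeasurable
    · have hae : ∀ᵐ q : Heis m × ℝ ∂(volume.prod (volume.restrict (Set.Ioi 0))), 0 < q.2 :=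
        Measure.quasiMeasurePreserving_snd.ae (ae_restrict_mem measurableSet_Ioi)
      filter_upwards [hae] with q hq
      rw [norm_mul, norm_mul, Complex.norm_cpow_eq_rpow_re_of_pos hq]
      calc _ ≤ (‖embed q.1‖ ^ k * g q.2) * ‖fourierHeis φ q.1‖ := by
            exact mul_le_mul_of_nonneg_right (hmaj q.1 q.2 hq) (norm_nonneg _)
        _ = _ := by ring
  have h1 : ∫ p, rayMellin a H (embed p) * fourierHeis φ p =
      ∫ p, ∫ r in Set.Ioi (0 : ℝ), ((r : ℂ) ^ a * H (r • embed p)) * fourierHeis φ p := by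
    refine integral_congr_ae (Eventually.of_forall fun p => ?_)
    simp only [rayMellin, smul_eq_mul]
    rw [integral_mul_const]
  rw [h1, integral_integral_swap hint, ← integral_const_mul]
  refine setIntegral_congr_fun measurableSet_Ioi fun r hr => ?_
  have hr0 : (0 : ℝ) < r := hr
  have h2 := hc H φ r hr0
  simp only [mul_assoc] at h2 ⊢
  rw [integral_const_mul, h2, Complex.cpow_sub _ _ (by exact_mod_cast hr0.ne'),
    Complex.cpow_natCast]
  ring

/-! ### The symplectic Fourier transform as an exchange of variables -/

variable {m : ℕ}

theorem halfFourier_eq_integral (H : 𝓢(Ambient m, ℂ)) (u v : Half m) :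
    halfFourier H (u, v) = ∫ w, Real.fourierChar (-inner ℝ w v) • H (pair u w) :=
  partialFourier_eq_integral _ _

theorem exists_halfFourier_bound (H : 𝓢(Ambient m, ℂ)) (j k : ℕ) : ∃ C, 0 ≤ C ∧
    ∀ p : Half m × Half m, (1 + ‖p.1‖) ^ j * ((1 + ‖p.2‖) ^ k * ‖halfFourier H p‖) ≤ C :=
  exists_partialFourier_bound _ j k

theorem continuous_halfFourier (H : 𝓢(Ambient m, ℂ)) : Continuous (halfFourier H) :=
  continuous_partialFourier _

/-- In terms of partial Fourier transforms, the symplectic Fourier transform exchanges the two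
variables. This is Fourier inversion in the first `n` variables. -/
theorem halfFourier_symplecticFourier (H : 𝓢(Ambient m, ℂ)) (u v : Half m) :
    halfFourier (symplecticFourier H) (u, v) = halfFourier H (v, u) := by
  set k : Half m → ℂ := fun x => halfFourier H (x, u) with hk
  have hkc : Continuous k := (continuous_halfFourier H).comp (by fun_prop)
  have hki : Integrable k := by
    obtain ⟨C, hC, hb⟩ := exists_halfFourier_bound H (volume : Measure (Half m)).integrablePower 0
    refine ((Measure.integrable_pow_neg_integrablePower (volume : Measure (Half m))).const_mul
      C).mono' hkc.aestronglyMeasurable (Eventually.of_forall fun x => ?_)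
    have h := hb (x, u)
    rw [pow_zero, one_mul] at h
    rw [Real.rpow_neg (by positivity), Real.rpow_natCast, ← div_eq_mul_inv,
      le_div_iff₀' (by positivity)]
    exact h
  -- the symplectic Fourier transform is an inverse Fourier transform of `k`
  have hS : ∀ η, symplecticFourier H (pair u η) = 𝓕⁻ k η := by
    intro η
    have hmp := measurePreserving_pairEquiv (m := m)
    have hemb := (pairEquiv m).toHomeomorph.measurableEmbedding
    have hint : Integrable (fun X : Ambient m =>
        Real.fourierChar (-inner ℝ X (pair (-η) u)) • H X) :=
      (Real.fourierIntegral_convergent_iff _).2 H.integrable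
    have hint2 := (hmp.integrable_comp_emb hemb).2 hint
    rw [symplecticFourier_apply, symplecticJ_pair, Real.fourier_eq, ← hmp.integral_comp hemb,
      Real.fourierInv_eq]
    refine (integral_prod _ hint2).trans ?_
    refine integral_congr_ae (Eventually.of_forall fun x => ?_)
    simp only [hk, halfFourier_eq_integral]
    rw [Circle.smul_def, ← integral_smul]
    refine integral_congr_ae (Eventually.of_forall fun w => ?_)
    simp only [Function.comp_apply, pairEquiv_apply, inner_pair, inner_neg_right, neg_add, neg_neg,
      AddChar.map_add_eq_mul, Circle.smul_def, Circle.coe_mul, smul_eq_mul, mul_assoc]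
  have hF : Integrable (𝓕 k) := by
    have h1 : 𝓕 k = fun η => symplecticFourier H (pair u (-η)) := by
      ext η
      rw [hS, Real.fourierInv_eq_fourier_neg, neg_neg]
    rw [h1]
    exact ((slice (SchwartzMap.compCLMOfContinuousLinearEquiv ℂ (pairEquiv m)
      (symplecticFourier H)) u).integrable).comp_neg
  have h := hkc.fourier_fourierInv_eq hki hF
  rw [halfFourier_eq_integral]
  simp_rw [hS]
  rw [← Real.fourier_eq, h]

/-- The partial Fourier transform preserves parity. -/
theorem halfFourier_neg {H : 𝓢(Ambient m, ℂ)} {c : ℂ} (hH : ∀ X, H (-X) = c * H X) (u v : Half m) :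
    halfFourier H (-u, -v) = c * halfFourier H (u, v) := by
  rw [halfFourier_eq_integral, halfFourier_eq_integral, ← integral_neg_eq_self,
    ← integral_const_mul]
  refine integral_congr_ae (Eventually.of_forall fun w => ?_)
  have h1 : pair (-u) (-w) = -pair u w := (pairEquiv m).map_neg (u, w)
  simp only [inner_neg_neg, h1, hH, Circle.smul_def, smul_eq_mul]
  ring

/-- The transform of `H` decays rapidly at `rayPoint r p` as `r → ∞`, because of its first entry
`r (1, x)`, and as `r → 0`, because of its second entry `r⁻¹ (ρ / 2, η)`, uniformly for `|ρ| ≥ ε`.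
-/
theorem exists_rayPoint_majorant (H : 𝓢(Ambient m, ℂ)) (σ : ℝ) {ε : ℝ} (hε : 0 < ε) :
    ∃ g : ℝ → ℝ, IntegrableOn g (Set.Ioi 0) ∧ ∀ p : Heis m, ε ≤ |p.1| → ∀ r, 0 < r →
      r ^ σ * ‖halfFourier H (rayPoint r p)‖ ≤ g r := by
  obtain ⟨N, hN⟩ := exists_nat_ge (|σ| + 2)
  obtain ⟨C1, hC1, H1⟩ := exists_halfFourier_bound H N 0
  obtain ⟨C2, hC2, H2⟩ := exists_halfFourier_bound H 0 N
  refine ⟨fun r => 2 * (C1 + C2 * (2 / ε) ^ N) * (r ^ (0 : ℝ) * (1 + r ^ 2)⁻¹), ?_,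
      fun p hp r hr => ?_⟩
  · exact (integrableOn_rpow_div_one_add_pow (by norm_num) (by norm_num)).const_mul _
  set z := ‖halfFourier H (rayPoint r p)‖ with hz
  have hz0 : 0 ≤ z := norm_nonneg _
  have n1 : r ≤ 1 + ‖(rayPoint r p).1‖ := by
    have h1 : ‖(1 : ℝ)‖ ≤ ‖(WithLp.toLp 2 (1, p.2.1) : Half m)‖ := WithLp.norm_fst_le _
        (WithLp.toLp 2 (1, p.2.1) : Half m)
    rw [rayPoint, norm_smul, Real.norm_of_nonneg hr.le]
    rw [norm_one] at h1
    nlinarith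
  have n2 : ε / (2 * r) ≤ 1 + ‖(rayPoint r p).2‖ := by
    have h1 : ‖p.1 / 2‖ ≤ ‖(WithLp.toLp 2 (p.1 / 2, p.2.2) : Half m)‖ :=
      WithLp.norm_fst_le _ (WithLp.toLp 2 (p.1 / 2, p.2.2) : Half m)
    rw [rayPoint, norm_smul, norm_inv, Real.norm_of_nonneg hr.le]
    rw [norm_div, Real.norm_eq_abs, Real.norm_two] at h1
    have h2 : ε / 2 ≤ ‖(WithLp.toLp 2 (p.1 / 2, p.2.2) : Half m)‖ := by linarith
    calc ε / (2 * r) = r⁻¹ * (ε / 2) := by field_simp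
      _ ≤ r⁻¹ * ‖(WithLp.toLp 2 (p.1 / 2, p.2.2) : Half m)‖ := by gcongr
      _ ≤ _ := by linarith
  have b1 : r ^ N * z ≤ C1 := (mul_le_mul_of_nonneg_right
    (pow_le_pow_left₀ hr.le n1 N) hz0).trans (by simpa using H1 (rayPoint r p))
  have b2 : (ε / (2 * r)) ^ N * z ≤ C2 := (mul_le_mul_of_nonneg_right
    (pow_le_pow_left₀ (by positivity) n2 N) hz0).trans (by simpa using H2 (rayPoint r p))
  have b2' : z ≤ C2 * (2 / ε) ^ N * r ^ N := by
    have : (ε / (2 * r)) ^ N * ((2 / ε) ^ N * r ^ N) = 1 := by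
      rw [← mul_pow, ← mul_pow]
      convert one_pow N using 2
      field_simp
    calc z = ((ε / (2 * r)) ^ N * z) * ((2 / ε) ^ N * r ^ N) := by
          rw [mul_right_comm, this, one_mul]
      _ ≤ C2 * ((2 / ε) ^ N * r ^ N) := by gcongr
      _ = _ := by ring
  have hσ1 := le_abs_self σ
  have hσ2 := neg_abs_le σ
  simp only [Real.rpow_zero, one_mul]
  rw [← div_eq_mul_inv, le_div_iff₀ (by positivity)]
  rcases le_total r 1 with h | h
  · have e1 : r ^ σ * z ≤ C2 * (2 / ε) ^ N := by
      calc r ^ σ * z ≤ r ^ σ * (C2 * (2 / ε) ^ N * r ^ N) := by gcongr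
        _ = C2 * (2 / ε) ^ N * r ^ (σ + N) := by
          rw [Real.rpow_add hr, Real.rpow_natCast]; ring
        _ ≤ C2 * (2 / ε) ^ N * 1 := by
          gcongr
          exact Real.rpow_le_one hr.le h (by linarith)
        _ = _ := mul_one _
    have e2 : 1 + r ^ 2 ≤ 2 := by nlinarith
    calc r ^ σ * z * (1 + r ^ 2) ≤ (C2 * (2 / ε) ^ N) * 2 := by gcongr
      _ ≤ _ := by nlinarith
  · have e1 : r ^ σ * z ≤ C1 * (r ^ 2)⁻¹ := by
      calc r ^ σ * z ≤ r ^ ((N : ℝ) - 2) * z := by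
            gcongr
            linarith
        _ = (r ^ N * z) * (r ^ 2)⁻¹ := by
            rw [Real.rpow_sub hr, Real.rpow_natCast, Real.rpow_two]; field_simp
        _ ≤ _ := by gcongr
    have e2 : 1 + r ^ 2 ≤ 2 * r ^ 2 := by nlinarith
    calc r ^ σ * z * (1 + r ^ 2) ≤ (C1 * (r ^ 2)⁻¹) * (2 * r ^ 2) := by gcongr
      _ = 2 * C1 := by field_simp
      _ ≤ _ := by
        have : 0 ≤ C2 * (2 / ε) ^ N := by positivity
        linarith

theorem continuousOn_rayPoint :
    ContinuousOn (fun q : Heis m × ℝ => rayPoint q.2 q.1) {q | 0 < q.2} := by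
  unfold rayPoint
  refine ContinuousOn.prodMk (Continuous.continuousOn (by fun_prop)) ?_
  refine ContinuousOn.smul (continuousOn_snd.inv₀ fun q hq => (ne_of_gt hq)) ?_
  exact Continuous.continuousOn (by fun_prop)

/-- Absolute convergence of the double integral of `r ^ a φ(p)` against the partial Fourier
transform of `H` at `rayPoint r p`, for all exponents `a`. -/
theorem integrable_rayPoint (H : 𝓢(Ambient m, ℂ)) (φ : 𝓢(Heis m, ℂ)) {ε : ℝ} (hε : 0 < ε)
    (hφ : ∀ p, φ p ≠ 0 → ε ≤ |p.1|) (a : ℂ) :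
    Integrable (fun q : Heis m × ℝ => φ q.1 * ((q.2 : ℂ) ^ a * halfFourier H (rayPoint q.2 q.1)))
      (volume.prod (volume.restrict (Set.Ioi 0))) := by
  obtain ⟨g, hg, hb⟩ := exists_rayPoint_majorant H a.re hε
  have hae : ∀ᵐ q : Heis m × ℝ ∂(volume.prod (volume.restrict (Set.Ioi 0))), 0 < q.2 :=
    Measure.quasiMeasurePreserving_snd.ae (ae_restrict_mem measurableSet_Ioi)
  have hrestr : (volume : Measure (Heis m)).prod (volume.restrict (Set.Ioi (0 : ℝ))) =
      ((volume : Measure (Heis m)).prod volume).restrict {q | 0 < q.2} := by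
    conv_lhs => rw [← Measure.restrict_univ (μ := (volume : Measure (Heis m)))]
    rw [Measure.prod_restrict]
    congr 1
    ext q; simp
  refine (φ.integrable.norm.mul_prod hg).mono' ?_ ?_
  · refine (φ.continuous.comp continuous_fst).aestronglyMeasurable.mul ?_
    refine ((Complex.measurable_ofReal.comp measurable_snd).pow_const a).aestronglyMeasurable.mul ?_
    rw [hrestr]
    exact ((continuous_halfFourier H).comp_continuousOn continuousOn_rayPoint).aestronglyMeasurable
      (measurableSet_lt measurable_const measurable_snd)
  · filter_upwards [hae] with q hq
    rw [norm_mul, norm_mul, Complex.norm_cpow_eq_rpow_re_of_pos hq]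
    by_cases h0 : φ q.1 = 0
    · simp [h0]
    · gcongr
      exact hb q.1 (hφ _ h0) q.2 hq

theorem integral_rayPoint_swap (H : 𝓢(Ambient m, ℂ)) (φ : 𝓢(Heis m, ℂ)) {ε : ℝ} (hε : 0 < ε)
    (hφ : ∀ p, φ p ≠ 0 → ε ≤ |p.1|) (a : ℂ) :
    ∫ r in Set.Ioi (0 : ℝ), (r : ℂ) ^ a * ∫ p, φ p * halfFourier H (rayPoint r p) =
      ∫ p, φ p * ∫ r in Set.Ioi (0 : ℝ), (r : ℂ) ^ a * halfFourier H (rayPoint r p) := by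
  have h := integral_integral_swap (f := fun (p : Heis m) (r : ℝ) =>
    φ p * ((r : ℂ) ^ a * halfFourier H (rayPoint r p))) (integrable_rayPoint H φ hε hφ a)
  calc _ = ∫ r in Set.Ioi (0 : ℝ), ∫ p, φ p * ((r : ℂ) ^ a * halfFourier H (rayPoint r p)) := by
        refine integral_congr_ae (Eventually.of_forall fun r => ?_)
        simp only
        rw [← integral_const_mul]
        refine integral_congr_ae (Eventually.of_forall fun p => ?_)
        simp only; ring
    _ = ∫ p, ∫ r in Set.Ioi (0 : ℝ), φ p * ((r : ℂ) ^ a * halfFourier H (rayPoint r p)) := h.symm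
    _ = _ := by
        refine integral_congr_ae (Eventually.of_forall fun p => ?_)
        simp only
        rw [integral_const_mul]

/-- The map `(ρ, x, η) ↦ (ρ, (2/ρ) η, (ρ/2) x)`. -/
def swapMap (p : Heis m) : Heis m := (p.1, (2 / p.1) • p.2.2, (p.1 / 2) • p.2.1)

theorem swapMap_swapMap {p : Heis m} (hp : p.1 ≠ 0) : swapMap (swapMap p) = p := by
  obtain ⟨ρ, x, η⟩ := p
  simp only at hp
  simp only [swapMap, smul_smul]
  rw [show 2 / ρ * (ρ / 2) = 1 by field_simp, show ρ / 2 * (2 / ρ) = 1 by field_simp, one_smul,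
    one_smul]

theorem algOp_eq (μ : ℂ) (δ : ZMod 2) (φ : Heis m → ℂ) (p : Heis m) :
    algOp μ δ φ p = ((|p.1 / 2| : ℝ) : ℂ) ^ μ * sgnPow δ p.1 * φ (swapMap p) := rfl

theorem ae_fst_ne_zero : ∀ᵐ p : Heis m, p.1 ≠ 0 := by
  have h : ∀ᵐ ρ : ℝ, ρ ≠ 0 := by simp [ae_iff]
  exact (Measure.quasiMeasurePreserving_fst (μ := (volume : Measure ℝ))
    (ν := (volume : Measure (EuclideanSpace ℝ (Fin m) × EuclideanSpace ℝ (Fin m))))).ae h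

theorem measurable_swapMap : Measurable (swapMap : Heis m → Heis m) := by
  unfold swapMap
  exact measurable_fst.prodMk (((measurable_const.div measurable_fst).smul
    measurable_snd.snd).prodMk ((measurable_fst.div_const 2).smul measurable_snd.fst))

theorem measurePreserving_swapMap : MeasurePreserving (swapMap : Heis m → Heis m) := by
  have h := MeasurePreserving.skew_product (MeasurePreserving.id (volume : Measure ℝ))
    (μc := (volume : Measure (EuclideanSpace ℝ (Fin m) × EuclideanSpace ℝ (Fin m))))
    (μd := (volume : Measure (EuclideanSpace ℝ (Fin m) × EuclideanSpace ℝ (Fin m))))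
    (g := fun (ρ : ℝ) q => ((2 / ρ) • q.2, (ρ / 2) • q.1)) measurable_swapMap.snd ?_
  · exact h
  · have h0 : ∀ᵐ ρ : ℝ, ρ ≠ 0 := by simp [ae_iff]
    filter_upwards [h0] with ρ hρ
    have e1 : (fun q : EuclideanSpace ℝ (Fin m) × EuclideanSpace ℝ (Fin m) =>
        ((2 / ρ) • q.2, (ρ / 2) • q.1)) =
        Prod.map (fun x => (2 / ρ) • x) (fun x => (ρ / 2) • x) ∘ Prod.swap := rfl
    have hd : (2 / ρ) ≠ 0 := div_ne_zero two_ne_zero hρ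
    have hd' : (ρ / 2) ≠ 0 := div_ne_zero hρ two_ne_zero
    rw [e1, ← Measure.map_map (by fun_prop) measurable_swap]
    have e2 : Measure.map Prod.swap (volume : Measure (EuclideanSpace ℝ (Fin m) ×
        EuclideanSpace ℝ (Fin m))) = volume := Measure.prod_swap
    rw [e2]
    have e3 := Measure.map_prod_map (volume : Measure (EuclideanSpace ℝ (Fin m)))
      (volume : Measure (EuclideanSpace ℝ (Fin m)))
      (measurable_const_smul (2 / ρ)) (measurable_const_smul (ρ / 2))
    refine e3.symm.trans ?_
    rw [Measure.map_addHaar_smul _ hd, Measure.map_addHaar_smul _ hd', Measure.prod_smul_left,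
      Measure.prod_smul_right, smul_smul, ← ENNReal.ofReal_mul (by positivity), ← abs_mul,
      ← mul_inv, ← mul_pow, show 2 / ρ * (ρ / 2) = 1 by field_simp]
    simp
    rfl

/-! ### The algebraic operator on test functions -/

variable {m : ℕ}

theorem continuousOn_swapMap : ContinuousOn (swapMap : Heis m → Heis m) {p | p.1 ≠ 0} := by
  unfold swapMap
  have h : ContinuousOn (fun p : Heis m => 2 / p.1) {p | p.1 ≠ 0} :=
    continuousOn_const.div continuousOn_fst fun p hp => hp
  have h1 : Continuous fun p : Heis m => p.2.2 := by fun_prop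
  have h2 : Continuous fun p : Heis m => (p.1 / 2) • p.2.1 := by fun_prop
  exact continuousOn_fst.prodMk ((h.smul h1.continuousOn).prodMk h2.continuousOn)

theorem contDiffAt_swapMap {p : Heis m} (hp : p.1 ≠ 0) : ContDiffAt ℝ ∞ swapMap p := by
  unfold swapMap
  refine contDiffAt_fst.prodMk (ContDiffAt.prodMk ?_ (by fun_prop))
  exact (contDiffAt_const.div contDiffAt_fst hp).smul (by fun_prop)

theorem contDiffAt_abs_cpow_mul_sgnPow (μ : ℂ) (δ : ZMod 2) {ρ : ℝ} (hρ : ρ ≠ 0) :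
    ContDiffAt ℝ ∞ (fun ρ : ℝ => ((|ρ / 2| : ℝ) : ℂ) ^ μ * sgnPow δ ρ) ρ := by
  have h1 : ContDiffAt ℝ ∞ (fun ρ : ℝ => ((|ρ / 2| : ℝ) : ℂ) ^ μ) ρ := by
    have h2 : ContDiffAt ℝ ∞ (fun t : ℝ => (t : ℂ) ^ μ) |ρ / 2| :=
      (contDiffOn_ofReal_cpow (S := Set.Ioi 0) contDiffOn_id (fun _ h => h) μ).contDiffAt
          (Ioi_mem_nhds (by positivity))
    have h3 : ContDiffAt ℝ ∞ (fun ρ : ℝ => |ρ / 2|) ρ :=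
      (contDiffAt_abs (div_ne_zero hρ two_ne_zero)).comp ρ (contDiffAt_id.div_const 2)
    exact h2.comp ρ h3
  refine h1.mul ?_
  have h4 : sgnPow δ =ᶠ[𝓝 ρ] fun _ => sgnPow δ ρ := by
    rcases lt_or_gt_of_ne hρ with h | h
    · filter_upwards [Iio_mem_nhds h] with r hr
      rw [sgnPow, sgnPow, Real.sign_of_neg hr, Real.sign_of_neg h]
    · filter_upwards [Ioi_mem_nhds h] with r hr
      rw [sgnPow, sgnPow, Real.sign_of_pos hr, Real.sign_of_pos h]
  exact contDiffAt_const.congr_of_eventuallyEq h4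

theorem algOp_mem_testFunctions {φ : Heis m → ℂ} (hφ : φ ∈ TestFunctions m) (μ : ℂ) (δ : ZMod 2) :
    algOp μ δ φ ∈ TestFunctions m := by
  obtain ⟨h1, h2, h3⟩ := hφ
  have hK : IsCompact (swapMap '' tsupport φ) :=
    h2.isCompact.image_of_continuousOn (continuousOn_swapMap.mono h3)
  have hsupp : ∀ p, algOp μ δ φ p ≠ 0 → p ∈ swapMap '' tsupport φ := by
    intro p hp
    have h4 : φ (swapMap p) ≠ 0 := right_ne_zero_of_mul hp
    have h5 := subset_tsupport φ h4
    have h6 : (swapMap p).1 ≠ 0 := h3 h5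
    exact ⟨swapMap p, h5, swapMap_swapMap h6⟩
  have hts : tsupport (algOp μ δ φ) ⊆ swapMap '' tsupport φ :=
    closure_minimal hsupp hK.isClosed
  have hne : tsupport (algOp μ δ φ) ⊆ {p | p.1 ≠ 0} := by
    refine hts.trans ?_
    rintro _ ⟨q, hq, rfl⟩
    have h5 : q.1 ≠ 0 := h3 hq
    exact h5
  refine ⟨contDiff_iff_contDiffAt.2 fun p => ?_, hK.of_isClosed_subset isClosed_closure hts, hne⟩
  by_cases hp : p.1 = 0
  · have h7 : algOp μ δ φ =ᶠ[𝓝 p] fun _ => 0 :=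
      notMem_tsupport_iff_eventuallyEq.1 fun h => hne h hp
    exact contDiffAt_const.congr_of_eventuallyEq h7
  · have h8 : ContDiffAt ℝ ∞ (fun q : Heis m => ((|q.1 / 2| : ℝ) : ℂ) ^ μ * sgnPow δ q.1) p :=
      (contDiffAt_abs_cpow_mul_sgnPow μ δ hp).comp p contDiffAt_fst
    exact h8.mul (h1.contDiffAt.comp p (contDiffAt_swapMap hp))

/-- A test function on `{ρ ≠ 0}` as a Schwartz function. -/
def testSchwartz {φ : Heis m → ℂ} (hφ : φ ∈ TestFunctions m) : 𝓢(Heis m, ℂ) :=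
  hφ.2.1.toSchwartzMap hφ.1

theorem testSchwartz_apply {φ : Heis m → ℂ} (hφ : φ ∈ TestFunctions m) (p : Heis m) :
    testSchwartz hφ p = φ p := rfl

theorem coe_testSchwartz {φ : Heis m → ℂ} (hφ : φ ∈ TestFunctions m) :
    (testSchwartz hφ : Heis m → ℂ) = φ := rfl

theorem exists_le_abs_fst {φ : Heis m → ℂ} (hφ : φ ∈ TestFunctions m) :
    ∃ ε : ℝ, 0 < ε ∧ ∀ p, φ p ≠ 0 → ε ≤ |p.1| := by
  have hK : IsCompact ((fun p : Heis m => p.1) '' tsupport φ) :=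
    hφ.2.1.isCompact.image continuous_fst
  have h0 : (0 : ℝ) ∈ ((fun p : Heis m => p.1) '' tsupport φ)ᶜ := by
    rintro ⟨p, hp, hp0⟩
    exact hφ.2.2 hp hp0
  obtain ⟨ε, hε, hb⟩ := Metric.isOpen_iff.1 hK.isClosed.isOpen_compl 0 h0
  refine ⟨ε, hε, fun p hp => ?_⟩
  by_contra! h
  exact hb (by simpa using h) ⟨p, subset_tsupport φ hp, rfl⟩

/-! ### The transform of the Knapp–Stein operator on smooth vectors -/

/-- The substitution `r = |ρ| / (2 s)` in the Mellin transform of the partial Fourier transform of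
the symplectic Fourier transform. -/
theorem integral_halfFourier_symplecticFourier {H : 𝓢(Ambient m, ℂ)} {δ : ZMod 2}
    (hH : ∀ X, H (-X) = sgnPow δ (-1) * H X) (μ : ℂ) {p : Heis m} (hp : p.1 ≠ 0) :
    ∫ r in Set.Ioi (0 : ℝ), (r : ℂ) ^ (μ - 1) * halfFourier (symplecticFourier H) (rayPoint r p) =
      ((|p.1 / 2| : ℝ) : ℂ) ^ μ * sgnPow δ p.1 *
        ∫ s in Set.Ioi (0 : ℝ), (s : ℂ) ^ (-μ - 1) * halfFourier H (rayPoint s (swapMap p)) := by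
  -- `f (c / s)` is the transform of `H` at the exchanged entries of `rayPoint (c / s) p`, which are
  -- those of `rayPoint s (swapMap p)` up to the sign of `ρ`
  set c := |p.1 / 2| with hc
  have hc0 : 0 < c := abs_pos.2 (div_ne_zero hp two_ne_zero)
  set f : ℝ → ℂ := fun r => halfFourier (symplecticFourier H) (rayPoint r p) with hf
  have hfs : ∀ s, 0 < s → f (c * s⁻¹) =
      sgnPow δ p.1 * halfFourier H (rayPoint s (swapMap p)) := by
    intro s hs
    have e1 : f (c * s⁻¹) = halfFourier H ((c * s⁻¹)⁻¹ • WithLp.toLp 2 (p.1 / 2, p.2.2),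
        (c * s⁻¹) • WithLp.toLp 2 (1, p.2.1)) := halfFourier_symplecticFourier _ _ _
    have e2 : ∀ (a : ℝ) (t : ℝ) (x : EuclideanSpace ℝ (Fin m)),
        a • (WithLp.toLp 2 (t, x) : Half m) = WithLp.toLp 2 (a * t, a • x) := fun _ _ _ => rfl
    have e5 : ∀ (a b t t' : ℝ) (x x' : EuclideanSpace ℝ (Fin m)), a * t = b * t' →
        a • x = b • x' → a • (WithLp.toLp 2 (t, x) : Half m) = b • WithLp.toLp 2 (t', x') := by
      intro a b t t' x x' h1 h2
      rw [e2, e2, h1, h2]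
    rw [e1]
    rcases lt_or_gt_of_ne hp with h | h
    · have hcv : c = -(p.1 / 2) := abs_of_neg (by linarith)
      have e3 : (c * s⁻¹)⁻¹ • (WithLp.toLp 2 (p.1 / 2, p.2.2) : Half m) =
          -(rayPoint s (swapMap p)).1 := by
        rw [rayPoint, swapMap, ← neg_smul, hcv]
        refine e5 _ _ _ _ _ _ (by field_simp) ?_
        rw [smul_smul]
        congr 1
        field_simp
      have e4 : (c * s⁻¹) • (WithLp.toLp 2 (1, p.2.1) : Half m) =
          -(rayPoint s (swapMap p)).2 := by
        rw [rayPoint, swapMap, ← neg_smul, hcv]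
        refine e5 _ _ _ _ _ _ (by field_simp) ?_
        rw [smul_smul]
        congr 1
        field_simp
      rw [e3, e4, halfFourier_neg hH]
      congr 1
      rw [sgnPow, sgnPow, Real.sign_of_neg h, Real.sign_of_neg (by norm_num)]
    · have hcv : c = p.1 / 2 := abs_of_pos (by linarith)
      have e3 : (c * s⁻¹)⁻¹ • (WithLp.toLp 2 (p.1 / 2, p.2.2) : Half m) =
          (rayPoint s (swapMap p)).1 := by
        rw [rayPoint, swapMap, hcv]
        refine e5 _ _ _ _ _ _ (by field_simp) ?_
        rw [smul_smul]
        congr 1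
        field_simp
      have e4 : (c * s⁻¹) • (WithLp.toLp 2 (1, p.2.1) : Half m) =
          (rayPoint s (swapMap p)).2 := by
        rw [rayPoint, swapMap, hcv]
        refine e5 _ _ _ _ _ _ (by field_simp) ?_
        rw [smul_smul]
        congr 1
        field_simp
      rw [e3, e4, sgnPow_of_pos _ h, one_mul]
  have h1 := mellin_comp_mul_left f μ hc0
  have h2 := mellin_comp_inv (fun t => f (c * t)) (-μ)
  rw [neg_neg, h1] at h2
  have h3 : mellin (fun t => f (c * t⁻¹)) (-μ) = sgnPow δ p.1 *
      ∫ s in Set.Ioi (0 : ℝ), (s : ℂ) ^ (-μ - 1) * halfFourier H (rayPoint s (swapMap p)) := by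
    rw [mellin, ← integral_const_mul]
    refine setIntegral_congr_fun measurableSet_Ioi fun s hs => ?_
    simp only [hfs s hs, smul_eq_mul]
    ring
  rw [h3] at h2
  change mellin f μ = _
  rw [mul_assoc, h2, smul_eq_mul, ← mul_assoc, ← Complex.cpow_add _ _ (by exact_mod_cast hc0.ne'),
    add_neg_cancel, Complex.cpow_zero, one_mul]

/-- The Mellin transforms of the pairings with `φ` and with its image under the algebraic operator,
for a Schwartz function and its symplectic Fourier transform. -/
theorem integral_pairing_symplecticFourier {H : 𝓢(Ambient m, ℂ)} {δ : ZMod 2}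
    (hH : ∀ X, H (-X) = sgnPow δ (-1) * H X) (μ : ℂ) {φ : Heis m → ℂ} (hφ : φ ∈ TestFunctions m) :
    ∫ r in Set.Ioi (0 : ℝ), (r : ℂ) ^ (μ - 1) *
        ∫ p, φ p * halfFourier (symplecticFourier H) (rayPoint r p) =
      ∫ r in Set.Ioi (0 : ℝ), (r : ℂ) ^ (-μ - 1) *
        ∫ p, algOp μ δ φ p * halfFourier H (rayPoint r p) := by
  have hφ' := algOp_mem_testFunctions hφ μ δ
  obtain ⟨ε, hε, hb⟩ := exists_le_abs_fst hφ
  obtain ⟨ε', hε', hb'⟩ := exists_le_abs_fst hφ'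
  have s1 := integral_rayPoint_swap (symplecticFourier H) (testSchwartz hφ) hε hb (μ - 1)
  have s2 := integral_rayPoint_swap H (testSchwartz hφ') hε' hb' (-μ - 1)
  simp only [testSchwartz_apply] at s1 s2
  rw [s1, s2]
  set G : Heis m → ℂ := fun p => algOp μ δ φ p *
    ∫ r in Set.Ioi (0 : ℝ), (r : ℂ) ^ (-μ - 1) * halfFourier H (rayPoint r p) with hG
  have hGi : Integrable G := by
    have h := (integrable_rayPoint H (testSchwartz hφ') hε' hb' (-μ - 1)).integral_prod_left
    refine h.congr (Eventually.of_forall fun p => ?_)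
    simp only [hG, testSchwartz_apply]
    rw [integral_const_mul]
  have hmp := measurePreserving_swapMap (m := m)
  have h1 : ∫ p, G (swapMap p) = ∫ p, G p := by
    have h2 := integral_map (μ := (volume : Measure (Heis m))) hmp.measurable.aemeasurable
      (f := G) (by rw [hmp.map_eq]; exact hGi.aestronglyMeasurable)
    rw [hmp.map_eq] at h2
    exact h2.symm
  rw [← h1]
  refine integral_congr_ae ?_
  filter_upwards [ae_fst_ne_zero] with p hp
  rw [integral_halfFourier_symplecticFourier hH μ hp, hG]
  simp only [algOp_eq, swapMap_swapMap hp]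
  simp only [swapMap]
  ring

variable {m : ℕ}

/-- As the truncation vanishes near the origin, the majorant along rays exists for all exponents,
at the cost of a power of the norm. -/
theorem exists_ray_majorant_truncate {f : Ambient m → ℂ} (hf : ContDiffOn ℝ ∞ f {0}ᶜ) (b : ℝ) :
    ∃ (k : ℕ) (g : ℝ → ℝ), IntegrableOn g (Set.Ioi 0) ∧
      ∀ p : Heis m, ∀ r, 0 < r → r ^ b * ‖generator hf (r • embed p)‖ ≤ ‖embed p‖ ^ k * g r := by
  obtain ⟨g, hg, H⟩ := exists_ray_majorant (generator hf) (b := max b 0)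
    (lt_of_lt_of_le (by norm_num) (le_max_right _ _)) one_pos
  refine ⟨⌈-b⌉₊, g, hg, fun p r hr => ?_⟩
  have he := one_le_norm_embed p
  have h1 := H (embed p) he r hr
  have hg0 : 0 ≤ g r := le_trans (by positivity) h1
  by_cases hX : ‖r • embed p‖ ∈ Set.Icc (1 : ℝ) 3
  swap
  · rw [generator_apply, truncate_eq_zero f hX, norm_zero, mul_zero]
    positivity
  rw [norm_smul, Real.norm_of_nonneg hr.le] at hX
  have h2 : r ^ b ≤ ‖embed p‖ ^ ⌈-b⌉₊ * r ^ max b 0 := by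
    rcases le_total b 0 with hb | hb
    · -- on the support of the truncation, `r⁻¹ ≤ ‖embed p‖`
      have h3 : r⁻¹ ≤ ‖embed p‖ := by
        rw [inv_le_iff_one_le_mul₀ hr, mul_comm]; exact hX.1
      rw [max_eq_right hb, Real.rpow_zero, mul_one, ← Real.rpow_natCast]
      calc r ^ b = r⁻¹ ^ (-b) := by rw [Real.inv_rpow hr.le, Real.rpow_neg hr.le, inv_inv]
        _ ≤ ‖embed p‖ ^ (-b) := Real.rpow_le_rpow (by positivity) h3 (by linarith)
        _ ≤ _ := Real.rpow_le_rpow_of_exponent_le he (Nat.le_ceil _)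
    · rw [max_eq_left hb]
      exact le_mul_of_one_le_left (by positivity) (one_le_pow₀ he)
  calc _ ≤ (‖embed p‖ ^ ⌈-b⌉₊ * r ^ max b 0) * ‖generator hf (r • embed p)‖ := by gcongr
    _ = ‖embed p‖ ^ ⌈-b⌉₊ * (r ^ max b 0 * ‖generator hf (r • embed p)‖) := by ring
    _ ≤ _ := by gcongr

/-- The pairing with the Knapp–Stein integral depends holomorphically on the spectral parameter. -/
theorem differentiableOn_integral_knappSteinIntegral_mul (δ : ZMod 2) {f : Ambient m → ℂ}
    (hf : ContDiffOn ℝ ∞ f {0}ᶜ) (φ : 𝓢(Heis m, ℂ)) :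
    DifferentiableOn ℂ (fun ν => ∫ p, knappSteinIntegral m ν δ f (embed p) * fourierHeis φ p)
      {ν | ν.re < 1 - ((m + 1 : ℕ) : ℝ)} := by
  obtain ⟨M, hM⟩ := exists_norm_sphere_le hf
  set P := (volume : Measure (Heis m)).prod (sphereMeasure m) with hP
  set w : Heis m × Metric.sphere (0 : Ambient m) 1 → ℝ :=
    fun q => |omega (q.2 : Ambient m) (embed q.1)| with hw
  set h : Heis m × Metric.sphere (0 : Ambient m) 1 → ℂ :=
    fun q => f q.2 * sgnPow δ (omega (q.2 : Ambient m) (embed q.1)) * fourierHeis φ q.1 with hh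
  have hωc : Continuous fun q : Heis m × Metric.sphere (0 : Ambient m) 1 =>
      omega (q.2 : Ambient m) (embed q.1) := by
    simp only [omega_eq_inner]
    exact (continuous_subtype_val.comp continuous_snd).inner
      ((symplecticJ m).continuous.comp (continuous_embed.comp continuous_fst))
  have hwm : Measurable w := hωc.abs.measurable
  have hhm : AEStronglyMeasurable h P :=
    (((continuous_sphere hf).comp continuous_snd).aestronglyMeasurable.mul
      ((measurable_sgnPow δ).comp hωc.measurable).aestronglyMeasurable).mul
      ((continuous_fourierHeis φ).comp continuous_fst).aestronglyMeasurable
  have hpos : ∀ᵐ q ∂P, 0 < w q := by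
    have h1 : MeasurableSet {q : Heis m × Metric.sphere (0 : Ambient m) 1 | 0 < w q} :=
      measurableSet_lt measurable_const hwm
    rw [hP, Measure.ae_prod_iff_ae_ae h1]
    refine Eventually.of_forall fun p => ?_
    filter_upwards [ae_sphere_omega_ne_zero (embed_ne_zero p)] with ξ hξ
    exact abs_pos.2 hξ
  have hint : ∀ s ∈ {s : ℂ | -1 < s.re}, Integrable (fun q => ‖h q‖ * w q ^ s.re) P := by
    intro s hs
    obtain ⟨C, hC⟩ := exists_integral_sphere_omega_rpow_le m hs
    have hmaj : Integrable (fun q => M * (‖fourierHeis φ q.1‖ * w q ^ s.re)) P := by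
      refine Integrable.const_mul ?_ M
      have hm2 : AEStronglyMeasurable (fun q : Heis m × Metric.sphere (0 : Ambient m) 1 =>
          ‖fourierHeis φ q.1‖ * w q ^ s.re) P :=
        ((continuous_fourierHeis φ).comp continuous_fst).norm.aestronglyMeasurable.mul
          (hwm.pow_const _).aestronglyMeasurable
      rw [hP, integrable_prod_iff hm2]
      refine ⟨Eventually.of_forall fun p => (hC _ (embed_ne_zero p)).1.const_mul ‖fourierHeis φ p‖, ?_⟩
      refine ((integrable_rpow_fourierHeis φ s.re).const_mul C).mono'
        (hm2.norm.integral_prod_right') (Eventually.of_forall fun p => ?_)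
      have h1 : ∀ ξ : Metric.sphere (0 : Ambient m) 1, ‖‖fourierHeis φ p‖ * w (p, ξ) ^ s.re‖ =
          ‖fourierHeis φ p‖ * |omega (ξ : Ambient m) (embed p)| ^ s.re := fun ξ =>
        Real.norm_of_nonneg (by positivity)
      simp only [h1]
      rw [integral_const_mul, norm_mul, norm_norm, Real.norm_of_nonneg
        (integral_nonneg fun ξ => by positivity)]
      calc _ ≤ ‖fourierHeis φ p‖ * (C * ‖embed p‖ ^ s.re) := by
            gcongr
            exact (hC _ (embed_ne_zero p)).2
        _ = _ := by ring
    refine hmaj.mono' (hhm.norm.mul (hwm.pow_const _).aestronglyMeasurable)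
      (Eventually.of_forall fun q => ?_)
    rw [Real.norm_of_nonneg (by positivity), hh]
    simp only [norm_mul]
    calc _ ≤ M * 1 * ‖fourierHeis φ q.1‖ * w q ^ s.re := by
          gcongr
          · exact le_trans (norm_nonneg _) (hM q.2)
          · exact hM q.2
          · exact norm_sgnPow_le _ _
      _ = _ := by ring
  have hopen : IsOpen {s : ℂ | -1 < s.re} := isOpen_lt_re _
  have hD := differentiableOn_integral_mul_cpow hhm hwm.aemeasurable hpos hopen hint
  have hcomp : DifferentiableOn ℂ (fun ν : ℂ => ∫ q, h q * (w q : ℂ) ^ (-ν - ((m + 1 : ℕ) : ℂ)) ∂P)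
      {ν | ν.re < 1 - ((m + 1 : ℕ) : ℝ)} := by
    refine hD.comp (f := fun ν : ℂ => -ν - ((m + 1 : ℕ) : ℂ)) (by fun_prop) fun ν hν => ?_
    simp only [Set.mem_ofPred_eq, Complex.sub_re, Complex.neg_re, Complex.natCast_re] at hν ⊢
    linarith
  refine hcomp.congr fun ν hν => ?_
  have hs : -ν - ((m + 1 : ℕ) : ℂ) ∈ {s : ℂ | -1 < s.re} := by
    simp only [Set.mem_ofPred_eq, Complex.sub_re, Complex.neg_re, Complex.natCast_re] at hν ⊢
    linarith
  have hi : Integrable (fun q => h q * (w q : ℂ) ^ (-ν - ((m + 1 : ℕ) : ℂ))) P := by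
    refine (hint _ hs).mono' (hhm.mul
      ((Complex.measurable_ofReal.comp hwm).pow_const _).aestronglyMeasurable) ?_
    filter_upwards [hpos] with q hq
    rw [norm_mul, Complex.norm_cpow_eq_rpow_re_of_pos hq]
  rw [integral_prod _ hi]
  refine integral_congr_ae (Eventually.of_forall fun p => ?_)
  simp only [knappSteinIntegral]
  rw [← integral_mul_const]
  refine integral_congr_ae (Eventually.of_forall fun ξ => ?_)
  simp only [hh, hw]
  ring

/-- The Mellin transform of the pairings is entire, by rapid decay at both ends of the ray. -/
theorem differentiable_integral_rayPoint (H : 𝓢(Ambient m, ℂ)) {φ : Heis m → ℂ}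
    (hφ : φ ∈ TestFunctions m) :
    Differentiable ℂ fun ν : ℂ => ∫ r in Set.Ioi (0 : ℝ), (r : ℂ) ^ (ν - 1) *
      ∫ p, φ p * halfFourier H (rayPoint r p) := by
  obtain ⟨ε, hε, hb⟩ := exists_le_abs_fst hφ
  have hI : ∀ a : ℂ, Integrable (fun r : ℝ => (r : ℂ) ^ a * ∫ p, φ p * halfFourier H (rayPoint r p))
      (volume.restrict (Set.Ioi 0)) := by
    intro a
    refine (integrable_rayPoint H (testSchwartz hφ) hε hb a).integral_prod_right.congr
      (Eventually.of_forall fun r => ?_)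
    simp only
    rw [← integral_const_mul]
    refine integral_congr_ae (Eventually.of_forall fun p => ?_)
    simp only [testSchwartz_apply]; ring
  have hpos : ∀ᵐ r : ℝ ∂(volume.restrict (Set.Ioi 0)), 0 < r := ae_restrict_mem measurableSet_Ioi
  have hm : AEStronglyMeasurable (fun r : ℝ => ∫ p, φ p * halfFourier H (rayPoint r p))
      (volume.restrict (Set.Ioi 0)) := by
    refine (hI 0).aestronglyMeasurable.congr (Eventually.of_forall fun r => ?_)
    simp
  have hD := differentiableOn_integral_mul_cpow (w := fun r : ℝ => r) hm aemeasurable_id hpos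
    isOpen_univ (fun s _ => by
      refine (hI s).norm.congr ?_
      filter_upwards [hpos] with r hr
      rw [norm_mul, Complex.norm_cpow_eq_rpow_re_of_pos hr, mul_comm])
  rw [differentiableOn_univ] at hD
  have h := hD.comp (f := fun ν : ℂ => ν - 1) (by fun_prop)
  refine (funext fun ν => ?_ : (fun ν : ℂ => ∫ r in Set.Ioi (0 : ℝ), (r : ℂ) ^ (ν - 1) *
    ∫ p, φ p * halfFourier H (rayPoint r p)) = _) ▸ h
  simp only [Function.comp_apply, mul_comm]

/-- The transforms of a smooth vector and of its image under the Knapp–Stein operator are related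
by the algebraic operator. Both sides are values at `ν = μ` of the entire function `B` of the
proof, for the left side by its representation as a Mellin average if `Re μ > -n`, and by analytic
continuation in `ν` from the strip `-n < Re ν < 1 - n` otherwise. -/
theorem fourierDist_knappStein {μ : ℂ} {δ : ZMod 2} (hμ : μ ∉ poles m δ) {f : Ambient m → ℂ}
    (hf : f ∈ VSmooth m (-μ) δ) {φ : Heis m → ℂ} (hφ : φ ∈ TestFunctions m) :
    fourierDist (toN (knappStein m μ δ f)) φ = fourierDist (toN f) (algOp μ δ φ) := by
  obtain ⟨c, hc⟩ := exists_integral_rayMellin_mul_fourierHeis m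
  set H := generator hf.1 with hH
  have hφ' := algOp_mem_testFunctions hφ μ δ
  set B : ℂ → ℂ := fun ν => c * ∫ r in Set.Ioi (0 : ℝ), (r : ℂ) ^ (ν - 1) *
    ∫ p, φ p * halfFourier (symplecticFourier H) (rayPoint r p) with hB
  -- the right-hand side
  have hright : fourierDist (toN f) (algOp μ δ φ) = B μ := by
    obtain ⟨k, g, hg, hmaj⟩ := exists_ray_majorant_truncate hf.1 (((m + 1 : ℕ) : ℂ) - 1 - μ).re
    have h1 := hc H (testSchwartz hφ') _ k g hg hmaj
    have h2 : fourierDist (toN f) (algOp μ δ φ) =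
        ∫ p, rayMellin (((m + 1 : ℕ) : ℂ) - 1 - μ) H (embed p) *
          fourierHeis (testSchwartz hφ') p := by
      refine integral_congr_ae (Eventually.of_forall fun p => ?_)
      have h3 := rayMellin_truncate hf.2 (embed_ne_zero p)
      simp only [toN, coe_testSchwartz]
      rw [← h3]
      rfl
    rw [h2, h1, hB]
    simp only [testSchwartz_apply]
    rw [integral_pairing_symplecticFourier (truncate_neg hf.2) μ hφ,
      show ((m + 1 : ℕ) : ℂ) - 1 - μ - ((m + 1 : ℕ) : ℂ) = -μ - 1 by ring]
  -- the pairing with the Mellin transform of the symplectic Fourier transform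
  have hleft : ∀ ν : ℂ, -((m + 1 : ℕ) : ℝ) < ν.re →
      ∫ p, rayMellin (((m + 1 : ℕ) : ℂ) - 1 + ν) (generatorFourier hf.1) (embed p) *
        fourierHeis φ p = B ν := by
    intro ν hν
    have ha : -1 < (((m + 1 : ℕ) : ℂ) - 1 + ν).re := by
      simp only [Complex.add_re, Complex.sub_re, Complex.natCast_re, Complex.one_re]
      linarith
    obtain ⟨g, hg, hmaj⟩ := exists_ray_majorant (generatorFourier hf.1) ha one_pos
    have h1 := hc (generatorFourier hf.1) (testSchwartz hφ) _ 0 g hg (fun p r hr => by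
      rw [pow_zero, one_mul]
      exact hmaj _ (one_le_norm_embed p) r hr)
    rw [coe_testSchwartz] at h1
    rw [h1, hB]
    rw [show ((m + 1 : ℕ) : ℂ) - 1 + ν - ((m + 1 : ℕ) : ℂ) = ν - 1 by ring]
    rfl
  rw [hright]
  rcases lt_or_ge (-((m + 1 : ℕ) : ℝ)) μ.re with hre | hre
  · rw [← hleft μ hre]
    refine integral_congr_ae (Eventually.of_forall fun p => ?_)
    simp only [toN, knappStein_eq_rayMellin hf hre (embed_ne_zero p)]
  · -- analytic continuation from the strip `-n < Re ν < 1 - n`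
    obtain ⟨P, q, hP, hq, hPq, hq0⟩ := exists_normConst_inv_eq m δ
    set U : Set ℂ := {ν | ν.re < 1 - ((m + 1 : ℕ) : ℝ)} with hU
    have hUo : IsOpen U := isOpen_re_lt _
    have hUc : IsPreconnected U := (convex_halfSpace_re_lt _).isPreconnected
    set I : ℂ → ℂ := fun ν => ∫ p, knappSteinIntegral m ν δ f (embed p) * fourierHeis φ p with hI
    have hID : DifferentiableOn ℂ I U :=
      differentiableOn_integral_knappSteinIntegral_mul δ hf.1 (testSchwartz hφ)
    have h1 : AnalyticOnNhd ℂ (fun ν => cutoffMellin (μ - ν) * (P ν * I ν)) U := by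
      refine DifferentiableOn.analyticOnNhd ?_ hUo
      refine DifferentiableOn.mul ?_ (hP.differentiableOn.mul hID)
      exact (differentiable_cutoffMellin.comp (by fun_prop : Differentiable ℂ fun ν : ℂ =>
        μ - ν)).differentiableOn
    have h2 : AnalyticOnNhd ℂ (fun ν => q ν * B ν) U := by
      refine DifferentiableOn.analyticOnNhd (Differentiable.differentiableOn ?_) hUo
      exact hq.mul ((differentiable_integral_rayPoint _ hφ).const_mul c)
    set ν0 : ℂ := ((1 / 2 - ((m + 1 : ℕ) : ℝ) : ℝ) : ℂ) with hν0
    have hν0r : ν0.re = 1 / 2 - ((m + 1 : ℕ) : ℝ) := Complex.ofReal_re _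
    have hν0U : ν0 ∈ U := by
      rw [hU, Set.mem_ofPred_eq, hν0r]; linarith
    have hev : (fun ν => cutoffMellin (μ - ν) * (P ν * I ν)) =ᶠ[𝓝 ν0] fun ν => q ν * B ν := by
      have hn1 : {ν : ℂ | -((m + 1 : ℕ) : ℝ) < ν.re} ∈ 𝓝 ν0 := by
        refine (isOpen_lt_re _).mem_nhds ?_
        rw [Set.mem_ofPred_eq, hν0r]; linarith
      filter_upwards [hUo.mem_nhds hν0U, hn1] with ν hνU hν
      have hqν : q ν ≠ 0 := hq0 ν fun hmem => absurd (re_le_of_mem_poles hmem) (not_le.2 hν)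
      rw [← hleft ν hν]
      have h3 : ∫ p, rayMellin (((m + 1 : ℕ) : ℂ) - 1 + ν) (generatorFourier hf.1) (embed p) *
          fourierHeis φ p = cutoffMellin (μ - ν) * (normConst m ν δ)⁻¹ * I ν := by
        rw [hI, ← integral_const_mul]
        refine integral_congr_ae (Eventually.of_forall fun p => ?_)
        simp only [rayMellin_generatorFourier hf hν hνU (embed_ne_zero p)]
        ring
      rw [h3, hPq]
      field_simp
    have hμU : μ ∈ U := by
      rw [hU, Set.mem_ofPred_eq]; linarith
    have h4 := h1.eqOn_of_preconnected_of_eventuallyEq h2 hUc hν0U hev hμU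
    simp only [sub_self, cutoffMellin_zero, one_mul] at h4
    have h5 : fourierDist (toN (knappStein m μ δ f)) φ = (normConst m μ δ)⁻¹ * I μ := by
      rw [hI, fourierDist, ← integral_const_mul]
      refine integral_congr_ae (Eventually.of_forall fun p => ?_)
      simp only [toN, knappStein_eq_integral hμ hf hμU (embed_ne_zero p)]
      ring
    have hqμ := hq0 μ hμ
    rw [h5, hPq, mul_comm (P μ), mul_assoc, h4, ← mul_assoc, inv_mul_cancel₀ hqμ, one_mul]

theorem VSmooth_subset_V {μ : ℂ} {δ : ZMod 2} : VSmooth m μ δ ⊆ V m μ δ :=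
  fun _ hf => ⟨hf.2, memLp_sphere hf.1⟩

/-- The relation between the transforms is closed under limits in `L²(S)`, hence holds on the graph
of the closure. -/
theorem KnappSteinGraph.fourierDist_eq {μ : ℂ} {δ : ZMod 2} (hμ : μ ∉ poles m δ)
    {f g : Ambient m → ℂ} (h : KnappSteinGraph m μ δ f g) {φ : Heis m → ℂ}
    (hφ : φ ∈ TestFunctions m) :
    fourierDist (toN g) φ = fourierDist (toN f) (algOp μ δ φ) := by
  obtain ⟨hf, hg, F, hF, h1, h2⟩ := h
  have e1 := tendsto_fourierDist (testSchwartz (algOp_mem_testFunctions hφ μ δ))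
    (fun k => VSmooth_subset_V (hF k)) hf h1
  have e2 := tendsto_fourierDist (testSchwartz hφ)
    (fun k => VSmooth_subset_V (knappStein_mem hμ (hF k))) hg h2
  rw [coe_testSchwartz] at e1 e2
  simp only [fourierDist_knappStein hμ (hF _) hφ] at e2
  exact tendsto_nhds_unique e2 e1

/-! ### Unitarity of the Knapp–Stein operator on the imaginary axis -/

variable {m : ℕ}

theorem integrable_rpow_norm_mul_schwartz (Φ : 𝓢(Ambient m, ℂ)) :
    Integrable (fun Y : Ambient m => ‖Y‖ ^ (-((m + 1 : ℕ) : ℝ)) * ‖Φ Y‖) := by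
  have hmeas : Measurable fun Y : Ambient m => ‖Y‖ ^ (-((m + 1 : ℕ) : ℝ)) * ‖Φ Y‖ :=
    (measurable_norm.pow_const _).mul Φ.continuous.norm.measurable
  refine ⟨hmeas.aestronglyMeasurable, ?_⟩
  obtain ⟨g, hg, H⟩ := exists_ray_majorant Φ (b := (m : ℝ))
    (by linarith [(Nat.cast_nonneg m : (0 : ℝ) ≤ m)]) one_pos
  rw [hasFiniteIntegral_iff_enorm, lintegral_polar hmeas.enorm, finrank_ambient]
  have hle : ∀ θ : Metric.sphere (0 : Ambient m) 1,
      ∫⁻ r, ‖‖r • (θ : Ambient m)‖ ^ (-((m + 1 : ℕ) : ℝ)) * ‖Φ (r • (θ : Ambient m))‖‖ₑ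
        ∂rayMeasure (2 * (m + 1)) ≤ ∫⁻ r in Set.Ioi (0 : ℝ), ENNReal.ofReal (g r) := by
    intro θ
    have hm2 : Measurable fun r : ℝ =>
        ‖‖r • (θ : Ambient m)‖ ^ (-((m + 1 : ℕ) : ℝ)) * ‖Φ (r • (θ : Ambient m))‖‖ₑ :=
      hmeas.enorm.comp (measurable_id.smul_const _)
    rw [lintegral_rayMeasure _ hm2]
    refine setLIntegral_mono' measurableSet_Ioi fun r hr => ?_
    have hr0 : (0 : ℝ) < r := hr
    have hθ : ‖(θ : Ambient m)‖ = 1 := norm_eq_of_mem_sphere θ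
    rw [← ofReal_norm, ← ENNReal.ofReal_mul (by positivity)]
    refine ENNReal.ofReal_le_ofReal (le_trans (le_of_eq ?_) (H θ hθ.ge r hr0))
    rw [Real.norm_of_nonneg (by positivity), norm_smul, hθ, mul_one, Real.norm_of_nonneg hr0.le,
      ← mul_assoc, ← Real.rpow_natCast, ← Real.rpow_add hr0]
    congr 2
    rw [show 2 * (m + 1) - 1 = 2 * m + 1 by omega]
    push_cast; ring
  refine (lintegral_mono hle).trans_lt ?_
  rw [lintegral_const]
  exact ENNReal.mul_lt_top hg.lintegral_lt_top (measure_lt_top _ _)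

/-- Absolute convergence of the double integral of `r ^ (n - 1 + a) Φ(r Y)` times the conjugate of
`Φ(Y)`: the integral over `r` is of order `‖Y‖ ^ (-n)`, and this is locally integrable on `ℝ²ⁿ`. -/
theorem integrable_ray_mul_conj (Φ : 𝓢(Ambient m, ℂ)) {a : ℂ} (ha : a.re = 0) :
    Integrable (fun q : Ambient m × ℝ =>
      ((q.2 : ℂ) ^ (((m + 1 : ℕ) : ℂ) - 1 + a) * Φ (q.2 • q.1)) * conj (Φ q.1))
      (volume.prod (volume.restrict (Set.Ioi 0))) := by
  have hre : (((m + 1 : ℕ) : ℂ) - 1 + a).re = m := by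
    simp only [Complex.add_re, Complex.sub_re, Complex.natCast_re, Complex.one_re, ha]
    push_cast; ring
  obtain ⟨g, hg, H⟩ := exists_ray_majorant Φ (b := (m : ℝ))
    (by linarith [(Nat.cast_nonneg m : (0 : ℝ) ≤ m)]) one_pos
  have hm : AEStronglyMeasurable (fun q : Ambient m × ℝ =>
      ((q.2 : ℂ) ^ (((m + 1 : ℕ) : ℂ) - 1 + a) * Φ (q.2 • q.1)) * conj (Φ q.1))
      (volume.prod (volume.restrict (Set.Ioi 0))) := by
    refine (AEStronglyMeasurable.mul ?_ ?_).mul ?_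
    · exact ((Complex.measurable_ofReal.comp measurable_snd).pow_const _).aestronglyMeasurable
    · exact (Φ.continuous.comp (continuous_snd.smul continuous_fst)).aestronglyMeasurable
    · exact (Complex.continuous_conj.comp (Φ.continuous.comp continuous_fst)).aestronglyMeasurable
  have hne : ∀ᵐ Y : Ambient m, Y ≠ 0 := by simp [ae_iff]
  rw [integrable_prod_iff hm]
  constructor
  · filter_upwards [hne] with Y hY
    exact (integrableOn_ray Φ (by rw [hre]; have : (0 : ℝ) ≤ m := by positivity
                                  linarith) hY).mul_const _
  · refine ((integrable_rpow_norm_mul_schwartz Φ).const_mul (∫ r in Set.Ioi (0 : ℝ), g r)).mono'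
      hm.norm.integral_prod_right' ?_
    filter_upwards [hne] with Y hY
    have hY0 : 0 < ‖Y‖ := norm_pos_iff.2 hY
    rw [Real.norm_of_nonneg (integral_nonneg fun _ => norm_nonneg _)]
    have h1 : ∫ r in Set.Ioi (0 : ℝ), ‖((r : ℂ) ^ (((m + 1 : ℕ) : ℂ) - 1 + a) * Φ (r • Y)) *
        conj (Φ Y)‖ = (∫ r in Set.Ioi (0 : ℝ), r ^ (m : ℝ) * ‖Φ (r • Y)‖) * ‖Φ Y‖ := by
      rw [← integral_mul_const]
      refine setIntegral_congr_fun measurableSet_Ioi fun r hr => ?_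
      simp only [norm_mul, RCLike.norm_conj, Complex.norm_cpow_eq_rpow_re_of_pos hr, hre]
    -- rescaling to the unit sphere
    have h2 : ∫ r in Set.Ioi (0 : ℝ), r ^ (m : ℝ) * ‖Φ (r • Y)‖ =
        ‖Y‖ ^ (-((m + 1 : ℕ) : ℝ)) *
          ∫ r in Set.Ioi (0 : ℝ), r ^ (m : ℝ) * ‖Φ (r • (‖Y‖⁻¹ • Y))‖ := by
      have h3 := integral_comp_mul_right_Ioi
        (fun r => r ^ (m : ℝ) * ‖Φ (r • (‖Y‖⁻¹ • Y))‖) 0 hY0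
      rw [zero_mul] at h3
      have h4 : ∫ r in Set.Ioi (0 : ℝ), (r * ‖Y‖) ^ (m : ℝ) * ‖Φ ((r * ‖Y‖) • (‖Y‖⁻¹ • Y))‖ =
          ‖Y‖ ^ (m : ℝ) * ∫ r in Set.Ioi (0 : ℝ), r ^ (m : ℝ) * ‖Φ (r • Y)‖ := by
        rw [← integral_const_mul]
        refine setIntegral_congr_fun measurableSet_Ioi fun r hr => ?_
        have hr0 : (0 : ℝ) < r := hr
        rw [smul_smul, mul_assoc r, mul_inv_cancel₀ hY0.ne', mul_one,
          Real.mul_rpow hr0.le hY0.le]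
        ring
      rw [h4] at h3
      rw [smul_eq_mul] at h3
      rw [Real.rpow_neg hY0.le, Nat.cast_succ, Real.rpow_add hY0, Real.rpow_one, mul_inv, mul_assoc,
        ← h3, ← mul_assoc, inv_mul_cancel₀ (by positivity), one_mul]
    have hθ : ‖‖Y‖⁻¹ • Y‖ = 1 := by
      rw [norm_smul, norm_inv, norm_norm, inv_mul_cancel₀ hY0.ne']
    have h5 : ∫ r in Set.Ioi (0 : ℝ), r ^ (m : ℝ) * ‖Φ (r • (‖Y‖⁻¹ • Y))‖ ≤
        ∫ r in Set.Ioi (0 : ℝ), g r := by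
      refine integral_mono_of_nonneg ?_ hg ?_
      · filter_upwards [ae_restrict_mem measurableSet_Ioi] with r hr
        have hr0 : (0 : ℝ) < r := hr
        positivity
      · filter_upwards [ae_restrict_mem measurableSet_Ioi] with r hr
        exact H _ hθ.ge r hr
    rw [h1, h2]
    calc _ ≤ ‖Y‖ ^ (-((m + 1 : ℕ) : ℝ)) * (∫ r in Set.Ioi (0 : ℝ), g r) * ‖Φ Y‖ := by gcongr
      _ = _ := by ring

/-- The `L²(S)` norm of the Mellin transform of a Schwartz function along rays, on the unitary axis,
in terms of the pairings of the function with its dilations. -/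
theorem integral_sphere_rayMellin_mul_conj (Φ : 𝓢(Ambient m, ℂ)) {a : ℂ} (ha : a.re = 0)
    {δ : ZMod 2} {h : Ambient m → ℂ} (hh : IsHomog m a δ h)
    (hΦ : ∀ Y, Y ≠ 0 → h Y = rayMellin (((m + 1 : ℕ) : ℂ) - 1 + a) Φ Y) :
    ∫ ξ : Metric.sphere (0 : Ambient m) 1, h ξ * conj (h ξ) ∂(sphereMeasure m) =
      ∫ t in Set.Ioi (0 : ℝ), (t : ℂ) ^ (((m + 1 : ℕ) : ℂ) - 1 + a) *
        ∫ Y, Φ (t • Y) * conj (Φ Y) := by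
  have hF := integrable_ray_mul_conj Φ ha
  have hne : ∀ᵐ Y : Ambient m, Y ≠ 0 := by simp [ae_iff]
  have hin : (fun Y => ∫ t in Set.Ioi (0 : ℝ),
      ((t : ℂ) ^ (((m + 1 : ℕ) : ℂ) - 1 + a) * Φ (t • Y)) * conj (Φ Y)) =ᵐ[volume]
      fun Y => h Y * conj (Φ Y) := by
    filter_upwards [hne] with Y hY
    rw [integral_mul_const, hΦ Y hY]
    rfl
  have hG : Integrable (fun Y => h Y * conj (Φ Y)) := hF.integral_prod_left.congr hin
  have h1 : ∫ Y, h Y * conj (Φ Y) = ∫ t in Set.Ioi (0 : ℝ),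
      (t : ℂ) ^ (((m + 1 : ℕ) : ℂ) - 1 + a) * ∫ Y, Φ (t • Y) * conj (Φ Y) := by
    rw [← integral_congr_ae hin, integral_integral_swap hF]
    refine integral_congr_ae (Eventually.of_forall fun t => ?_)
    simp only [mul_assoc]
    rw [integral_const_mul]
  rw [← h1, integral_polar hG, finrank_ambient]
  refine integral_congr_ae (Eventually.of_forall fun ξ => ?_)
  simp only
  have hξ := sphere_ne_zero ξ
  have hca : conj a = -a := by
    apply Complex.ext <;> simp [ha]
  have h2 : ∀ r ∈ Set.Ioi (0 : ℝ), (r : ℂ) ^ (2 * (m + 1) - 1) *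
      (h (r • (ξ : Ambient m)) * conj (Φ (r • (ξ : Ambient m)))) = h ξ *
      conj ((r : ℂ) ^ (((m + 1 : ℕ) : ℂ) - 1 + a) * Φ (r • (ξ : Ambient m))) := by
    intro r hr
    have hr0 : (0 : ℝ) < r := hr
    have hrc : (r : ℂ) ≠ 0 := by exact_mod_cast hr0.ne'
    have harg : ((r : ℝ) : ℂ).arg ≠ Real.pi := by
      rw [Complex.arg_ofReal_of_nonneg hr0.le]; exact Real.pi_ne_zero.symm
    have h3 : conj ((r : ℂ) ^ (((m + 1 : ℕ) : ℂ) - 1 + a)) =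
        (r : ℂ) ^ (((m + 1 : ℕ) : ℂ) - 1 - a) := by
      have h5 := Complex.cpow_conj (r : ℂ) (((m + 1 : ℕ) : ℂ) - 1 + a) harg
      rw [Complex.conj_ofReal] at h5
      rw [← h5]
      congr 1
      simp only [map_add, map_sub, map_natCast, map_one, hca]
      ring
    rw [map_mul, h3, hh.smul_pos hr0 hξ, ← Complex.cpow_natCast]
    have h4 : (r : ℂ) ^ (((2 * (m + 1) - 1 : ℕ)) : ℂ) * (r : ℂ) ^ (-((m + 1 : ℕ) : ℂ) - a) =
        (r : ℂ) ^ (((m + 1 : ℕ) : ℂ) - 1 - a) := by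
      rw [← Complex.cpow_add _ _ hrc]
      congr 1
      rw [show 2 * (m + 1) - 1 = 2 * m + 1 by omega]
      push_cast; ring
    rw [← h4]
    ring
  rw [setIntegral_congr_fun measurableSet_Ioi h2, integral_const_mul, integral_conj]
  rw [← show rayMellin (((m + 1 : ℕ) : ℂ) - 1 + a) Φ ξ = ∫ r in Set.Ioi (0 : ℝ),
    (r : ℂ) ^ (((m + 1 : ℕ) : ℂ) - 1 + a) * Φ (r • (ξ : Ambient m)) from rfl, ← hΦ _ hξ]

/-- Parseval's formula for a Schwartz function and its dilation. -/
theorem integral_symplecticFourier_smul_mul_conj (H : 𝓢(Ambient m, ℂ)) {t : ℝ} (ht : 0 < t) :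
    ∫ Y, symplecticFourier H (t • Y) * conj (symplecticFourier H Y) =
      ((t : ℂ) ^ (2 * (m + 1)))⁻¹ * ∫ X, H (t⁻¹ • X) * conj (H X) := by
  set A : Ambient m ≃L[ℝ] Ambient m :=
    ContinuousLinearEquiv.smulLeft (Units.mk0 t⁻¹ (inv_ne_zero ht.ne')) with hA
  set Ht : 𝓢(Ambient m, ℂ) := SchwartzMap.compCLMOfContinuousLinearEquiv ℂ A H with hHt
  have hHtv : ∀ X, Ht X = H (t⁻¹ • X) := fun _ => rfl
  have htc : (t : ℂ) ≠ 0 := by exact_mod_cast ht.ne'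
  have hF : ∀ Z, 𝓕 H (t • Z) = ((t : ℂ) ^ (2 * (m + 1)))⁻¹ * 𝓕 Ht Z := by
    intro Z
    rw [SchwartzMap.fourier_coe, SchwartzMap.fourier_coe, Real.fourier_eq, Real.fourier_eq]
    have h1 := Measure.integral_comp_smul (volume : Measure (Ambient m))
      (fun X => Real.fourierChar (-inner ℝ X (t • Z)) • H X) t⁻¹
    rw [finrank_ambient, abs_of_pos (by positivity)] at h1
    have h2 : ∀ X, Real.fourierChar (-inner ℝ (t⁻¹ • X) (t • Z)) • H (t⁻¹ • X) =
        Real.fourierChar (-inner ℝ X Z) • Ht X := by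
      intro X
      rw [hHtv, inner_smul_left, inner_smul_right]
      congr 3
      simp [ht.ne']
    simp only [h2] at h1
    rw [h1, Complex.real_smul]
    push_cast
    rw [inv_pow, inv_inv, ← mul_assoc, inv_mul_cancel₀ (by positivity), one_mul]
  have h3 : ∫ Y, symplecticFourier H (t • Y) * conj (symplecticFourier H Y) =
      ∫ Z, 𝓕 H (t • Z) * conj (𝓕 H Z) := by
    rw [← (symplecticJ m).measurePreserving.integral_comp
      (symplecticJ m).toHomeomorph.measurableEmbedding (fun Z => 𝓕 H (t • Z) * conj (𝓕 H Z))]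
    refine integral_congr_ae (Eventually.of_forall fun Y => ?_)
    simp only [symplecticFourier_apply, SchwartzMap.fourier_coe, map_smul]
  have h4 := SchwartzMap.integral_inner_fourier_fourier H Ht
  simp only [RCLike.inner_apply] at h4
  rw [h3]
  simp only [hF, mul_assoc]
  rw [integral_const_mul, h4]
  simp only [hHtv]

/-- The Knapp–Stein operator is isometric on the imaginary axis. Both squares of norms are Mellin
transforms of pairings with dilations, and Parseval's formula exchanges the dilations by `t` and
`t⁻¹`. -/
theorem integral_sphere_knappStein_mul_conj {μ : ℂ} {δ : ZMod 2} (hre : μ.re = 0)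
    (hμ : μ ∉ poles m δ) {f : Ambient m → ℂ} (hf : f ∈ VSmooth m (-μ) δ) :
    ∫ ξ : Metric.sphere (0 : Ambient m) 1, knappStein m μ δ f ξ * conj (knappStein m μ δ f ξ)
      ∂(sphereMeasure m) =
      ∫ ξ : Metric.sphere (0 : Ambient m) 1, f ξ * conj (f ξ) ∂(sphereMeasure m) := by
  have hpos : -((m + 1 : ℕ) : ℝ) < μ.re := by
    rw [hre]; push_cast; have : (0 : ℝ) ≤ m := by positivity
    linarith
  have h1 := integral_sphere_rayMellin_mul_conj (generatorFourier hf.1) hre (knappStein_mem hμ hf).2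
    fun Y hY => knappStein_eq_rayMellin hf hpos hY
  have h2 := integral_sphere_rayMellin_mul_conj (generator hf.1) (a := -μ) (by simp [hre]) hf.2
    fun Y hY => by
      rw [← sub_eq_add_neg]
      exact (rayMellin_truncate hf.2 hY).symm
  rw [h1, h2]
  set Q : ℝ → ℂ := fun t => ∫ X, generator hf.1 (t • X) * conj (generator hf.1 X) with hQ
  -- Parseval's formula, and the substitution `t ↦ t⁻¹`
  have h3 := mellin_comp_inv Q (μ - ((m + 1 : ℕ) : ℂ))
  rw [mellin, mellin] at h3
  have h4 : ∫ t in Set.Ioi (0 : ℝ), (t : ℂ) ^ (((m + 1 : ℕ) : ℂ) - 1 + μ) *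
      ∫ Y, generatorFourier hf.1 (t • Y) * conj (generatorFourier hf.1 Y) =
      ∫ t in Set.Ioi (0 : ℝ), (t : ℂ) ^ (μ - ((m + 1 : ℕ) : ℂ) - 1) • Q t⁻¹ := by
    refine setIntegral_congr_fun measurableSet_Ioi fun t ht => ?_
    have ht0 : (0 : ℝ) < t := ht
    have htc : (t : ℂ) ≠ 0 := by exact_mod_cast ht0.ne'
    simp only [generatorFourier]
    rw [integral_symplecticFourier_smul_mul_conj _ ht0, ← mul_assoc, smul_eq_mul,
      ← Complex.cpow_natCast, ← Complex.cpow_neg, ← Complex.cpow_add _ _ htc]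
    congr 2
    push_cast; ring
  rw [h4, h3]
  refine setIntegral_congr_fun measurableSet_Ioi fun t ht => ?_
  simp only [smul_eq_mul, hQ]
  congr 2
  ring

/-- The Knapp–Stein operator preserves the norm of `L²(S)` if `Re μ = 0`. -/
theorem eLpNorm_knappStein {μ : ℂ} {δ : ZMod 2} (hre : μ.re = 0) (hμ : μ ∉ poles m δ)
    {f : Ambient m → ℂ} (hf : f ∈ VSmooth m (-μ) δ) :
    eLpNorm (fun ξ : Metric.sphere (0 : Ambient m) 1 => knappStein m μ δ f ξ) 2 (sphereMeasure m) =
      eLpNorm (fun ξ : Metric.sphere (0 : Ambient m) 1 => f ξ) 2 (sphereMeasure m) := by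
  have key : ∀ h : Ambient m → ℂ, ContDiffOn ℝ ∞ h {0}ᶜ →
      eLpNorm (fun ξ : Metric.sphere (0 : Ambient m) 1 => h ξ) 2 (sphereMeasure m) =
      ENNReal.ofReal ((∫ ξ : Metric.sphere (0 : Ambient m) 1, h ξ * conj (h ξ)
        ∂(sphereMeasure m)).re ^ (1 / 2 : ℝ)) := by
    intro h hh
    rw [(memLp_sphere hh).eLpNorm_eq_integral_rpow_norm (by simp) (by simp)]
    congr 1
    simp only [ENNReal.toReal_ofNat, one_div]
    congr 1
    rw [← RCLike.re_eq_complex_re, ← integral_re]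
    · refine integral_congr_ae (Eventually.of_forall fun ξ => ?_)
      simp only [Complex.mul_conj, RCLike.re_eq_complex_re, Complex.ofReal_re,
        Complex.normSq_eq_norm_sq, Real.rpow_two]
    · have hc := continuous_sphere hh
      exact (hc.mul (Complex.continuous_conj.comp hc)).integrable_of_hasCompactSupport
        (HasCompactSupport.of_compactSpace _)
  rw [key _ (knappStein_mem hμ hf).1, key _ hf.1, integral_sphere_knappStein_mul_conj hre hμ hf]

/-! ### Density of the smooth vectors and extension to square integrable vectors -/

variable {m : ℕ}

/-- The homogeneous function of degree `-n - ν` and parity `δ` whose restriction to the sphere is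
the part of `G` of parity `δ`. -/
def homogExtension (ν : ℂ) (δ : ZMod 2) (G : Ambient m → ℂ) (X : Ambient m) : ℂ :=
  ((‖X‖ : ℝ) : ℂ) ^ (-((m + 1 : ℕ) : ℂ) - ν) *
    (1 / 2 * (G (‖X‖⁻¹ • X) + sgnPow δ (-1) * G (-(‖X‖⁻¹ • X))))

theorem sgnPow_neg_one_mul_self (δ : ZMod 2) : sgnPow δ (-1) * sgnPow δ (-1) = 1 :=
  sgnPow_mul_self δ (by norm_num)

theorem isHomog_homogExtension (ν : ℂ) (δ : ZMod 2) (G : Ambient m → ℂ) :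
    IsHomog m ν δ (homogExtension ν δ G) := by
  intro r hr X hX
  have hX0 : 0 < ‖X‖ := norm_pos_iff.2 hX
  have h1 : ((‖r • X‖ : ℝ) : ℂ) ^ (-((m + 1 : ℕ) : ℂ) - ν) =
      ((|r| : ℝ) : ℂ) ^ (-((m + 1 : ℕ) : ℂ) - ν) * ((‖X‖ : ℝ) : ℂ) ^ (-((m + 1 : ℕ) : ℂ) - ν) := by
    rw [norm_smul, Real.norm_eq_abs, Complex.ofReal_mul,
      Complex.mul_cpow_ofReal_nonneg (abs_nonneg r) hX0.le]
  rcases lt_or_gt_of_ne hr with h | h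
  · have h2 : ‖r • X‖⁻¹ • (r • X) = -(‖X‖⁻¹ • X) := by
      rw [norm_smul, Real.norm_of_nonpos h.le, smul_smul, ← neg_smul]
      congr 1
      field_simp
    have h3 : sgnPow δ r = sgnPow δ (-1) := by
      rw [sgnPow, sgnPow, Real.sign_of_neg h, Real.sign_of_neg (by norm_num)]
    rw [homogExtension, homogExtension, h1, h2, h3, neg_neg]
    linear_combination (-(1 / 2) * ((|r| : ℝ) : ℂ) ^ (-((m + 1 : ℕ) : ℂ) - ν) *
      ((‖X‖ : ℝ) : ℂ) ^ (-((m + 1 : ℕ) : ℂ) - ν) * G (-(‖X‖⁻¹ • X))) * sgnPow_neg_one_mul_self δ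
  · have h2 : ‖r • X‖⁻¹ • (r • X) = ‖X‖⁻¹ • X := by
      rw [norm_smul, Real.norm_of_nonneg h.le, smul_smul]
      congr 1
      field_simp
    rw [homogExtension, homogExtension, h1, h2, sgnPow_of_pos _ h, one_mul]
    ring

theorem contDiffOn_homogExtension (ν : ℂ) (δ : ZMod 2) {G : Ambient m → ℂ} (hG : ContDiff ℝ ∞ G) :
    ContDiffOn ℝ ∞ (homogExtension ν δ G) {0}ᶜ := by
  have hn : ContDiffOn ℝ ∞ (fun X : Ambient m => ‖X‖) {0}ᶜ := fun X hX =>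
    (contDiffAt_norm ℝ hX).contDiffWithinAt
  have hu : ContDiffOn ℝ ∞ (fun X : Ambient m => ‖X‖⁻¹ • X) {0}ᶜ :=
    (hn.inv fun X hX => norm_ne_zero_iff.2 hX).smul contDiffOn_id
  have h1 := contDiffOn_ofReal_cpow hn (fun X hX => norm_pos_iff.2 hX) (-((m + 1 : ℕ) : ℂ) - ν)
  exact h1.mul (contDiffOn_const.mul ((hG.comp_contDiffOn hu).add
    (contDiffOn_const.mul (hG.comp_contDiffOn hu.neg))))

theorem homogExtension_sphere (ν : ℂ) (δ : ZMod 2) (G : Ambient m → ℂ)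
    (ξ : Metric.sphere (0 : Ambient m) 1) : homogExtension ν δ G ξ =
      1 / 2 * (G ξ + sgnPow δ (-1) * G (-(ξ : Ambient m))) := by
  have hξ : ‖(ξ : Ambient m)‖ = 1 := norm_eq_of_mem_sphere ξ
  rw [homogExtension, hξ, Complex.ofReal_one, Complex.one_cpow, one_mul, inv_one, one_smul]

theorem measurePreserving_neg_sphere : MeasurePreserving
    (fun ξ : Metric.sphere (0 : Ambient m) 1 => -ξ) (sphereMeasure m) (sphereMeasure m) := by
  have hmeas : Measurable (fun ξ : Metric.sphere (0 : Ambient m) 1 => -ξ) :=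
    continuous_neg.measurable
  refine ⟨hmeas, ?_⟩
  ext s hs
  rw [Measure.map_apply hmeas hs, Measure.toSphere_apply' _ (hmeas hs),
    Measure.toSphere_apply' _ hs]
  congr 1
  have h1 : (Subtype.val '' ((fun ξ : Metric.sphere (0 : Ambient m) 1 => -ξ) ⁻¹' s)) =
      -(Subtype.val '' s : Set (Ambient m)) := by
    ext X
    constructor
    · rintro ⟨ξ, hξ, rfl⟩
      exact ⟨-ξ, hξ, rfl⟩
    · rintro ⟨ξ, hξ, hX⟩
      refine ⟨-ξ, by simpa using hξ, ?_⟩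
      have : (ξ : Ambient m) = -X := hX
      simp [this]
  rw [h1, Set.smul_neg, Measure.measure_neg]

/-- Homogeneous extension does not increase the distance to a homogeneous function in `L²(S)`. -/
theorem eLpNorm_homogExtension_sub_le {ν : ℂ} {δ : ZMod 2} {G h : Ambient m → ℂ}
    (hG : AEStronglyMeasurable (fun ξ : Metric.sphere (0 : Ambient m) 1 => G ξ) (sphereMeasure m))
    (hh : IsHomog m ν δ h)
    (hm : AEStronglyMeasurable (fun ξ : Metric.sphere (0 : Ambient m) 1 => h ξ) (sphereMeasure m)) :
    eLpNorm (fun ξ : Metric.sphere (0 : Ambient m) 1 => homogExtension ν δ G ξ - h ξ) 2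
        (sphereMeasure m) ≤
      eLpNorm (fun ξ : Metric.sphere (0 : Ambient m) 1 => G ξ - h ξ) 2 (sphereMeasure m) := by
  -- the extension is the projection to the part of parity `δ`, which fixes `h`; it is the mean of
  -- two isometries
  set D : Metric.sphere (0 : Ambient m) 1 → ℂ := fun ξ => G ξ - h ξ with hD
  have hDm : AEStronglyMeasurable D (sphereMeasure m) := hG.sub hm
  have hmp := measurePreserving_neg_sphere (m := m)
  have hDn : AEStronglyMeasurable (fun ξ => D (-ξ)) (sphereMeasure m) :=
    hDm.comp_measurePreserving hmp
  have hcomp : eLpNorm (fun ξ => D (-ξ)) 2 (sphereMeasure m) = eLpNorm D 2 (sphereMeasure m) := by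
    clear_value D
    exact eLpNorm_comp_measurePreserving (p := 2) hDm hmp
  have h1 : (fun ξ : Metric.sphere (0 : Ambient m) 1 => homogExtension ν δ G ξ - h ξ) =
      (1 / 2 : ℂ) • (D + sgnPow δ (-1) • fun ξ => D (-ξ)) := by
    ext ξ
    have h2 : h (-(ξ : Ambient m)) = sgnPow δ (-1) * h ξ := hh.neg (sphere_ne_zero ξ)
    rw [homogExtension_sphere]
    simp only [Pi.smul_apply, Pi.add_apply, smul_eq_mul, hD]
    change _ = 1 / 2 * (G ξ - h ξ + sgnPow δ (-1) * (G (-(ξ : Ambient m)) - h (-(ξ : Ambient m))))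
    rw [h2]
    linear_combination (1 / 2 * h ξ) * sgnPow_neg_one_mul_self δ
  have hs : ‖sgnPow δ (-1)‖ₑ ≤ 1 := by
    rw [← ofReal_norm, ← ENNReal.ofReal_one]
    exact ENNReal.ofReal_le_ofReal (norm_sgnPow_le _ _)
  rw [h1, eLpNorm_const_smul]
  calc _ ≤ ‖(1 / 2 : ℂ)‖ₑ * (eLpNorm D 2 (sphereMeasure m) + eLpNorm D 2 (sphereMeasure m)) := by
        gcongr
        refine (eLpNorm_add_le hDm (hDn.const_smul _) (by norm_num)).trans ?_
        gcongr
        rw [eLpNorm_const_smul]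
        refine (mul_le_of_le_one_left zero_le hs).trans (le_of_eq ?_)
        exact hcomp
    _ = eLpNorm D 2 (sphereMeasure m) := by
        rw [← two_mul, ← mul_assoc, ← ofReal_norm]
        norm_num
        rw [ENNReal.ofReal_div_of_pos two_pos]
        simp
        rw [ENNReal.inv_mul_cancel (by simp) (by simp), one_mul]

/-- Smooth vectors are dense in `V m ν δ`. -/
theorem exists_mem_VSmooth_eLpNorm_sub_le {ν : ℂ} {δ : ZMod 2} {f : Ambient m → ℂ}
    (hf : f ∈ V m ν δ) {ε : ℝ} (hε : 0 < ε) : ∃ F ∈ VSmooth m ν δ,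
      eLpNorm (fun ξ : Metric.sphere (0 : Ambient m) 1 => F ξ - f ξ) 2 (sphereMeasure m) ≤
        ENNReal.ofReal ε := by
  have hemb : MeasurableEmbedding (Subtype.val : Metric.sphere (0 : Ambient m) 1 → Ambient m) :=
    MeasurableEmbedding.subtype_coe Metric.isClosed_sphere.measurableSet
  set ρ : Measure (Ambient m) := (sphereMeasure m).map Subtype.val with hρ
  have hfin : IsFiniteMeasure ρ := Measure.isFiniteMeasure_map _ _
  have hfρ : MemLp f 2 ρ := hemb.memLp_map_measure_iff.2 hf.2
  -- a test function on the ambient space, close to `f` for the surface measure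
  obtain ⟨G, -, hG, hGε⟩ := hfρ.exist_eLpNorm_sub_le (by simp) (by norm_num) hε
  have hGm : AEStronglyMeasurable (fun ξ : Metric.sphere (0 : Ambient m) 1 => G ξ)
      (sphereMeasure m) := (hG.continuous.comp continuous_subtype_val).aestronglyMeasurable
  rw [hemb.eLpNorm_map_measure] at hGε
  refine ⟨homogExtension ν δ G, ⟨contDiffOn_homogExtension ν δ hG, isHomog_homogExtension ν δ G⟩,
    (eLpNorm_homogExtension_sub_le hGm hf.1 hf.2.1).trans (le_trans (le_of_eq ?_) hGε)⟩
  exact eLpNorm_sub_comm (fun ξ : Metric.sphere (0 : Ambient m) 1 => G ξ) (fun ξ => f ξ) 2 _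

theorem VSmooth_sub {ν : ℂ} {δ : ZMod 2} {f g : Ambient m → ℂ} (hf : f ∈ VSmooth m ν δ)
    (hg : g ∈ VSmooth m ν δ) : (fun X => f X - g X) ∈ VSmooth m ν δ :=
  ⟨hf.1.sub hg.1, hf.2.sub hg.2⟩

theorem symplecticFourier_sub (Φ Ψ : 𝓢(Ambient m, ℂ)) :
    symplecticFourier (Φ - Ψ) = symplecticFourier Φ - symplecticFourier Ψ := by
  simp only [symplecticFourier, sub_eq_add_neg, FourierTransform.fourier_add,
    FourierTransform.fourier_neg, map_add, map_neg]

/-- Additivity of the Knapp–Stein operator, from its representation as a Mellin average. -/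
theorem knappStein_sub {μ : ℂ} {δ : ZMod 2} (hre : -((m + 1 : ℕ) : ℝ) < μ.re)
    {f g : Ambient m → ℂ} (hf : f ∈ VSmooth m (-μ) δ) (hg : g ∈ VSmooth m (-μ) δ)
    {Y : Ambient m} (hY : Y ≠ 0) :
    knappStein m μ δ (fun X => f X - g X) Y = knappStein m μ δ f Y - knappStein m μ δ g Y := by
  have h1 : ∀ X, generatorFourier (VSmooth_sub hf hg).1 X =
      generatorFourier hf.1 X - generatorFourier hg.1 X := by
    intro X
    have h2 : generator (VSmooth_sub hf hg).1 = generator hf.1 - generator hg.1 := by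
      ext X
      simp only [generator_apply, truncate, sub_apply]
      ring
    rw [generatorFourier, h2, symplecticFourier_sub]
    rfl
  have ha : -1 < (((m + 1 : ℕ) : ℂ) - 1 + μ).re := by
    simp only [Complex.add_re, Complex.sub_re, Complex.natCast_re, Complex.one_re]
    linarith
  rw [knappStein_eq_rayMellin (VSmooth_sub hf hg) hre hY, knappStein_eq_rayMellin hf hre hY,
    knappStein_eq_rayMellin hg hre hY, rayMellin, rayMellin, rayMellin,
    ← integral_sub (integrableOn_ray _ ha hY) (integrableOn_ray _ ha hY)]
  refine integral_congr_ae (Eventually.of_forall fun r => ?_)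
  simp only [h1]
  ring

/-- On the unitary axis, the Knapp–Stein operator is defined on all of `V m (-μ) δ`: it is
isometric on the dense subspace of smooth vectors. -/
theorem exists_knappSteinGraph {μ : ℂ} {δ : ZMod 2} (hre : μ.re = 0) (hμ : μ ∉ poles m δ)
    {f : Ambient m → ℂ} (hf : f ∈ V m (-μ) δ) : ∃ g, KnappSteinGraph m μ δ f g := by
  have hpos : -((m + 1 : ℕ) : ℝ) < μ.re := by
    rw [hre]; push_cast; have : (0 : ℝ) ≤ m := by positivity
    linarith
  choose F hF hFf using fun k : ℕ => exists_mem_VSmooth_eLpNorm_sub_le hf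
    (show (0 : ℝ) < (1 / 2) ^ k by positivity)
  have hlim : Tendsto (fun k : ℕ => ENNReal.ofReal ((1 / 2) ^ k)) atTop (𝓝 0) := by
    rw [← ENNReal.ofReal_zero]
    exact ENNReal.tendsto_ofReal (tendsto_pow_atTop_nhds_zero_of_lt_one (by norm_num) (by norm_num))
  set K : ℕ → Metric.sphere (0 : Ambient m) 1 → ℂ := fun k ξ => knappStein m μ δ (F k) ξ with hK
  have hKm : ∀ k, MemLp (K k) 2 (sphereMeasure m) := fun k => memLp_sphere
      (knappStein_mem hμ (hF k)).1
  have hFm : ∀ k, AEStronglyMeasurable (fun ξ : Metric.sphere (0 : Ambient m) 1 => F k ξ)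
    (sphereMeasure m) := fun k => (memLp_sphere (hF k).1).1
  have hcau : ∀ k l, eLpNorm (K k - K l) 2 (sphereMeasure m) ≤
      ENNReal.ofReal ((1 / 2) ^ k) + ENNReal.ofReal ((1 / 2) ^ l) := by
    intro k l
    have h1 : K k - K l = fun ξ : Metric.sphere (0 : Ambient m) 1 =>
        knappStein m μ δ (fun X => F k X - F l X) ξ := by
      ext ξ
      rw [knappStein_sub hpos (hF k) (hF l) (sphere_ne_zero ξ)]
      rfl
    have h2 : (fun ξ : Metric.sphere (0 : Ambient m) 1 => F k ξ - F l ξ) =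
        (fun ξ : Metric.sphere (0 : Ambient m) 1 => F k ξ - f ξ) -
        (fun ξ : Metric.sphere (0 : Ambient m) 1 => F l ξ - f ξ) := by
      ext ξ
      simp
    rw [h1, eLpNorm_knappStein hre hμ (VSmooth_sub (hF k) (hF l)), h2]
    exact (eLpNorm_sub_le ((hFm k).sub hf.2.1) ((hFm l).sub hf.2.1) (by norm_num)).trans
      (add_le_add (hFf k) (hFf l))
  obtain ⟨G, hG, hGlim⟩ := Lp.cauchy_complete_eLpNorm (p := 2) (by norm_num) hKm
    (B := fun N => ENNReal.ofReal (3 * (1 / 2) ^ N)) (by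
      rw [← ENNReal.ofReal_tsum_of_nonneg (fun _ => by positivity)
        ((summable_geometric_of_lt_one (by norm_num) (by norm_num)).mul_left 3)]
      exact ENNReal.ofReal_ne_top) (fun N k l hk hl => by
      refine (hcau k l).trans_lt ?_
      rw [← ENNReal.ofReal_add (by positivity) (by positivity)]
      refine (ENNReal.ofReal_lt_ofReal_iff (by positivity)).2 ?_
      have h1 : (1 / 2 : ℝ) ^ k ≤ (1 / 2) ^ N :=
        pow_le_pow_of_le_one (by norm_num) (by norm_num) hk
      have h2 : (1 / 2 : ℝ) ^ l ≤ (1 / 2) ^ N :=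
        pow_le_pow_of_le_one (by norm_num) (by norm_num) hl
      have h3 : (0 : ℝ) < (1 / 2) ^ N := by positivity
      linarith)
  -- the limit in `L²(S)` is only defined almost everywhere; its homogeneous extension has the right
  -- parity everywhere
  set G' : Ambient m → ℂ := Function.extend Subtype.val G 0 with hG'
  have hG'e : (fun ξ : Metric.sphere (0 : Ambient m) 1 => G' ξ) = G := by
    ext ξ
    exact Subtype.val_injective.extend_apply _ _ _
  have hG'm : AEStronglyMeasurable (fun ξ : Metric.sphere (0 : Ambient m) 1 => G' ξ)
      (sphereMeasure m) := by rw [hG'e]; exact hG.1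
  have hle : ∀ k, eLpNorm (fun ξ : Metric.sphere (0 : Ambient m) 1 =>
      homogExtension μ δ G' ξ - knappStein m μ δ (F k) ξ) 2 (sphereMeasure m) ≤
      eLpNorm (K k - G) 2 (sphereMeasure m) := by
    intro k
    refine (eLpNorm_homogExtension_sub_le hG'm (knappStein_mem hμ (hF k)).2 (hKm k).1).trans
      (le_of_eq ?_)
    rw [eLpNorm_sub_comm (K k) G, ← hG'e]
    rfl
  have hgm : AEStronglyMeasurable (fun ξ : Metric.sphere (0 : Ambient m) 1 =>
      homogExtension μ δ G' ξ) (sphereMeasure m) := by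
    have h1 : (fun ξ : Metric.sphere (0 : Ambient m) 1 => homogExtension μ δ G' ξ) =
        fun ξ => 1 / 2 * (G ξ + sgnPow δ (-1) * G (-ξ)) := by
      ext ξ
      rw [homogExtension_sphere, ← hG'e]
      rfl
    rw [h1]
    exact (hG.1.add ((hG.1.comp_measurePreserving measurePreserving_neg_sphere).const_mul _)).const_mul _
  refine ⟨homogExtension μ δ G', hf, ⟨isHomog_homogExtension μ δ G', ?_⟩, F, hF,
    tendsto_of_tendsto_of_tendsto_of_le_of_le tendsto_const_nhds hlim (fun _ => zero_le) hFf, ?_⟩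
  · have h1 : MemLp (fun ξ : Metric.sphere (0 : Ambient m) 1 =>
        homogExtension μ δ G' ξ - knappStein m μ δ (F 0) ξ) 2 (sphereMeasure m) :=
      ⟨hgm.sub (hKm 0).1, (hle 0).trans_lt ((hKm 0).sub hG).2⟩
    have h2 := h1.add (hKm 0)
    refine h2.ae_eq (Eventually.of_forall fun ξ => ?_)
    simp [hK]
  · refine tendsto_of_tendsto_of_tendsto_of_le_of_le tendsto_const_nhds hGlim (fun _ => zero_le)
      fun k => le_trans (le_of_eq ?_) (hle k)
    exact eLpNorm_sub_comm (fun ξ : Metric.sphere (0 : Ambient m) 1 => knappStein m μ δ (F k) ξ)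
      (fun ξ => homogExtension μ δ G' ξ) 2 _

/-! ### The partial Fourier transform on square integrable functions -/

variable {m : ℕ}

theorem eLpNorm_fourier_schwartz {W : Type*} [NormedAddCommGroup W] [InnerProductSpace ℝ W]
    [FiniteDimensional ℝ W] [MeasurableSpace W] [BorelSpace W] (ψ : 𝓢(W, ℂ)) :
    eLpNorm (𝓕 ψ : 𝓢(W, ℂ)) 2 = eLpNorm ψ 2 := by
  have h := SchwartzMap.norm_fourier_toL2_eq ψ
  rw [SchwartzMap.norm_toLp, SchwartzMap.norm_toLp] at h
  have h1 : MemLp (𝓕 ψ : 𝓢(W, ℂ)) 2 (volume : Measure W) := (𝓕 ψ : 𝓢(W, ℂ)).memLp 2 volume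
  have h2 : MemLp ψ 2 (volume : Measure W) := ψ.memLp 2 volume
  exact (ENNReal.toReal_eq_toReal_iff' h1.eLpNorm_ne_top h2.eLpNorm_ne_top).1 h

theorem lintegral_enorm_sq_eq {α : Type*} [MeasurableSpace α] {μ : Measure α} (f : α → ℂ) :
    ∫⁻ x, ‖f x‖ₑ ^ (2 : ℝ) ∂μ = eLpNorm f 2 μ ^ (2 : ℝ) := by
  have h := eLpNorm_nnreal_pow_eq_lintegral (f := f) (μ := μ) (p := 2) (by norm_num)
  exact h.symm

/-- Plancherel's theorem for the partial Fourier transform, from Plancherel's theorem on each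
slice. -/
theorem eLpNorm_fourierHeis (φ : 𝓢(Heis m, ℂ)) :
    eLpNorm (fourierHeis (φ : Heis m → ℂ)) 2 = eLpNorm φ 2 := by
  have hslice : ∀ x : EuclideanSpace ℝ (Fin m),
      ∫⁻ w, ‖partialFourier (splitHeis φ) (x, w)‖ₑ ^ (2 : ℝ) =
        ∫⁻ w, ‖splitHeis φ (x, w)‖ₑ ^ (2 : ℝ) := by
    intro x
    have h := eLpNorm_fourier_schwartz (slice (splitHeis φ) x)
    have h1 := lintegral_enorm_sq_eq (μ := volume) (𝓕 (slice (splitHeis φ) x) : 𝓢(Half m, ℂ))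
    have h2 := lintegral_enorm_sq_eq (μ := volume) (slice (splitHeis φ) x)
    rw [h, ← h2] at h1
    exact h1
  have hmp := measurePreserving_heisEquiv (m := m)
  have hemb := (heisEquiv m).toHomeomorph.measurableEmbedding
  have h0 : ∫⁻ p, ‖fourierHeis φ p‖ₑ ^ (2 : ℝ) = ∫⁻ p, ‖φ p‖ₑ ^ (2 : ℝ) := by
    have e1 := hmp.lintegral_comp_emb hemb (fun p => ‖fourierHeis φ p‖ₑ ^ (2 : ℝ))
    have e2 := hmp.lintegral_comp_emb hemb (fun p => ‖φ p‖ₑ ^ (2 : ℝ))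
    rw [← e1, ← e2]
    simp only [fourierHeis_heisEquiv]
    have m1 : AEMeasurable (fun p => ‖partialFourier (splitHeis φ) p‖ₑ ^ (2 : ℝ))
        ((volume : Measure (EuclideanSpace ℝ (Fin m))).prod (volume : Measure (Half m))) :=
      ((continuous_partialFourier _).measurable.enorm.pow_const _).aemeasurable
    have m2 : AEMeasurable (fun p => ‖splitHeis φ p‖ₑ ^ (2 : ℝ))
        ((volume : Measure (EuclideanSpace ℝ (Fin m))).prod (volume : Measure (Half m))) :=
      ((splitHeis φ).continuous.measurable.enorm.pow_const _).aemeasurable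
    refine (lintegral_prod _ m1).trans (Eq.trans ?_ (lintegral_prod _ m2).symm)
    exact lintegral_congr hslice
  rw [lintegral_enorm_sq_eq, lintegral_enorm_sq_eq] at h0
  exact ENNReal.rpow_left_injective two_ne_zero h0

theorem memLp_fourierHeis (φ : 𝓢(Heis m, ℂ)) : MemLp (fourierHeis (φ : Heis m → ℂ)) 2 :=
  ⟨(continuous_fourierHeis φ).aestronglyMeasurable, by
    have h : MemLp φ 2 (volume : Measure (Heis m)) := φ.memLp 2
    rw [eLpNorm_fourierHeis]; exact h.eLpNorm_lt_top⟩

theorem fourierHeis_add (φ ψ : 𝓢(Heis m, ℂ)) :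
    fourierHeis (φ + ψ : 𝓢(Heis m, ℂ)) = fourierHeis φ + fourierHeis (ψ : Heis m → ℂ) := by
  ext p
  have h : ∀ x, slice (splitHeis (φ + ψ)) x = slice (splitHeis φ) x + slice (splitHeis ψ) x :=
    fun _ => rfl
  simp only [Pi.add_apply, fourierHeis_eq, partialFourier, h, FourierTransform.fourier_add]
  rfl

theorem fourierHeis_smul (c : ℂ) (φ : 𝓢(Heis m, ℂ)) :
    fourierHeis (c • φ : 𝓢(Heis m, ℂ)) = c • fourierHeis (φ : Heis m → ℂ) := by
  ext p
  have h : ∀ x, slice (splitHeis (c • φ)) x = c • slice (splitHeis φ) x := fun _ => rfl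
  simp only [Pi.smul_apply, fourierHeis_eq, partialFourier, h, FourierTransform.fourier_smul]
  rfl

/-- The partial Fourier transform of Schwartz functions, with values in `L²`. -/
def fourierHeisL2 (m : ℕ) : 𝓢(Heis m, ℂ) →ₗ[ℂ] Lp ℂ 2 (volume : Measure (Heis m)) where
  toFun φ := (memLp_fourierHeis φ).toLp _
  map_add' φ ψ := by
    rw [← MemLp.toLp_add]
    exact MemLp.toLp_congr _ _ (by rw [fourierHeis_add])
  map_smul' c φ := by
    rw [RingHom.id_apply, ← MemLp.toLp_const_smul]
    exact MemLp.toLp_congr _ _ (by rw [fourierHeis_smul])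

theorem MemLp.conj {α : Type*} [MeasurableSpace α] {μ : Measure α} {f : α → ℂ} {p : ENNReal}
    (hf : MemLp f p μ) : MemLp (fun x => conj (f x)) p μ :=
  hf.of_le (Complex.continuous_conj.comp_aestronglyMeasurable hf.1)
    (Eventually.of_forall fun x => by rw [RCLike.norm_conj])

/-- Every square integrable function has a square integrable partial Fourier transform: the
transform of test functions extends to a bounded operator on `L²`, and the transform of `F` is
`F` composed with it, represented by means of the adjoint. -/
theorem exists_isFourier {F : Heis m → ℂ} (hF : MemLp F 2) :
    ∃ H : Heis m → ℂ, MemLp H 2 ∧ IsFourier F H := by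
  set e : 𝓢(Heis m, ℂ) →ₗ[ℂ] Lp ℂ 2 (volume : Measure (Heis m)) :=
    (SchwartzMap.toLpCLM ℂ ℂ 2 (volume : Measure (Heis m))).toLinearMap with he
  have hd : DenseRange e :=
    SchwartzMap.denseRange_toLpCLM (E := Heis m) (F := ℂ) (μ := volume) (p := 2) (by norm_num)
  have hn : ∃ C, ∀ φ, ‖fourierHeisL2 m φ‖ ≤ C * ‖e φ‖ := by
    refine ⟨1, fun φ => le_of_eq ?_⟩
    have h1 : ‖fourierHeisL2 m φ‖ = (eLpNorm (fourierHeis φ) 2).toReal :=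
      Lp.norm_toLp _ (memLp_fourierHeis φ)
    have h2 : ‖e φ‖ = (eLpNorm φ 2).toReal := SchwartzMap.norm_toLp
    rw [h1, h2, one_mul, eLpNorm_fourierHeis]
  set A := (fourierHeisL2 m).extendOfNorm e with hA
  have hAe : ∀ φ, A (e φ) = fourierHeisL2 m φ := LinearMap.extendOfNorm_eq hd hn
  set h := ContinuousLinearMap.adjoint A ((MemLp.conj hF).toLp _) with hh
  refine ⟨fun p => conj (h p), MemLp.conj (Lp.memLp h), fun φ => ?_⟩
  have key : inner ℂ h (e φ) = inner ℂ ((MemLp.conj hF).toLp _) (fourierHeisL2 m φ) := by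
    rw [hh, ContinuousLinearMap.adjoint_inner_left, hAe]
  rw [L2.inner_def, L2.inner_def] at key
  simp only [RCLike.inner_apply] at key
  have e1 : ∀ᵐ p, e φ p = φ p := φ.coeFn_toLp 2 volume
  have e2 : ∀ᵐ p, fourierHeisL2 m φ p = fourierHeis φ p := (memLp_fourierHeis φ).coeFn_toLp
  have e3 : ∀ᵐ p, (MemLp.conj hF).toLp _ p = conj (F p) := (MemLp.conj hF).coeFn_toLp
  calc _ = ∫ p, e φ p * conj (h p) := by
        refine integral_congr_ae ?_
        filter_upwards [e1] with p hp
        rw [hp, mul_comm]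
    _ = _ := key
    _ = fourierDist F φ := by
        refine integral_congr_ae ?_
        filter_upwards [e2, e3] with p hp hp'
        rw [hp, hp', Complex.conj_conj, mul_comm]

/-! ### The algebraic operator on square integrable functions -/

theorem measurable_algOp_factor (μ : ℂ) (δ : ZMod 2) :
    Measurable fun p : Heis m => ((|p.1 / 2| : ℝ) : ℂ) ^ μ * sgnPow δ p.1 := by
  have h1 : Measurable fun p : Heis m => |p.1 / 2| := (measurable_fst.div_const 2).norm
  exact ((Complex.measurable_ofReal.comp h1).pow_const _).mul
    ((measurable_sgnPow δ).comp measurable_fst)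

/-- The algebraic operator is its own transpose. -/
theorem integral_algOp_mul (μ : ℂ) (δ : ZMod 2) {H φ : Heis m → ℂ}
    (hH : AEStronglyMeasurable H) (hφ : AEStronglyMeasurable φ) :
    ∫ p, algOp μ δ H p * φ p = ∫ p, H p * algOp μ δ φ p := by
  have hmp := measurePreserving_swapMap (m := m)
  set G : Heis m → ℂ := fun p => H p * algOp μ δ φ p with hG
  have hGm : AEStronglyMeasurable G (volume : Measure (Heis m)) :=
    hH.mul ((measurable_algOp_factor μ δ).aestronglyMeasurable.mul (hφ.comp_measurePreserving hmp))
  have h1 : ∫ p, G (swapMap p) = ∫ p, G p := by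
    rw [← integral_map hmp.aemeasurable (by rw [hmp.map_eq]; exact hGm), hmp.map_eq]
  rw [← h1]
  refine integral_congr_ae ?_
  filter_upwards [ae_fst_ne_zero] with p hp
  simp only [hG, algOp_eq, swapMap_swapMap hp]
  rw [show (swapMap p).1 = p.1 from rfl]
  ring

theorem memLp_algOp {μ : ℂ} (hμ : μ.re = 0) (δ : ZMod 2) {H : Heis m → ℂ} (hH : MemLp H 2) :
    MemLp (algOp μ δ H) 2 := by
  have h1 : MemLp (fun p => H (swapMap p)) 2 (volume : Measure (Heis m)) :=
    hH.comp_measurePreserving measurePreserving_swapMap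
  refine h1.of_le ((measurable_algOp_factor μ δ).aestronglyMeasurable.mul h1.1) ?_
  filter_upwards [ae_fst_ne_zero] with p hp
  have h2 : 0 < |p.1 / 2| := abs_pos.2 (div_ne_zero hp two_ne_zero)
  rw [algOp_eq, norm_mul, norm_mul, Complex.norm_cpow_eq_rpow_re_of_pos h2, hμ, Real.rpow_zero,
    one_mul]
  exact mul_le_of_le_one_left (norm_nonneg _) (norm_sgnPow_le _ _)

/-- Square integrable functions are determined by their pairings with the test functions on
`ρ ≠ 0`. -/
theorem ae_eq_of_forall_testFunctions {H K : Heis m → ℂ} (hH : MemLp H 2) (hK : MemLp K 2)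
    (h : ∀ φ ∈ TestFunctions m, ∫ p, H p * φ p = ∫ p, K p * φ p) : H =ᵐ[volume] K := by
  have hU : IsOpen {p : Heis m | p.1 ≠ 0} := isOpen_ne_fun continuous_fst continuous_const
  have hl : LocallyIntegrable (fun p => H p - K p) (volume : Measure (Heis m)) :=
    (hH.sub hK).locallyIntegrable (by norm_num)
  have h0 := hU.ae_eq_zero_of_integral_contDiff_smul_eq_zero
      (hl.locallyIntegrableOn _) fun g hg hc hs => by
    set φ : Heis m → ℂ := fun p => (g p : ℂ) with hφ
    have hφc : HasCompactSupport φ := hc.comp_left (g := fun r : ℝ => (r : ℂ)) Complex.ofReal_zero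
    have hφd : ContDiff ℝ ∞ φ := Complex.ofRealCLM.contDiff.comp hg
    have hφs : tsupport φ ⊆ {p | p.1 ≠ 0} := by
      refine (closure_mono fun p hp => ?_).trans hs
      simpa [hφ] using hp
    have hφL : MemLp φ 2 (volume : Measure (Heis m)) :=
        hφd.continuous.memLp_of_hasCompactSupport hφc
    have h1 := h φ ⟨hφd, hφc, hφs⟩
    have i1 : Integrable (fun p => H p * φ p) := hH.integrable_mul hφL
    have i2 : Integrable (fun p => K p * φ p) := hK.integrable_mul hφL
    rw [← sub_eq_zero, ← integral_sub i1 i2] at h1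
    rw [← h1]
    refine integral_congr_ae (Eventually.of_forall fun p => ?_)
    simp only [hφ, Complex.real_smul]
    ring
  filter_upwards [h0, ae_fst_ne_zero] with p hp hp0
  exact sub_eq_zero.1 (hp hp0)

/-- On the unitary axis, the transforms of `f` and of its image under the Knapp–Stein operator are
square integrable, and are exchanged by the algebraic operator. -/
theorem KnappSteinGraph.exists_isFourier {μ : ℂ} {δ : ZMod 2} (hre : μ.re = 0)
    (hμ : μ ∉ poles m δ) {f g : Ambient m → ℂ} (h : KnappSteinGraph m μ δ f g) :
    MemLp (toN f) 2 ∧ MemLp (toN g) 2 ∧ ∃ H : Heis m → ℂ, MemLp H 2 ∧ MemLp (algOp μ δ H) 2 ∧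
      IsFourier (toN f) H ∧ IsFourier (toN g) (algOp μ δ H) := by
  have hf : MemLp (toN f) 2 := memLp_toN (by simp [hre]) h.1
  have hg : MemLp (toN g) 2 := memLp_toN hre h.2.1
  obtain ⟨H, hH, hHf⟩ := KnappStein.exists_isFourier hf
  obtain ⟨K, hK, hKg⟩ := KnappStein.exists_isFourier hg
  have hA := memLp_algOp hre δ hH
  have hKA : K =ᵐ[volume] algOp μ δ H := by
    refine ae_eq_of_forall_testFunctions hK hA fun φ hφ => ?_
    have h1 := hKg (testSchwartz hφ)
    have h2 := hHf (testSchwartz (algOp_mem_testFunctions hφ μ δ))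
    rw [coe_testSchwartz] at h1 h2
    rw [h1, h.fourierDist_eq hμ hφ, ← h2,
      integral_algOp_mul μ δ hH.1 hφ.1.continuous.aestronglyMeasurable]
  refine ⟨hf, hg, H, hH, hA, hHf, fun φ => ?_⟩
  rw [← hKg φ]
  refine integral_congr_ae ?_
  filter_upwards [hKA] with p hp
  rw [hp]

end KnappStein

end

theorem mainTheorem3 (m : ℕ) (μ : ℂ) (δ : ZMod 2) (hμ : μ ∉ KnappStein.poles m δ) :
    -- the normalized Knapp–Stein operator is well defined on smooth vectors
    (∀ f ∈ KnappStein.VSmooth m (-μ) δ,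
      (∀ Y : KnappStein.Ambient m, Y ≠ 0 →
        KnappStein.IsContinuation m δ f Y (KnappStein.continuation m δ f Y)) ∧
      KnappStein.knappStein m μ δ f ∈ KnappStein.VSmooth m μ δ ∧
      KnappStein.KnappSteinGraph m μ δ f (KnappStein.knappStein m μ δ f)) ∧
    -- the diagram commutes, as an identity of distributions on `ρ ≠ 0`
    (∀ f g : KnappStein.Ambient m → ℂ, KnappStein.KnappSteinGraph m μ δ f g →
      ∀ φ ∈ KnappStein.TestFunctions m,
        Integrable (fun p => KnappStein.toN f p *
          KnappStein.fourierXi (KnappStein.fourierT (KnappStein.algOp μ δ φ)) p) ∧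
        Integrable (fun p => KnappStein.toN g p *
          KnappStein.fourierXi (KnappStein.fourierT φ) p) ∧
        KnappStein.fourierDist (KnappStein.toN g) φ =
          KnappStein.algOpDist μ δ (KnappStein.fourierDist (KnappStein.toN f)) φ) ∧
    -- on the unitary axis, the diagram is one of everywhere defined operators on `L²`
    (μ.re = 0 → ∀ f ∈ KnappStein.V m (-μ) δ,
      (∃ g, KnappStein.KnappSteinGraph m μ δ f g) ∧
      ∀ g, KnappStein.KnappSteinGraph m μ δ f g →
        MemLp (KnappStein.toN f) 2 ∧ MemLp (KnappStein.toN g) 2 ∧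
        ∃ H : KnappStein.Heis m → ℂ, MemLp H 2 ∧ MemLp (KnappStein.algOp μ δ H) 2 ∧
          KnappStein.IsFourier (KnappStein.toN f) H ∧
          KnappStein.IsFourier (KnappStein.toN g) (KnappStein.algOp μ δ H)) := by
  refine ⟨fun f hf => ⟨fun Y hY => ?_, ?_, ?_⟩, fun f g h φ hφ => ⟨?_, ?_, ?_⟩, fun hre f hf =>
    ⟨KnappStein.exists_knappSteinGraph hre hμ hf, fun g h => h.exists_isFourier hre hμ⟩⟩
  · exact KnappStein.isContinuation_continuation hf hY
  · exact KnappStein.knappStein_mem hμ hf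
  · exact KnappStein.knappSteinGraph_knappStein hμ hf
  · exact KnappStein.integrable_toN_mul_fourierHeis
      (KnappStein.testSchwartz (KnappStein.algOp_mem_testFunctions hφ μ δ)) h.1
  · exact KnappStein.integrable_toN_mul_fourierHeis (KnappStein.testSchwartz hφ) h.2.1
  · exact h.fourierDist_eq hμ hφ
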